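/- Let $\mathbb K=\mathbb R$ or $\mathbb C$ and let $n,m,p\ge 1$. Everything is local at the origin and $\mathbb K$-analytic. Fix $p$ distinct pairs $(j(q),\beta(q))$ with $1\le j(q)\le m$, $\beta(q)\in\mathbb N^n$, $|\beta(q)|\ge 1$, and put $\kappa=\max_q|\beta(q)|$. Let $$(\mathcal E)\qquad y^j_{x^\alpha}(x)=F^j_\alpha\big(x,y(x),(y^{j(q)}_{x^{\beta(q)}}(x))_{1\le q\le p}\big),\qquad |\alpha|\le\kappa+1,\ \alpha\ne 0,\ (j,\alpha)\ne(j(q),\beta(q)),$$ be a completely integrable system for $y=y(x)\in\mathbb K^m$, $x\in\mathbb K^n$, with $F^j_\alpha$ analytic near $0\in\mathbb K^{n+m+p}$ and with $y=0$ as a solution. Complete integrability means the following. The skeleton $\{y^j_\alpha=F^j_\alpha\}$ in the space of $(\kappa+1)$-jets has coordinates $(x,y,(y^{j(q)}_{\beta(q)})_q)$; the contact distribution meets its tangent bundle along a rank-$n$ bundle, spanned by the restrictions $\mathsf D_1,\dots,\mathsf D_n$ of the total differentiation operators; and each bracket $[\mathsf D_i,\mathsf D_k]$ is a linear combination of $\mathsf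 D_1,\dots,\mathsf D_n$. Let $\mathcal M=\mathcal V_{\mathcal S}(\mathcal E)=\{y=\Pi(x,a,b)\}\subset\mathbb K^{n}_x\times\mathbb K^m_y\times\mathbb K^{p}_a\times\mathbb K^m_b$ be its submanifold of solutions: $\exp(x^n\mathsf D_n)(\cdots\exp(x^1\mathsf D_1)(0,b,a))=(x,\Pi(x,a,b),\Omega(x,a,b))$, where the point $(0,b,a)$ has coordinates $x=0$, $y=b$, $y^{j(q)}_{\beta(q)}=a^q$. Let $b=\Pi^*(a,x,y)$ be the dual equations of $\mathcal M$, i.e. $b\equiv\Pi^*(a,x,\Pi(x,a,b))$ and $y\equiv\Pi(x,a,\Pi^*(a,x,y))$, with $\Pi^*$ analytic and $\Pi^*(0)=0$. Assume that $\mathcal M$ is solvable with respect to the parameters by means of the pairs $(j(q),\beta(q))$: $b\mapsto\Pi(0,0,b)$ has rank $m$ at $0$ and $(a,b)\mapsto\big(\Pi(0,a,b),(\Pi^{j(q)}_{x^{\beta(q)}}(0,a,b))_q\big)$ has rank $m+p$ at $0$. Assume also that $\mathcal M$ is solvable with respect to the variables: there are $n$ distinct pairs $(j^*(l),\delta(l))$,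 $1\le j^*(l)\le m$, $\delta(l)\in\mathbb N^p$, $|\delta(l)|\ge1$, such that $(x,y)\mapsto\big(\Pi^*(0,x,y),(\Pi^{*\,j^*(l)}_{a^{\delta(l)}}(0,x,y))_l\big)$ has rank $m+n$ at $0$. Put $\kappa^*=\max_l|\delta(l)|$. Then there is a dual completely integrable system $$(\mathcal E^*)\qquad b^j_{a^\gamma}(a)=G^j_\gamma\big(a,b(a),(b^{j^*(l)}_{a^{\delta(l)}}(a))_{1\le l\le n}\big),\qquad |\gamma|\le\kappa^*+1,\ \gamma\ne0,\ (j,\gamma)\ne(j^*(l),\delta(l)),$$ with $G^j_\gamma$ analytic at $0$ and with $b=0$ as a solution, associated with the equations $b=\Pi^*(a,x,y)$: it is obtained from $b^j_{a^\gamma}=\Pi^{*\,j}_{a^\gamma}(a,x,y)$ by eliminating $(x,y)$ by means of $b=\Pi^*$ and $b^{j^*(l)}_{a^{\delta(l)}}=\Pi^{*\,j^*(l)}_{a^{\delta(l)}}$. Its submanifold of solutions $\mathcal V_{\mathcal S}(\mathcal E^*)$ is $\mathcal M$, written in the dual form $b=\Pi^*(a,x,y)$. Let $\mathfrak{SYM}(\mathcal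 E)$ be the set of germs at $0$ of analytic vector fields $\mathcal L$ in the $(x,y)$-space which are infinitesimal symmetries of $(\mathcal E)$: for all small $t\in\mathbb K$ the time-$t$ flow map of $\mathcal L$ transforms graphs of local solutions into graphs of local solutions (for solutions whose coordinates $(x,y,(y^{j(q)}_{x^{\beta(q)}})_q)$ lie in a neighborhood of $0$ that does not depend on $t$). Define $\mathfrak{SYM}(\mathcal E^*)$ likewise in the $(a,b)$-space. Let $\mathfrak{SYM}(\mathcal V_{\mathcal S}(\mathcal E))$, resp. $\mathfrak{SYM}(\mathcal V_{\mathcal S}(\mathcal E^*))$, be the set of germs at $0$ of vector fields $\mathcal L+\mathcal L^*$, with $\mathcal L$ analytic in the $(x,y)$-space and $\mathcal L^*$ analytic in the $(a,b)$-space, that are tangent to $\{y=\Pi\}$, resp. to $\{b=\Pi^*\}$. For every such dual system, these four sets are Lie algebras over $\mathbb K$ under the Lie bracket of vector fields, and there are Lie algebra isomorphisms $$\mathfrak{SYM}(\mathcal E)\simeq\mathfrak{SYM}(\mathcal V_{\mathcal S}(\mathcal E))=\mathfrak{SYM}(\mathcal V_{\mathcal S}(\mathcal E^*))\simeq\mathfrak{SYM}(\mathcal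 E^*),\qquad \mathcal L\longleftrightarrow\mathcal L+\mathcal L^*\longleftrightarrow\mathcal L^*.$$ -/

import Mathlib

open Filter Topology

/-! ### Lie algebra of germs at the origin of analytic vector fields -/

section VectorFieldGerms

/-- Germs at `0` of `𝕜`-analytic vector fields on the normed space `V`. -/
def analyticGerms (𝕜 V : Type*) [RCLike 𝕜] [NormedAddCommGroup V] [NormedSpace 𝕜 V] :
    Submodule 𝕜 (Germ (𝓝 (0 : V)) V) where
  carrier := {g | ∃ L : V → V, AnalyticAt 𝕜 L 0 ∧ g = (L : Germ (𝓝 (0 : V)) V)}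
  add_mem' := by
    rintro _ _ ⟨L, hL, rfl⟩ ⟨L', hL', rfl⟩
    exact ⟨L + L', hL.add hL', rfl⟩
  zero_mem' := ⟨0, analyticAt_const, rfl⟩
  smul_mem' := by
    rintro c _ ⟨L, hL, rfl⟩
    exact ⟨c • L, hL.const_smul, rfl⟩

/-- The type of germs at `0` of `𝕜`-analytic vector fields on `V`. -/
abbrev VFGerm (𝕜 V : Type*) [RCLike 𝕜] [NormedAddCommGroup V] [NormedSpace 𝕜 V] : Type _ :=
  analyticGerms 𝕜 V

namespace VFGerm

variable {𝕜 V V' : Type*} [RCLike 𝕜] [NormedAddCommGroup V] [NormedSpace 𝕜 V]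
  [NormedAddCommGroup V'] [NormedSpace 𝕜 V']

/-- The germ of a vector field that is analytic at the origin. -/
def mk (L : V → V) (hL : AnalyticAt 𝕜 L 0) : VFGerm 𝕜 V := ⟨(L : Germ (𝓝 (0 : V)) V), L, hL, rfl⟩

/-- A representative of a germ. -/
noncomputable def rep (g : VFGerm 𝕜 V) : V → V := g.2.choose

theorem rep_analytic (g : VFGerm 𝕜 V) : AnalyticAt 𝕜 g.rep 0 := g.2.choose_spec.1

theorem mk_rep (g : VFGerm 𝕜 V) : mk g.rep g.rep_analytic = g :=
  Subtype.ext g.2.choose_spec.2.symm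

theorem mk_eq_mk {L M : V → V} {hL : AnalyticAt 𝕜 L 0} {hM : AnalyticAt 𝕜 M 0} :
    mk L hL = mk M hM ↔ L =ᶠ[𝓝 0] M :=
  Subtype.ext_iff.trans Germ.coe_eq

theorem rep_mk {L : V → V} (hL : AnalyticAt 𝕜 L 0) : (mk L hL).rep =ᶠ[𝓝 0] L :=
  mk_eq_mk.1 (mk_rep (mk L hL))

theorem add_mk {L M : V → V} (hL : AnalyticAt 𝕜 L 0) (hM : AnalyticAt 𝕜 M 0) :
    mk L hL + mk M hM = mk (L + M) (hL.add hM) := rfl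

theorem smul_mk {L : V → V} (c : 𝕜) (hL : AnalyticAt 𝕜 L 0) :
    c • mk L hL = mk (c • L) hL.const_smul := rfl

variable [CompleteSpace V]

theorem analyticAt_lieBracket {L M : V → V} {z : V} (hL : AnalyticAt 𝕜 L z)
    (hM : AnalyticAt 𝕜 M z) : AnalyticAt 𝕜 (VectorField.lieBracket 𝕜 L M) z :=
  (((ContinuousLinearMap.apply 𝕜 V).flip.analyticAt_bilinear _).comp₂ hM.fderiv hL).sub
    (((ContinuousLinearMap.apply 𝕜 V).flip.analyticAt_bilinear _).comp₂ hL.fderiv hM)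

/-- The Lie bracket of germs is the germ of the Lie bracket of vector fields. -/
noncomputable instance : Bracket (VFGerm 𝕜 V) (VFGerm 𝕜 V) where
  bracket g h := mk (VectorField.lieBracket 𝕜 g.rep h.rep)
    (analyticAt_lieBracket g.rep_analytic h.rep_analytic)

theorem bracket_mk {L M : V → V} (hL : AnalyticAt 𝕜 L 0) (hM : AnalyticAt 𝕜 M 0) :
    ⁅mk L hL, mk M hM⁆ = mk (VectorField.lieBracket 𝕜 L M) (analyticAt_lieBracket hL hM) :=
  mk_eq_mk.2 ((rep_mk hL).lieBracket_vectorField (rep_mk hM))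

noncomputable instance : LieRing (VFGerm 𝕜 V) where
  add_lie x y z := by
    rw [← mk_rep x, ← mk_rep y, ← mk_rep z]
    simp only [add_mk, bracket_mk, mk_eq_mk]
    filter_upwards [x.rep_analytic.eventually_analyticAt, y.rep_analytic.eventually_analyticAt]
      with v hx hy
    exact VectorField.lieBracket_add_left hx.differentiableAt hy.differentiableAt
  lie_add x y z := by
    rw [← mk_rep x, ← mk_rep y, ← mk_rep z]
    simp only [add_mk, bracket_mk, mk_eq_mk]
    filter_upwards [z.rep_analytic.eventually_analyticAt, y.rep_analytic.eventually_analyticAt]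
      with v hz hy
    exact VectorField.lieBracket_add_right hy.differentiableAt hz.differentiableAt
  lie_self x := by
    rw [← mk_rep x, bracket_mk]
    refine (mk_eq_mk (hM := analyticAt_const)).2 (Eventually.of_forall fun v => ?_)
    simp [VectorField.lieBracket]
  leibniz_lie x y z := by
    rw [← mk_rep x, ← mk_rep y, ← mk_rep z]
    simp only [add_mk, bracket_mk, mk_eq_mk]
    filter_upwards [x.rep_analytic.eventually_analyticAt, y.rep_analytic.eventually_analyticAt,
      z.rep_analytic.eventually_analyticAt] with v hx hy hz
    exact VectorField.leibniz_identity_lieBracket (n := 2) (by simp) hx.contDiffAt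
      hy.contDiffAt hz.contDiffAt

noncomputable instance : LieAlgebra 𝕜 (VFGerm 𝕜 V) where
  lie_smul c x y := by
    rw [← mk_rep x, ← mk_rep y]
    simp only [smul_mk, bracket_mk, mk_eq_mk]
    filter_upwards [y.rep_analytic.eventually_analyticAt] with v hy
    exact VectorField.lieBracket_const_smul_right hy.differentiableAt

end VFGerm

end VectorFieldGerms
/-! ### Partial derivatives, systems of partial differential equations -/

section Systems

/-- First order partial derivative `∂f/∂xⁱ`. -/
noncomputable def pd {𝕜 : Type*} [RCLike 𝕜] {n : ℕ} (i : Fin n) (f : (Fin n → 𝕜) → 𝕜) :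
    (Fin n → 𝕜) → 𝕜 :=
  fun x => fderiv 𝕜 f x (Pi.single i 1)

/-- The partial derivative `∂^{|α|}f/∂x^α` for a multiindex `α ∈ ℕⁿ`. -/
noncomputable def mpd {𝕜 : Type*} [RCLike 𝕜] {n : ℕ} (α : Fin n → ℕ) (f : (Fin n → 𝕜) → 𝕜) :
    (Fin n → 𝕜) → 𝕜 :=
  (List.finRange n).foldr (fun i g => (pd i)^[α i] g) f

/-- The length `|α|` of a multiindex. -/
def mdeg {n : ℕ} (α : Fin n → ℕ) : ℕ := ∑ i, α i

/-- The choice of `p` distinct jet variables `y^{j(q)}_{β(q)}` with `|β(q)| ≥ 1`, for functions of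
`n` variables with values in dimension `m`. -/
structure JetIndex (n m p : ℕ) where
  β : Fin p → Fin n → ℕ
  j : Fin p → Fin m
  one_le : ∀ q, 1 ≤ mdeg (β q)
  inj : Function.Injective fun q => (j q, β q)

namespace JetIndex

variable {n m p : ℕ} (I : JetIndex n m p)

/-- `κ = max |β(q)|`. -/
def order : ℕ := Finset.univ.sup fun q => mdeg (I.β q)

/-- The pairs `(j, α)` with `|α| ≤ κ + 1` for which the system prescribes `y^j_{x^α}`. -/
def IsPrincipal (j : Fin m) (α : Fin n → ℕ) : Prop :=
  α ≠ 0 ∧ (∀ q, (j, α) ≠ (I.j q, I.β q)) ∧ mdeg α ≤ I.order + 1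

/-- The derivatives `(y^{j(q)}_{x^{β(q)}}(x))_{1 ≤ q ≤ p}` of a map `s`. -/
noncomputable def derivs {𝕜 : Type*} [RCLike 𝕜] (s : (Fin n → 𝕜) → Fin m → 𝕜) (x : Fin n → 𝕜) :
    Fin p → 𝕜 :=
  fun q => mpd (I.β q) (fun x' => s x' (I.j q)) x

end JetIndex

/-- The space of the coordinates `(x, y, (y^{j(q)}_{β(q)})_q)`, on which the right-hand sides of
the system are defined; it is also the coordinate space of the skeleton. -/
abbrev JetSpace (𝕜 : Type*) (n m p : ℕ) : Type _ := (Fin n → 𝕜) × (Fin m → 𝕜) × (Fin p → 𝕜)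

/-- A system `y^j_{x^α} = F^j_α(x, y, (y^{j(q)}_{x^{β(q)}})_q)` with right-hand sides analytic at the
origin and admitting `y = 0` as a local solution. The values of `F j α` for the other pairs `(j, α)`
and away from a neighborhood of the origin play no role. -/
structure PDESystem (𝕜 : Type*) [RCLike 𝕜] {n m p : ℕ} (I : JetIndex n m p) where
  F : Fin m → (Fin n → ℕ) → JetSpace 𝕜 n m p → 𝕜
  analytic : ∀ j α, I.IsPrincipal j α → AnalyticAt 𝕜 (F j α) 0
  zero_solution : ∀ j α, I.IsPrincipal j α → ∀ᶠ x : Fin n → 𝕜 in 𝓝 0, F j α (x, 0, 0) = 0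

namespace PDESystem

variable {𝕜 : Type*} [RCLike 𝕜] {n m p : ℕ} {I : JetIndex n m p} (E : PDESystem 𝕜 I)

open Classical in
/-- The jet variable `y^j_α` restricted to the skeleton, as a function of the coordinates
`(x, y, (y^{j(q)}_{β(q)})_q)`: a coordinate if `α = 0` or `(j, α)` is one of the `(j(q), β(q))`,
and `F^j_α` otherwise. -/
noncomputable def jet (j : Fin m) (α : Fin n → ℕ) (w : JetSpace 𝕜 n m p) : 𝕜 :=
  if α = 0 then w.2.1 j
  else if h : ∃ q, I.j q = j ∧ I.β q = α then w.2.2 h.choose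
  else E.F j α w

/-- The total differentiation operator `D_i` restricted to the skeleton, a vector field in the
coordinates `(x, y, (y^{j(q)}_{β(q)})_q)`. -/
noncomputable def totalD (i : Fin n) (w : JetSpace 𝕜 n m p) : JetSpace 𝕜 n m p :=
  (Pi.single i 1, fun j => E.jet j (Pi.single i 1) w,
    fun q => E.jet (I.j q) (I.β q + Pi.single i 1) w)

/-- Complete integrability: the contact distribution of the jet space of order `κ + 1` meets the
tangent bundle of the skeleton along a bundle generated by `n` vector fields `D_i`, i.e. the
restrictions of the jet variables of order `≤ κ` satisfy `D_i y^j_α = y^j_{α + e_i}`, and these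
vector fields satisfy the Frobenius condition. -/
def CompletelyIntegrable : Prop :=
  (∀ (j : Fin m) (α : Fin n → ℕ) (i : Fin n), mdeg α ≤ I.order →
    ∀ᶠ w in 𝓝 (0 : JetSpace 𝕜 n m p),
      fderiv 𝕜 (E.jet j α) w (E.totalD i w) = E.jet j (α + Pi.single i 1) w) ∧
  ∀ i k : Fin n, ∀ᶠ w in 𝓝 (0 : JetSpace 𝕜 n m p),
    VectorField.lieBracket 𝕜 (E.totalD i) (E.totalD k) w ∈
      Submodule.span 𝕜 (Set.range fun l => E.totalD l w)

/-- The map `s` satisfies the equations of the system at the point `x`. -/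
def HoldsAt (s : (Fin n → 𝕜) → Fin m → 𝕜) (x : Fin n → 𝕜) : Prop :=
  ∀ (j : Fin m) (α : Fin n → ℕ), I.IsPrincipal j α →
    mpd α (fun x' => s x' j) x = E.F j α (x, s x, I.derivs s x)

/-- `s` is a local solution of the system near `x₀`. -/
def IsSolutionAt (s : (Fin n → 𝕜) → Fin m → 𝕜) (x₀ : Fin n → 𝕜) : Prop :=
  AnalyticAt 𝕜 s x₀ ∧ ∀ᶠ x in 𝓝 x₀, E.HoldsAt s x

/-- The local transformation `φ` of the `(x, y)`-space transforms the graph of every local solution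
passing through `N` into the graph of another local solution. Graphs are taken as germs: the germ at
`(x₀, s x₀)` of the graph of `s` is `map (fun x => (x, s x)) (𝓝 x₀)`. -/
def IsLieSymmetryOn (N : Set (JetSpace 𝕜 n m p))
    (φ : (Fin n → 𝕜) × (Fin m → 𝕜) → (Fin n → 𝕜) × (Fin m → 𝕜)) : Prop :=
  ∀ (x₀ : Fin n → 𝕜) (s : (Fin n → 𝕜) → Fin m → 𝕜), E.IsSolutionAt s x₀ →
    (x₀, s x₀, I.derivs s x₀) ∈ N →
    ∃ s' : (Fin n → 𝕜) → Fin m → 𝕜, E.IsSolutionAt s' (φ (x₀, s x₀)).1 ∧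
      map φ (map (fun x => (x, s x)) (𝓝 x₀)) = map (fun x => (x, s' x)) (𝓝 (φ (x₀, s x₀)).1)

end PDESystem

/-- `φ(t, z) = exp(t L)(z)` is the local analytic flow of `L` near `t = 0`, `z = 0`. -/
def IsLocalFlow {𝕜 V : Type*} [RCLike 𝕜] [NormedAddCommGroup V] [NormedSpace 𝕜 V]
    (L : V → V) (φ : 𝕜 × V → V) : Prop :=
  AnalyticAt 𝕜 φ 0 ∧ (∀ᶠ z in 𝓝 (0 : V), φ (0, z) = z) ∧
    ∀ᶠ w in 𝓝 (0 : 𝕜 × V), HasDerivAt (fun t => φ (t, w.2)) (L (φ w)) w.1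

namespace PDESystem

variable {𝕜 : Type*} [RCLike 𝕜] {n m p : ℕ} {I : JetIndex n m p} (E : PDESystem 𝕜 I)

/-- `L` is an infinitesimal symmetry: for every small `t`, its time-`t` flow map is a Lie symmetry
of the system (localized near the origin, uniformly in `t`). -/
def IsInfinitesimalSymmetry
    (L : (Fin n → 𝕜) × (Fin m → 𝕜) → (Fin n → 𝕜) × (Fin m → 𝕜)) : Prop :=
  ∃ φ : 𝕜 × ((Fin n → 𝕜) × (Fin m → 𝕜)) → (Fin n → 𝕜) × (Fin m → 𝕜), IsLocalFlow L φ ∧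
    ∃ N ∈ 𝓝 (0 : JetSpace 𝕜 n m p), ∀ᶠ t in 𝓝 (0 : 𝕜), E.IsLieSymmetryOn N fun z => φ (t, z)

/-- `𝔖𝔜𝔐(E)`: the germs at the origin of analytic vector fields in the `(x, y)`-space that are
infinitesimal symmetries of the system. -/
def symSet : Set (VFGerm 𝕜 ((Fin n → 𝕜) × (Fin m → 𝕜))) :=
  {g | ∃ (L : (Fin n → 𝕜) × (Fin m → 𝕜) → (Fin n → 𝕜) × (Fin m → 𝕜)) (hL : AnalyticAt 𝕜 L 0),
    g = VFGerm.mk L hL ∧ E.IsInfinitesimalSymmetry L}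

end PDESystem

end Systems

/-! ### Submanifolds of solutions -/

section Submanifolds

variable {𝕜 : Type*} [RCLike 𝕜] {n m p : ℕ}

/-- A map `P(x, a, b)` whose graph `y = P(x, a, b)` is a submanifold of the
`(x, y, a, b)`-space. -/
abbrev DefMap (𝕜 : Type*) (n m p : ℕ) : Type _ :=
  (Fin n → 𝕜) → (Fin p → 𝕜) × (Fin m → 𝕜) → Fin m → 𝕜

/-- The map `P` is analytic at the origin. -/
def DefMap.Analytic (P : DefMap 𝕜 n m p) : Prop :=
  AnalyticAt 𝕜 (fun w : (Fin n → 𝕜) × ((Fin p → 𝕜) × (Fin m → 𝕜)) => P w.1 w.2) 0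

/-- `y = P(x, a, b)` is satisfied by solutions of `E` for all small `(a, b)`. -/
def PDESystem.SolvedBy {I : JetIndex n m p} (E : PDESystem 𝕜 I) (P : DefMap 𝕜 n m p) : Prop :=
  P.Analytic ∧ ∀ᶠ w in 𝓝 (0 : (Fin n → 𝕜) × ((Fin p → 𝕜) × (Fin m → 𝕜))),
    E.HoldsAt (fun x => P x w.2) w.1

/-- `y = P(x, a, b)` is the submanifold of solutions of `E`: the multiple flow
`exp(xⁿ D_n)(⋯ exp(x¹ D_1)(0, b, a))` of the vector fields `D_i` on the skeleton, starting from the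
initial conditions `y = b`, `y^{j(q)}_{β(q)} = a^q` at `x = 0`, is `(x, P(x, a, b), Ω(x, a, b))`.
The `i`-th flow moves the coordinate `xⁱ` while `x^k = 0` for `k > i`. -/
def PDESystem.IsSubmanifoldOfSolutions {I : JetIndex n m p} (E : PDESystem 𝕜 I)
    (P : DefMap 𝕜 n m p) : Prop :=
  ∃ Ω : (Fin n → 𝕜) → (Fin p → 𝕜) × (Fin m → 𝕜) → Fin p → 𝕜,
    P.Analytic ∧
    AnalyticAt 𝕜 (fun w : (Fin n → 𝕜) × ((Fin p → 𝕜) × (Fin m → 𝕜)) => Ω w.1 w.2) 0 ∧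
    (∀ᶠ c in 𝓝 (0 : (Fin p → 𝕜) × (Fin m → 𝕜)), P 0 c = c.2 ∧ Ω 0 c = c.1) ∧
    ∀ i : Fin n, ∀ᶠ w in 𝓝 (0 : (Fin n → 𝕜) × ((Fin p → 𝕜) × (Fin m → 𝕜))),
      (∀ k, i < k → w.1 k = 0) →
      HasDerivAt
        (fun t => ((Function.update w.1 i t, P (Function.update w.1 i t) w.2,
          Ω (Function.update w.1 i t) w.2) : JetSpace 𝕜 n m p))
        (E.totalD i (w.1, P w.1 w.2, Ω w.1 w.2)) (w.1 i)

/-- The map `(a, b) ↦ (P(0, a, b), (P^{j(q)}_{x^{β(q)}}(0, a, b))_q)` has maximal rank `m + p` at the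
origin. -/
def DefMap.HasMaximalRank (P : DefMap 𝕜 n m p) (I : JetIndex n m p) : Prop :=
  Function.Bijective (fderiv 𝕜 (fun c : (Fin p → 𝕜) × (Fin m → 𝕜) =>
    (P 0 c, I.derivs (fun x => P x c) 0)) 0)

/-- `y = P(x, a, b)` is solvable with respect to the parameters, by means of the pairs
`(j(q), β(q))`. -/
def DefMap.SolvableWrtParameters (P : DefMap 𝕜 n m p) (I : JetIndex n m p) : Prop :=
  Function.Bijective (fderiv 𝕜 (fun b : Fin m → 𝕜 => P 0 (0, b)) 0) ∧ P.HasMaximalRank I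

/-- `b = Ps(a, x, y)` are the dual defining equations of `y = P(x, a, b)`. -/
def IsDualMap (P : DefMap 𝕜 n m p) (Ps : DefMap 𝕜 p m n) : Prop :=
  P.Analytic ∧ Ps.Analytic ∧ P 0 0 = 0 ∧ Ps 0 0 = 0 ∧
    (∀ᶠ w in 𝓝 (0 : (Fin n → 𝕜) × (Fin p → 𝕜) × (Fin m → 𝕜)),
      Ps w.2.1 (w.1, P w.1 w.2) = w.2.2) ∧
    (∀ᶠ w in 𝓝 (0 : (Fin p → 𝕜) × (Fin n → 𝕜) × (Fin m → 𝕜)),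
      P w.2.1 (w.1, Ps w.1 w.2) = w.2.2)

/-- The submanifold with dual equations `b = Ps(a, x, y)` is solvable with respect to the variables,
by means of the pairs `(j(l), δ(l))`, `1 ≤ l ≤ n`. -/
def DefMap.SolvableWrtVariables (Ps : DefMap 𝕜 p m n) (J : JetIndex p m n) : Prop :=
  Ps.HasMaximalRank J

/-- `E` is the system of partial differential equations associated with the submanifold
`y = P(x, a, b)` by means of the pairs `(j(q), β(q))` of `I`: the equations
`y = P`, `y^{j(q)}_{x^{β(q)}} = P^{j(q)}_{x^{β(q)}}` can be solved for `(a, b)`, and substituting the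
result in `y^j_{x^α} = P^j_{x^α}` gives `y^j_{x^α} = F^j_α`. -/
def PDESystem.IsAssociatedWith {I : JetIndex n m p} (E : PDESystem 𝕜 I)
    (P : DefMap 𝕜 n m p) : Prop :=
  P.HasMaximalRank I ∧ E.SolvedBy P

/-- The vector field germ `L + L*` on the product of two spaces. -/
noncomputable def VFGerm.directSum {V V' : Type*} [NormedAddCommGroup V] [NormedSpace 𝕜 V]
    [NormedAddCommGroup V'] [NormedSpace 𝕜 V'] (L : VFGerm 𝕜 V) (L' : VFGerm 𝕜 V') :
    VFGerm 𝕜 (V × V') :=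
  VFGerm.mk (fun w => (L.rep w.1, L'.rep w.2))
    ((L.rep_analytic.comp_of_eq analyticAt_fst rfl).prod
      (L'.rep_analytic.comp_of_eq analyticAt_snd rfl))

/-- The ambient `(x, y, a, b)`-space. -/
abbrev Ambient (𝕜 : Type*) (n m p : ℕ) : Type _ :=
  ((Fin n → 𝕜) × (Fin m → 𝕜)) × ((Fin p → 𝕜) × (Fin m → 𝕜))

/-- The vector fields `L + L*`, with `L` in the `(x, y)`-space and `L*` in the `(a, b)`-space, that
are tangent to the submanifold `ρ = 0` of the `(x, y, a, b)`-space. -/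
def twinSymSet (ρ : Ambient 𝕜 n m p → Fin m → 𝕜) : Set (VFGerm 𝕜 (Ambient 𝕜 n m p)) :=
  {W | (∃ (L : VFGerm 𝕜 ((Fin n → 𝕜) × (Fin m → 𝕜))) (L' : VFGerm 𝕜 ((Fin p → 𝕜) × (Fin m → 𝕜))),
      W = L.directSum L') ∧
    ∀ᶠ w in 𝓝 (0 : Ambient 𝕜 n m p), ρ w = 0 → fderiv 𝕜 ρ w (W.rep w) = 0}

/-- `𝔖𝔜𝔐(M)` for `M = {y = P(x, a, b)}`. -/
def symSubmanifold (P : DefMap 𝕜 n m p) : Set (VFGerm 𝕜 (Ambient 𝕜 n m p)) :=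
  twinSymSet fun w => -w.1.2 + P w.1.1 w.2

/-- `𝔖𝔜𝔐(M)` for `M = {b = Ps(a, x, y)}`. -/
def symDualSubmanifold (Ps : DefMap 𝕜 p m n) : Set (VFGerm 𝕜 (Ambient 𝕜 n m p)) :=
  twinSymSet fun w => -w.2.2 + Ps w.2.1 w.1

end Submanifolds

/-! Write c = (a, b). Each bracket of the fields D_i has no x-component, while D_l has x-component
e_l, so the Frobenius condition forces the D_i to commute. Flowing along them one after the other
therefore gives a map that is integral for all of them simultaneously
(`fderiv_eq_of_successive_flows`). Its fibre coordinates are the derivatives of P, so every P(·, c)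
solves the system (`IsSubmanifoldOfSolutions.solvedBy`). By the rank condition the jet map (x, c) ↦
(x, y, derivatives) has a local analytic inverse Φ, and Φ carries D_i to ∂/∂xⁱ. Hence c is constant
along the jet of any solution, and every solution with jet near 0 is some P(·, c)
(`SolvedBy.exists_eq_of_isSolutionAt`).

If L + L* is tangent to M, the two flows together preserve M, by a Grönwall estimate on the defining
function. The flow of L then sends the graph of P(·, c) into that of P(·, c'), where c' is the image
of c under the flow of L*, so L is a symmetry. Conversely, the flow of a symmetry permutes the
solutions P(·, c) and so acts on the parameters by some analytic κ(t, c)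
(`IsAssociatedWith.exists_parameter_flow`); differentiating the invariance of M at t = 0 gives L* =
∂κ/∂t. This L* is unique: if L = 0, the flow of L* does not change the function P(·, c), and Φ
recovers c from its jet (`eq_zero_of_isTangent_zero`). So L + L* ↦ L is a bijection of the tangent
fields onto the symmetries.

These arguments use only that a system is associated with a map P, so they apply verbatim to Π* with
x and a exchanged. The dual system comes from eliminating (x, y) by means of the inverse jet map.
Tangency depends only on the zero set, which P and Π* share, and tangent fields are closed under
brackets. The bracket acts componentwise on sums L + L*, so both projections are Lie algebra
isomorphisms onto their images. -/

/-! ### Inverse functions, identity theorem and Grönwall estimate. -/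

section LocalAnalysis

variable {𝕜 : Type*} [RCLike 𝕜] {E F U X Z : Type*}
  [NormedAddCommGroup E] [NormedSpace 𝕜 E] [NormedAddCommGroup F] [NormedSpace 𝕜 F]
  [NormedAddCommGroup U] [NormedSpace 𝕜 U] [NormedAddCommGroup X] [NormedSpace 𝕜 X]
  [NormedAddCommGroup Z] [NormedSpace 𝕜 Z]

/-- Analytic inverse function theorem. -/
theorem AnalyticAt.exists_local_inverse [CompleteSpace E] [CompleteSpace F] {f : E → F} {a : E}
    (hf : AnalyticAt 𝕜 f a) (hb : Function.Bijective (fderiv 𝕜 f a)) :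
    ∃ g : F → E, AnalyticAt 𝕜 g (f a) ∧ g (f a) = a ∧ (∀ᶠ x in 𝓝 a, g (f x) = x) ∧
      ∀ᶠ y in 𝓝 (f a), f (g y) = y := by
  let e : E ≃L[𝕜] F := ContinuousLinearEquiv.ofBijective (fderiv 𝕜 f a)
    (LinearMap.ker_eq_bot.2 hb.1) (LinearMap.range_eq_top.2 hb.2)
  have he : HasStrictFDerivAt f (e : E →L[𝕜] F) a := hf.hasStrictFDerivAt
  -- The exponent `⊤` is the analytic class, not merely the smooth one, so the regularity of the
  -- local inverse is analyticity.
  have hc : ContDiffAt 𝕜 ⊤ f a := hf.contDiffAt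
  refine ⟨he.localInverse f e a, ?_, he.localInverse_apply_image,
    he.eventually_left_inverse, he.eventually_right_inverse⟩
  exact (hc.to_localInverse he.hasFDerivAt (by simp)).analyticAt

theorem AnalyticAt.comp₂' {G : Type*} [NormedAddCommGroup G] [NormedSpace 𝕜 G]
    {f : E × F → G} {g : X → E} {h : X → F} {x : X} {y : E × F} (hf : AnalyticAt 𝕜 f y)
    (hg : AnalyticAt 𝕜 g x) (hh : AnalyticAt 𝕜 h x) (hy : (g x, h x) = y) :
    AnalyticAt 𝕜 (fun x => f (g x, h x)) x := by
  subst hy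
  exact AnalyticAt.comp (f := fun x => (g x, h x)) hf (hg.prod hh)

/-- The map `(u, x) ↦ (u, f (u, x))` has invertible derivative if `f (u₀, ·)` does. -/
theorem bijective_fderiv_graph {f : U × X → Z} {u₀ : U} {x₀ : X}
    (hf : DifferentiableAt 𝕜 f (u₀, x₀))
    (hb : Function.Bijective (fderiv 𝕜 (fun x => f (u₀, x)) x₀)) :
    Function.Bijective (fderiv 𝕜 (fun w : U × X => (w.1, f w)) (u₀, x₀)) := by
  have h1 : fderiv 𝕜 (fun w : U × X => (w.1, f w)) (u₀, x₀)
      = (ContinuousLinearMap.fst 𝕜 U X).prod (fderiv 𝕜 f (u₀, x₀)) :=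
    (hasFDerivAt_fst.prodMk hf.hasFDerivAt).fderiv
  have h2 : ∀ v, fderiv 𝕜 (fun x => f (u₀, x)) x₀ v = fderiv 𝕜 f (u₀, x₀) (0, v) := by
    intro v
    have : HasFDerivAt (fun x => f (u₀, x))
        ((fderiv 𝕜 f (u₀, x₀)).comp (ContinuousLinearMap.inr 𝕜 U X)) x₀ :=
      HasFDerivAt.comp x₀ hf.hasFDerivAt (hasFDerivAt_prodMk_right u₀ x₀)
    rw [this.fderiv]; simp
  rw [h1]
  have h3 : ∀ du dx, fderiv 𝕜 f (u₀, x₀) (du, dx)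
      = fderiv 𝕜 f (u₀, x₀) (du, 0) + fderiv 𝕜 (fun x => f (u₀, x)) x₀ dx := by
    intro du dx
    rw [h2, ← map_add]; simp
  constructor
  · rintro ⟨u, x⟩ ⟨u', x'⟩ h
    simp only [ContinuousLinearMap.prod_apply, ContinuousLinearMap.coe_fst', Prod.mk.injEq] at h
    obtain ⟨rfl, h⟩ := h
    rw [h3, h3 u x'] at h
    rw [hb.1 (add_left_cancel h)]
  · rintro ⟨u, z⟩
    obtain ⟨x, hx⟩ := hb.2 (z - fderiv 𝕜 f (u₀, x₀) (u, 0))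
    refine ⟨(u, x), ?_⟩
    simp only [ContinuousLinearMap.prod_apply, ContinuousLinearMap.coe_fst']
    rw [h3, hx]; simp

/-- Analytic inverse function theorem with parameters. -/
theorem AnalyticAt.exists_param_inverse [CompleteSpace U] [CompleteSpace X] [CompleteSpace Z]
    {f : U × X → Z} {u₀ : U} {x₀ : X} {z₀ : Z} (hf : AnalyticAt 𝕜 f (u₀, x₀))
    (hz : f (u₀, x₀) = z₀)
    (hb : Function.Bijective (fderiv 𝕜 (fun x => f (u₀, x)) x₀)) :
    ∃ h : U × Z → X, AnalyticAt 𝕜 h (u₀, z₀) ∧ h (u₀, z₀) = x₀ ∧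
      (∀ᶠ w in 𝓝 (u₀, x₀), h (w.1, f w) = w.2) ∧
      ∀ᶠ w in 𝓝 (u₀, z₀), f (w.1, h w) = w.2 := by
  subst hz
  obtain ⟨g, hg, hg0, hgl, hgr⟩ := AnalyticAt.exists_local_inverse
    (analyticAt_fst.prod hf) (bijective_fderiv_graph hf.differentiableAt hb)
  refine ⟨fun w => (g w).2, analyticAt_snd.comp_of_eq hg rfl, by simp only [hg0], ?_, ?_⟩
  · filter_upwards [hgl] with w hw using by rw [hw]
  · filter_upwards [hgr] with w hw
    have h1 := congrArg Prod.fst hw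
    have h2 := congrArg Prod.snd hw
    simp only at h1 h2
    rw [← h1]; exact h2

/-- Identity theorem with parameters. -/
theorem AnalyticAt.eventually_eq_zero_of_forall_eventually [CompleteSpace F] {H : U × X → F} {u₀ : U} {x₀ : X}
    (hH : AnalyticAt 𝕜 H (u₀, x₀)) (h0 : ∀ᶠ u in 𝓝 u₀, ∀ᶠ x in 𝓝 x₀, H (u, x) = 0) :
    ∀ᶠ w in 𝓝 (u₀, x₀), H w = 0 := by
  let _ : NormedSpace ℝ X := NormedSpace.restrictScalars ℝ 𝕜 X
  obtain ⟨V, hV, W, hW, hVW⟩ := mem_nhds_prod_iff.1 hH.eventually_analyticAt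
  obtain ⟨r, hr, hrW⟩ := Metric.mem_nhds_iff.1 hW
  have hm : V ×ˢ Metric.ball x₀ r ∈ 𝓝 (u₀, x₀) := prod_mem_nhds hV (Metric.ball_mem_nhds _ hr)
  have h0' : ∀ᶠ w : U × X in 𝓝 (u₀, x₀), ∀ᶠ x in 𝓝 x₀, H (w.1, x) = 0 :=
    (continuous_fst.tendsto (u₀, x₀)).eventually h0
  filter_upwards [hm, h0'] with w hw hw0
  -- The neighborhoods on which H(u, ·) vanishes may shrink with u. Analytic continuation over a
  -- ball independent of u makes them uniform.
  have han : AnalyticOnNhd 𝕜 (fun x => H (w.1, x)) (Metric.ball x₀ r) := fun x hx =>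
    AnalyticAt.comp₂' (y := (w.1, x)) (hVW ⟨hw.1, hrW hx⟩) analyticAt_const analyticAt_id rfl
  exact han.eqOn_zero_of_preconnected_of_eventuallyEq_zero
    (convex_ball x₀ r).isPreconnected (Metric.mem_ball_self hr) hw0 hw.2

/-- A Grönwall type lemma: a function satisfying `‖∂H/∂t‖ ≤ K ‖H‖` and vanishing for `t = 0`
vanishes identically. -/
theorem eventually_eq_zero_of_norm_deriv_le {H H' : 𝕜 × U → F} {u₀ : U} {K : ℝ}
    (hd : ∀ᶠ w in 𝓝 ((0 : 𝕜), u₀), HasDerivAt (fun t => H (t, w.2)) (H' w) w.1)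
    (hK : ∀ᶠ w in 𝓝 ((0 : 𝕜), u₀), ‖H' w‖ ≤ K * ‖H w‖)
    (h0 : ∀ᶠ u in 𝓝 u₀, H (0, u) = 0) :
    ∀ᶠ w in 𝓝 ((0 : 𝕜), u₀), H w = 0 := by
  let _ : NormedSpace ℝ F := NormedSpace.restrictScalars ℝ 𝕜 F
  obtain ⟨r, hr, hrW⟩ := Metric.eventually_nhds_iff_ball.1 (hd.and hK)
  have h0' : ∀ᶠ w : 𝕜 × U in 𝓝 ((0 : 𝕜), u₀), H (0, w.2) = 0 := (continuous_snd.tendsto ((0 : 𝕜), u₀)).eventually h0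
  filter_upwards [Metric.ball_mem_nhds _ hr, h0'] with w hw hw0
  rw [← ball_prod_same] at hw hrW
  -- Restricting to the segment s ↦ s t with s ∈ [0, 1] reduces the real and complex cases alike to
  -- Grönwall in one real variable.
  have hmem : ∀ s ∈ Set.Icc (0 : ℝ) 1,
      (((s : 𝕜) * w.1), w.2) ∈ Metric.ball (0 : 𝕜) r ×ˢ Metric.ball u₀ r := by
    intro s hs
    refine ⟨?_, hw.2⟩
    have h1 : ‖w.1‖ < r := by simpa using hw.1
    simp only [mem_ball_zero_iff, norm_mul, RCLike.norm_ofReal, abs_of_nonneg hs.1]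
    nlinarith [norm_nonneg w.1, hs.1, hs.2]
  have hder : ∀ s ∈ Set.Icc (0 : ℝ) 1, HasDerivAt (fun s : ℝ => H ((s : 𝕜) * w.1, w.2))
      (w.1 • H' ((s : 𝕜) * w.1, w.2)) s := by
    intro s hs
    have h1 : HasDerivAt (fun s : ℝ => (s : 𝕜) * w.1) w.1 s := by
      simpa using (RCLike.ofRealCLM (K := 𝕜)).hasDerivAt.mul_const w.1
    exact HasDerivAt.scomp s (hrW _ (hmem s hs)).1 h1
  have key := eq_zero_of_abs_deriv_le_mul_abs_self_of_eq_zero_right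
    (f := fun s : ℝ => H ((s : 𝕜) * w.1, w.2)) (K := ‖w.1‖ * K) (a := 0) (b := 1)
    (fun s hs => (hder s hs).continuousAt.continuousWithinAt)
    (fun s hs => (hder s ⟨hs.1, hs.2.le⟩).hasDerivWithinAt) (by simpa using hw0)
    (fun s hs => by
      rw [norm_smul, mul_assoc]
      exact mul_le_mul_of_nonneg_left (hrW _ (hmem s ⟨hs.1, hs.2.le⟩)).2 (norm_nonneg _))
    1 ⟨zero_le_one, le_rfl⟩
  simpa using key

end LocalAnalysis

/-! ### Existence and joint analyticity of local flows. -/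

section Flow

open scoped unitInterval

/-- The power series acting pointwise on continuous functions. -/
noncomputable def FormalMultilinearSeries.onContinuousMap {𝕜 V W : Type*} [RCLike 𝕜]
    [NormedAddCommGroup V] [NormedSpace 𝕜 V] [NormedAddCommGroup W] [NormedSpace 𝕜 W]
    (K : Type*) [TopologicalSpace K] [CompactSpace K] (p : FormalMultilinearSeries 𝕜 V W) :
    FormalMultilinearSeries 𝕜 C(K, V) C(K, W) := fun n =>
  MultilinearMap.mkContinuous
    { toFun := fun u => ⟨fun s => p n fun i => u i s, by fun_prop⟩
      map_update_add' := by
        intro _ u i x y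
        ext s
        have h : ∀ z : C(K, V), (fun j => Function.update u i z j s)
            = Function.update (fun j => u j s) i (z s) := by
          intro z; ext j
          by_cases hj : j = i
          · subst hj; simp
          · simp [hj]
        simp [h]
      map_update_smul' := by
        intro _ u i c x
        ext s
        have h : ∀ z : C(K, V), (fun j => Function.update u i z j s)
            = Function.update (fun j => u j s) i (z s) := by
          intro z; ext j
          by_cases hj : j = i
          · subst hj; simp
          · simp [hj]
        simp [h] }
    ‖p n‖ (by
      intro u
      refine (ContinuousMap.norm_le _ (by positivity)).2 fun s => ?_
      refine ((p n).le_opNorm _).trans ?_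
      gcongr with i
      exact (u i).norm_coe_le_norm s)

variable {𝕜 V W : Type*} [RCLike 𝕜]
  [NormedAddCommGroup V] [NormedSpace 𝕜 V] [NormedAddCommGroup W] [NormedSpace 𝕜 W]

/-- Acting pointwise does not increase the norms of the coefficients, because the sup norm dominates
every value. -/
theorem FormalMultilinearSeries.radius_le_onContinuousMap
    {K : Type*} [TopologicalSpace K] [CompactSpace K] (p : FormalMultilinearSeries 𝕜 V W) :
    p.radius ≤ (p.onContinuousMap K).radius := by
  refine ENNReal.le_of_forall_nnreal_lt fun r hr => ?_
  obtain ⟨C, -, hC⟩ := p.norm_mul_pow_le_of_lt_radius hr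
  refine FormalMultilinearSeries.le_radius_of_bound _ C fun n => le_trans ?_ (hC n)
  gcongr
  exact MultilinearMap.mkContinuous_norm_le _ (norm_nonneg _) _

/-- The superposition operator of an analytic map is analytic on spaces of continuous functions. -/
theorem AnalyticAt.exists_superposition [CompleteSpace W] (K : Type*) [TopologicalSpace K]
    [CompactSpace K] {L : V → W} (hL : AnalyticAt 𝕜 L 0) :
    ∃ N : C(K, V) → C(K, W), AnalyticAt 𝕜 N 0 ∧ ∀ᶠ u in 𝓝 0, ∀ s, N u s = L (u s) := by
  obtain ⟨p, r, hp⟩ := hL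
  have hq : 0 < (p.onContinuousMap K).radius :=
    hp.radius_pos.trans_le p.radius_le_onContinuousMap
  have hN := (p.onContinuousMap K).hasFPowerSeriesOnBall hq
  refine ⟨(p.onContinuousMap K).sum, hN.analyticAt, ?_⟩
  filter_upwards [Metric.eball_mem_nhds _ hp.r_pos, Metric.eball_mem_nhds _ hq] with u hu huq s
  have h1 := (ContinuousMap.evalCLM 𝕜 s).hasSum (hN.hasSum huq)
  have hus : u s ∈ Metric.eball (0 : V) r := by
    rw [Metric.mem_eball, edist_zero_right] at hu ⊢
    refine lt_of_le_of_lt ?_ hu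
    simp only [enorm_eq_nnnorm, ENNReal.coe_le_coe]
    exact NNReal.coe_le_coe.1 (u.norm_coe_le_norm s)
  have h2 := hp.hasSum hus
  simp only [zero_add] at h1 h2
  exact h1.unique h2


/-- For small t this makes v ↦ t J(N' v) a strict contraction, so the linearized integral equation
of the flow has at most one solution. -/
theorem eventually_norm_mul_fderiv_lt_one {S : Type*} [TopologicalSpace S] {N : V → V} {u : S → V}
    {τ : S → 𝕜} {s₀ : S} (hN : ContinuousAt (fderiv 𝕜 N) (u s₀)) (hu : ContinuousAt u s₀)
    (hτ : ContinuousAt τ s₀) (h0 : τ s₀ = 0) (J : V →L[𝕜] V) :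
    ∀ᶠ s in 𝓝 s₀, ‖τ s‖ * (‖J‖ * ‖fderiv 𝕜 N (u s)‖) < 1 := by
  have h1 : ContinuousAt (fun s => ‖τ s‖ * (‖J‖ * ‖fderiv 𝕜 N (u s)‖)) s₀ :=
    hτ.norm.mul (continuousAt_const.mul (ContinuousAt.comp (f := u) hN hu).norm)
  exact h1.eventually_lt continuousAt_const (by simp [h0])

/-- Integration `u ↦ (s ↦ ∫₀ˢ u)` as a bounded operator. -/
theorem exists_integralOperator (𝕜 : Type*) [RCLike 𝕜] [NormedSpace 𝕜 V] [NormedSpace ℝ V]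
    [IsScalarTower ℝ 𝕜 V] [CompleteSpace V] :
    ∃ J : C(I, V) →L[𝕜] C(I, V), ∀ u s, J u s =
      ∫ r in (0 : ℝ)..s, Set.IccExtend (zero_le_one' ℝ) u r := by
  have hc : ∀ u : C(I, V), Continuous (Set.IccExtend (zero_le_one' ℝ) u) :=
    fun u => u.continuous.Icc_extend'
  have hsc : SMulCommClass ℝ 𝕜 V := inferInstance
  refine ⟨LinearMap.mkContinuous
    { toFun := fun u => ⟨fun s => ∫ r in (0 : ℝ)..s, Set.IccExtend (zero_le_one' ℝ) u r,
        (intervalIntegral.continuous_primitive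
          (fun a b => (hc u).intervalIntegrable a b) 0).comp continuous_subtype_val⟩
      map_add' := ?_
      map_smul' := ?_ } 1 ?_, fun u s => rfl⟩
  · intro u v
    ext s
    exact intervalIntegral.integral_add ((hc u).intervalIntegrable _ _)
      ((hc v).intervalIntegrable _ _)
  · intro c u
    ext s
    exact intervalIntegral.integral_smul c _
  · intro u
    rw [one_mul]
    refine (ContinuousMap.norm_le _ (norm_nonneg _)).2 fun s => ?_
    have h := intervalIntegral.norm_integral_le_of_norm_le_const (a := 0) (b := (s : ℝ))
      (f := Set.IccExtend (zero_le_one' ℝ) u) (C := ‖u‖) fun r _ => u.norm_coe_le_norm _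
    refine h.trans ?_
    rw [sub_zero, abs_of_nonneg s.2.1]
    exact mul_le_of_le_one_right (norm_nonneg _) s.2.2

/-- An analytic vector field has an analytic local flow. -/
theorem exists_isLocalFlow [CompleteSpace V] {L : V → V} (hL : AnalyticAt 𝕜 L 0) :
    ∃ φ : 𝕜 × V → V, IsLocalFlow L φ := by
  let _ : NormedSpace ℝ V := NormedSpace.restrictScalars ℝ 𝕜 V
  have _ : IsScalarTower ℝ 𝕜 V := RestrictScalars.isScalarTower ℝ 𝕜 V
  obtain ⟨J, hJ⟩ := exists_integralOperator (V := V) 𝕜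
  obtain ⟨N, hN, hNL⟩ := hL.exists_superposition I
  let cst : V →L[𝕜] C(I, V) := LinearMap.mkContinuous
    { toFun := fun z => ContinuousMap.const I z
      map_add' := fun _ _ => rfl
      map_smul' := fun _ _ => rfl } 1 (fun z => by
        rw [one_mul]; exact (ContinuousMap.norm_le _ (norm_nonneg _)).2 fun s => le_rfl)
  -- Time is rescaled to [0, 1]: zeros of Θ are the curves u(s) = z + t ∫₀ˢ L(u), that is u(s) =
  -- φ(st, z). The unknown lies in a Banach space and Θ is analytic in (t, z, u) jointly, so the
  -- inverse function theorem yields analytic dependence of the flow on time and initial point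
  -- together.
  let Θ : (𝕜 × V) × C(I, V) → C(I, V) := fun w => w.2 - cst w.1.2 - w.1.1 • J (N w.2)
  have hN2 : AnalyticAt 𝕜 (fun w : (𝕜 × V) × C(I, V) => N w.2) ((0, 0), 0) :=
    AnalyticAt.comp_of_eq hN analyticAt_snd rfl
  have hΘ : AnalyticAt 𝕜 Θ ((0, 0), 0) := by
    refine (analyticAt_snd.sub ?_).sub (AnalyticAt.fun_smul ?_ ?_)
    · exact (cst.analyticAt _).comp_of_eq (analyticAt_snd.comp_of_eq analyticAt_fst rfl) rfl
    · exact analyticAt_fst.comp_of_eq analyticAt_fst rfl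
    · exact (J.analyticAt _).comp_of_eq hN2 rfl
  have hΘ0 : (fun u => Θ ((0, 0), u)) = id := by
    funext u; simp [Θ]
  obtain ⟨h, hh, hh0, -, hhr⟩ := hΘ.exists_param_inverse (z₀ := 0) (congrFun hΘ0 0) (by
    rw [hΘ0, fderiv_id]; exact Function.bijective_id)
  let uu : 𝕜 × V → C(I, V) := fun w => h (w, 0)
  have huu : AnalyticAt 𝕜 uu 0 :=
    AnalyticAt.comp₂' hh analyticAt_id analyticAt_const rfl
  have huu0 : uu 0 = 0 := hh0
  have heq : ∀ᶠ w in 𝓝 (0 : 𝕜 × V), uu w = cst w.2 + w.1 • J (N (uu w)) := by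
    have hct : ContinuousAt (fun w : 𝕜 × V => (w, (0 : C(I, V)))) 0 := by fun_prop
    filter_upwards [hct.eventually hhr] with w hw
    have hw' : uu w - cst w.2 - w.1 • J (N (uu w)) = 0 := hw
    rwa [sub_sub, sub_eq_zero] at hw'
  have huc : Tendsto uu (𝓝 0) (𝓝 0) := by
    have := huu.continuousAt.tendsto
    rwa [huu0] at this
  let ev : I → C(I, V) →L[𝕜] V := fun s => ContinuousMap.evalCLM 𝕜 s
  refine ⟨fun w => ev 1 (uu w), ((ev 1).analyticAt _).comp_of_eq huu rfl, ?_, ?_⟩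
  · have hct : ContinuousAt (fun z : V => ((0 : 𝕜), z)) 0 := by fun_prop
    filter_upwards [hct.eventually heq] with z hz
    have : uu (0, z) = cst z := by simpa using hz
    simp only [this]; rfl
  · have hLd : ∀ᶠ u in 𝓝 (0 : C(I, V)), ∀ s, DifferentiableAt 𝕜 L (u s) := by
      obtain ⟨r, hr, hrL⟩ := Metric.eventually_nhds_iff_ball.1 hL.eventually_analyticAt
      filter_upwards [Metric.ball_mem_nhds _ hr] with u hu s
      refine (hrL _ ?_).differentiableAt
      rw [mem_ball_zero_iff] at hu ⊢
      exact (u.norm_coe_le_norm s).trans_lt hu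
    have hsmall := eventually_norm_mul_fderiv_lt_one (S := 𝕜 × V) (huu0.symm ▸ hN.fderiv.continuousAt)
      huu.continuousAt (continuousAt_fst (p := (0 : 𝕜 × V))) rfl J
    filter_upwards [heq.eventually_nhds, hsmall, huc.eventually hLd, huc.eventually hNL.eventually_nhds,
      huc.eventually hN.eventually_analyticAt, huu.eventually_analyticAt]
      with w hw hs hLw hNw hNan huw
    obtain ⟨t, z⟩ := w
    set u := uu (t, z) with hu
    set N' := fderiv 𝕜 N u with hN'
    have hNu : ∀ s, N u s = L (u s) := hNw.self_of_nhds
    have hN's : ∀ (v : C(I, V)) s, (N' v) s = fderiv 𝕜 L (u s) (v s) := by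
      intro v s
      have h1 : HasFDerivAt (fun u' : C(I, V) => N u' s)
          ((ev s).comp N') u :=
        (ev s).hasFDerivAt.comp u hNan.differentiableAt.hasFDerivAt
      have h2 : HasFDerivAt (fun u' : C(I, V) => L (u' s))
          ((fderiv 𝕜 L (u s)).comp (ev s)) u :=
        HasFDerivAt.comp (f := ev s) u (hLw s).hasFDerivAt (ev s).hasFDerivAt
      have h3 := h1.unique (h2.congr_of_eventuallyEq (hNw.mono fun u' hu' => hu' s))
      exact DFunLike.congr_fun h3 v
    have hc : HasDerivAt (fun τ => uu (τ, z)) (fderiv 𝕜 uu (t, z) (1, 0)) t := by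
      have h1 : HasDerivAt (fun τ : 𝕜 => (τ, z)) (1, 0) t :=
        (hasDerivAt_id t).prodMk (hasDerivAt_const t z)
      exact HasFDerivAt.comp_hasDerivAt t huw.differentiableAt.hasFDerivAt h1
    set v := fderiv 𝕜 uu (t, z) (1, 0) with hv
    have hveq : v = J (N u) + t • J (N' v) := by
      have h1 : HasDerivAt (fun τ => J (N (uu (τ, z)))) (J (N' v)) t :=
        J.hasFDerivAt.comp_hasDerivAt t
          (HasFDerivAt.comp_hasDerivAt t hNan.differentiableAt.hasFDerivAt hc)
      have h2 := ((hasDerivAt_id t).smul h1).const_add (cst z)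
      have hct : ContinuousAt (fun τ : 𝕜 => (τ, z)) t := by fun_prop
      have h3 := hc.unique (h2.congr_of_eventuallyEq (hct.eventually hw))
      simp only [id, one_smul] at h3
      exact h3.trans (add_comm _ _)
    -- Since u(s) should be φ(st, z), its t-derivative should be s L(u(s)). This candidate is shown
    -- to solve the same linear integral equation as the true derivative v; at s = 1 it is the flow
    -- equation.
    let y : C(I, V) := ⟨fun s => ((s : ℝ) : 𝕜) • N u s, by
      have : Continuous fun s : I => ((s : ℝ) : 𝕜) :=
        RCLike.continuous_ofReal.comp continuous_subtype_val
      exact this.smul (N u).continuous⟩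
    have hyeq : y = J (N u) + t • J (N' y) := by
      have h0 : J (N u) + t • J (N' y) = J (N u + t • N' y) := by simp
      rw [h0]
      have hext : ∀ x : C(I, V), Continuous (Set.IccExtend (zero_le_one' ℝ) x) :=
        fun x => x.continuous.Icc_extend'
      -- The integral formula extends u to all of ℝ, which provides two-sided derivatives even at
      -- the endpoints of [0, 1].
      let g : ℝ → V := fun r => z + t • ∫ r' in (0 : ℝ)..r, Set.IccExtend (zero_le_one' ℝ) (N u) r'
      have hg : ∀ r, HasDerivAt g (t • Set.IccExtend (zero_le_one' ℝ) (N u) r) r := fun r =>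
        (((hext (N u)).integral_hasStrictDerivAt 0 r).hasDerivAt.const_smul t).const_add z
      have hgu : ∀ s : I, g s = u s := by
        intro s
        have h1 := DFunLike.congr_fun hw.self_of_nhds s
        change u s = z + t • (J (N u)) s at h1
        rw [h1, hJ]
      have hgd : ∀ r ∈ Set.Icc (0 : ℝ) 1, HasDerivAt (fun r : ℝ => (r : 𝕜) • L (g r))
          (Set.IccExtend (zero_le_one' ℝ) (N u + t • N' y) r) r := by
        intro r hr
        have h1 : HasDerivAt (fun r : ℝ => (r : 𝕜)) 1 r := by
          simpa using (RCLike.ofRealCLM (K := 𝕜)).hasDerivAt (x := r)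
        have h2 : HasDerivAt (fun r : ℝ => L (g r))
            (fderiv 𝕜 L (g r) (t • Set.IccExtend (zero_le_one' ℝ) (N u) r)) r := by
          have h3 : DifferentiableAt 𝕜 L (g r) := by
            rw [hgu ⟨r, hr⟩]; exact hLw _
          exact (h3.hasFDerivAt.restrictScalars ℝ).comp_hasDerivAt r (hg r)
        have h4 := h1.fun_smul h2
        convert h4 using 1
        rw [Set.IccExtend_of_mem _ _ hr, Set.IccExtend_of_mem _ _ hr, hgu ⟨r, hr⟩]
        change N u ⟨r, hr⟩ + t • (N' y) ⟨r, hr⟩ = _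
        rw [hN's, one_smul, add_comm, hNu]
        congr 1
        change t • fderiv 𝕜 L (u ⟨r, hr⟩) ((r : 𝕜) • N u ⟨r, hr⟩) = _
        rw [map_smul, map_smul, smul_comm, hNu]
      ext s
      rw [hJ, intervalIntegral.integral_eq_sub_of_hasDerivAt (f := fun r : ℝ => (r : 𝕜) • L (g r))]
      · simp [y, hgu, hNu]
      · intro r hr
        rw [Set.uIcc_of_le s.2.1] at hr
        exact hgd r ⟨hr.1, hr.2.trans s.2.2⟩
      · exact (hext _).intervalIntegrable _ _
    have hvy : v = y := by
      -- The difference satisfies the homogeneous equation, whose operator has norm below 1.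
      have h1 : v - y = t • J (N' (v - y)) := by
        conv_lhs => rw [hveq, hyeq]
        simp [smul_sub]
      have h2 : ‖v - y‖ ≤ ‖t‖ * (‖J‖ * ‖N'‖) * ‖v - y‖ := by
        conv_lhs => rw [h1]
        rw [norm_smul, mul_assoc, mul_assoc]
        gcongr
        exact (J.le_opNorm _).trans (by gcongr; exact N'.le_opNorm _)
      have h3 : ‖v - y‖ = 0 := by
        have h4 : ‖t‖ * (‖J‖ * ‖N'‖) < 1 := hs
        nlinarith [norm_nonneg (v - y)]
      exact sub_eq_zero.1 (norm_eq_zero.1 h3)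
    have hfin : HasDerivAt (fun τ => ev 1 (uu (τ, z))) (ev 1 v) t :=
      (ev 1).hasFDerivAt.comp_hasDerivAt t hc
    convert hfin using 1
    rw [hvy]
    change L (u 1) = (((1 : I) : ℝ) : 𝕜) • N u 1
    rw [hNu]; simp

end Flow

/-! ### Iterated partial derivatives, with analytic parameters. -/

section PartialDerivatives

variable {𝕜 : Type*} [RCLike 𝕜] {n : ℕ} {C : Type*} [NormedAddCommGroup C] [NormedSpace 𝕜 C]
  {f g : (Fin n → 𝕜) → 𝕜} {x : Fin n → 𝕜}

theorem AnalyticAt.clm_apply_vec {E F G : Type*} [NormedAddCommGroup E] [NormedSpace 𝕜 E]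
    [NormedAddCommGroup F] [NormedSpace 𝕜 F] [NormedAddCommGroup G] [NormedSpace 𝕜 G]
    {A : E → F →L[𝕜] G} {v : E → F} {x : E} (hA : AnalyticAt 𝕜 A x) (hv : AnalyticAt 𝕜 v x) :
    AnalyticAt 𝕜 (fun z => A z (v z)) x :=
  ((ContinuousLinearMap.apply 𝕜 G (E := F)).flip.analyticAt_bilinear _).comp₂ hA hv

/-- Directional derivatives of an analytic function commute. -/
theorem AnalyticAt.eventually_fderiv_fderiv_comm {E F : Type*} [NormedAddCommGroup E]
    [NormedSpace 𝕜 E] [NormedAddCommGroup F] [NormedSpace 𝕜 F] [CompleteSpace F] {f : E → F} {x : E}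
    (hf : AnalyticAt 𝕜 f x) (u v : E) :
    ∀ᶠ y in 𝓝 x, fderiv 𝕜 (fun z => fderiv 𝕜 f z u) y v = fderiv 𝕜 (fun z => fderiv 𝕜 f z v) y u := by
  filter_upwards [hf.eventually_analyticAt] with y hy
  have h : ∀ a b : E, fderiv 𝕜 (fun z => fderiv 𝕜 f z a) y b = fderiv 𝕜 (fderiv 𝕜 f) y b a := by
    intro a b
    rw [fderiv_clm_apply hy.fderiv.differentiableAt (differentiableAt_const a)]
    simp
  rw [h, h]
  exact (hy.contDiffAt (n := ⊤)).isSymmSndFDerivAt (by simp) v u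

theorem pd_congr (i : Fin n) (h : f =ᶠ[𝓝 x] g) : pd i f =ᶠ[𝓝 x] pd i g :=
  (h.fderiv (𝕜 := 𝕜)).mono fun y hy => by simp only [pd, hy]

theorem pd_iterate_congr (i : Fin n) (k : ℕ) (h : f =ᶠ[𝓝 x] g) :
    (pd i)^[k] f =ᶠ[𝓝 x] (pd i)^[k] g := by
  induction k with
  | zero => exact h
  | succ k ih => simpa only [Function.iterate_succ_apply'] using pd_congr i ih

theorem mpd_congr (α : Fin n → ℕ) (h : f =ᶠ[𝓝 x] g) : mpd α f =ᶠ[𝓝 x] mpd α g := by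
  unfold mpd
  induction List.finRange n with
  | nil => exact h
  | cons i l ih => exact pd_iterate_congr i _ ih

/-- A partial derivative in x is the derivative of the joint function in the direction (e_i, 0),
hence remains jointly analytic in the variables and the parameters and can be iterated. -/
theorem pd_analyticAt_param (i : Fin n) {H : C → (Fin n → 𝕜) → 𝕜} {w : (Fin n → 𝕜) × C}
    (hH : AnalyticAt 𝕜 (fun w : (Fin n → 𝕜) × C => H w.2 w.1) w) :
    (∀ᶠ w' in 𝓝 w, pd i (H w'.2) w'.1 =
      fderiv 𝕜 (fun w : (Fin n → 𝕜) × C => H w.2 w.1) w' (Pi.single i 1, 0)) ∧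
    AnalyticAt 𝕜 (fun w : (Fin n → 𝕜) × C => pd i (H w.2) w.1) w := by
  have h : ∀ᶠ w' in 𝓝 w, pd i (H w'.2) w'.1 =
      fderiv 𝕜 (fun w : (Fin n → 𝕜) × C => H w.2 w.1) w' (Pi.single i 1, 0) := by
    filter_upwards [hH.eventually_analyticAt] with w' hw'
    have h2 : HasFDerivAt (fun y => H w'.2 y)
        ((fderiv 𝕜 (fun w : (Fin n → 𝕜) × C => H w.2 w.1) w').comp
          (ContinuousLinearMap.inl 𝕜 (Fin n → 𝕜) C)) w'.1 :=
      HasFDerivAt.comp (f := fun y => (y, w'.2)) w'.1 (g := fun w : (Fin n → 𝕜) × C => H w.2 w.1)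
        hw'.differentiableAt.hasFDerivAt (hasFDerivAt_prodMk_left w'.1 w'.2)
    simp [pd, h2.fderiv]
  refine ⟨h, ?_⟩
  have h3 := (hH.fderiv).clm_apply_vec (analyticAt_const (v := ((Pi.single i 1 : Fin n → 𝕜), (0 : C))))
  exact h3.congr (h.mono fun _ hy => hy.symm)

theorem mpd_analyticAt_param (α : Fin n → ℕ) {H : C → (Fin n → 𝕜) → 𝕜} {w : (Fin n → 𝕜) × C}
    (hH : AnalyticAt 𝕜 (fun w : (Fin n → 𝕜) × C => H w.2 w.1) w) :
    AnalyticAt 𝕜 (fun w : (Fin n → 𝕜) × C => mpd α (H w.2) w.1) w := by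
  unfold mpd
  induction List.finRange n with
  | nil => exact hH
  | cons i l ih =>
    simp only [List.foldr_cons]
    induction α i with
    | zero => exact ih
    | succ k ihk =>
      simp only [Function.iterate_succ_apply']
      exact (pd_analyticAt_param (H := fun c => (pd i)^[k] (List.foldr _ (H c) l)) i ihk).2

theorem mpd_analyticAt (α : Fin n → ℕ) (hf : AnalyticAt 𝕜 f x) : AnalyticAt 𝕜 (mpd α f) x := by
  have h := mpd_analyticAt_param (C := 𝕜) (H := fun _ => f) (w := (x, 0)) α
    (AnalyticAt.comp_of_eq hf analyticAt_fst rfl)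
  exact AnalyticAt.comp₂' (g := fun y => y) (h := fun _ => (0 : 𝕜)) h analyticAt_id
    analyticAt_const rfl

theorem pd_analyticAt (i : Fin n) (hf : AnalyticAt 𝕜 f x) : AnalyticAt 𝕜 (pd i f) x :=
  hf.fderiv.clm_apply_vec analyticAt_const

theorem pd_iterate_analyticAt (i : Fin n) (k : ℕ) (hf : AnalyticAt 𝕜 f x) :
    AnalyticAt 𝕜 ((pd i)^[k] f) x := by
  induction k with
  | zero => exact hf
  | succ k ih => simpa only [Function.iterate_succ_apply'] using pd_analyticAt i ih

theorem pd_iterate_comm (i k : Fin n) (a : ℕ) (hf : AnalyticAt 𝕜 f x) :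
    (pd k)^[a] (pd i f) =ᶠ[𝓝 x] pd i ((pd k)^[a] f) := by
  induction a with
  | zero => exact EventuallyEq.rfl
  | succ a ih =>
    simp only [Function.iterate_succ_apply']
    exact (pd_congr k ih).trans
      ((pd_iterate_analyticAt k a hf).eventually_fderiv_fderiv_comm _ _)

theorem mpd_zero (f : (Fin n → 𝕜) → 𝕜) : mpd 0 f = f := by
  unfold mpd
  induction List.finRange n with
  | nil => rfl
  | cons i l ih => exact ih

/-- `mpd` differentiates in a fixed order of the variables. The extra derivative is produced at the
place of i and is moved to the outside by symmetry of second derivatives. -/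
theorem mpd_add_single (α : Fin n → ℕ) (i : Fin n) (hf : AnalyticAt 𝕜 f x) :
    mpd (α + Pi.single i 1) f =ᶠ[𝓝 x] pd i (mpd α f) := by
  have h1 : ∀ l : List (Fin n), i ∉ l →
      l.foldr (fun k g => (pd k)^[(α + Pi.single i 1 : Fin n → ℕ) k] g) f =
        l.foldr (fun k g => (pd k)^[α k] g) f := by
    intro l
    induction l with
    | nil => intro _; rfl
    | cons k l ih =>
      intro hi
      rw [List.mem_cons, not_or] at hi
      simp only [List.foldr_cons, ih hi.2]
      simp [Pi.single_eq_of_ne (Ne.symm hi.1)]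
  have h2 : ∀ l : List (Fin n), AnalyticAt 𝕜 (l.foldr (fun k g => (pd k)^[α k] g) f) x := by
    intro l
    induction l with
    | nil => exact hf
    | cons k l ih => exact pd_iterate_analyticAt k _ ih
  have h3 : ∀ l : List (Fin n), l.Nodup → i ∈ l →
      l.foldr (fun k g => (pd k)^[(α + Pi.single i 1 : Fin n → ℕ) k] g) f =ᶠ[𝓝 x]
        pd i (l.foldr (fun k g => (pd k)^[α k] g) f) := by
    intro l
    induction l with
    | nil => intro _ h; simp at h
    | cons k l ih =>
      intro hl hi
      rw [List.nodup_cons] at hl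
      by_cases hk : k = i
      · subst hk
        rw [List.foldr_cons, h1 l hl.1, List.foldr_cons]
        simp only [Pi.add_apply, Pi.single_eq_same, Function.iterate_succ_apply']
        exact EventuallyEq.rfl
      · have hi' : i ∈ l := by
          rcases List.mem_cons.1 hi with h | h
          · exact absurd h.symm hk
          · exact h
        simp only [List.foldr_cons, Pi.add_apply, Pi.single_eq_of_ne hk, add_zero]
        exact (pd_iterate_congr k _ (ih hl.2 hi')).trans (pd_iterate_comm i k _ (h2 l))
  exact h3 _ (List.nodup_finRange n) (List.mem_finRange i)

theorem mpd_single (i : Fin n) (hf : AnalyticAt 𝕜 f x) :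
    mpd (Pi.single i 1) f =ᶠ[𝓝 x] pd i f := by
  simpa [mpd_zero] using mpd_add_single 0 i hf

theorem mpd_add_single_param (α : Fin n → ℕ) (i : Fin n) {H : C → (Fin n → 𝕜) → 𝕜}
    {w : (Fin n → 𝕜) × C} (hH : AnalyticAt 𝕜 (fun w : (Fin n → 𝕜) × C => H w.2 w.1) w) :
    ∀ᶠ w' in 𝓝 w, mpd (α + Pi.single i 1) (H w'.2) w'.1 =
      fderiv 𝕜 (fun w : (Fin n → 𝕜) × C => mpd α (H w.2) w.1) w' (Pi.single i 1, 0) := by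
  filter_upwards [(pd_analyticAt_param (H := fun c => mpd α (H c)) i (mpd_analyticAt_param α hH)).1,
    hH.eventually_analyticAt] with w' h1 h2
  rw [← h1]
  refine (mpd_add_single α i ?_).self_of_nhds
  exact AnalyticAt.comp₂' (f := fun w : (Fin n → 𝕜) × C => H w.2 w.1) h2 analyticAt_id
    analyticAt_const rfl

theorem mdeg_add_single (α : Fin n → ℕ) (i : Fin n) : mdeg (α + Pi.single i 1) = mdeg α + 1 := by
  simp [mdeg, Finset.sum_add_distrib]

theorem mdeg_single (i : Fin n) : mdeg (Pi.single i 1 : Fin n → ℕ) = 1 := by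
  simp [mdeg]

/-- A nonzero multiindex is obtained by raising an entry of a smaller one. -/
theorem exists_add_single {α : Fin n → ℕ} (h : α ≠ 0) :
    ∃ (α' : Fin n → ℕ) (i : Fin n), α = α' + Pi.single i 1 := by
  obtain ⟨i, hi⟩ := Function.ne_iff.1 h
  refine ⟨Function.update α i (α i - 1), i, ?_⟩
  ext k
  by_cases hk : k = i
  · subst hk
    simp only [Pi.zero_apply, ne_eq] at hi
    simp; omega
  · simp [hk]

/-- A linear map on `𝕜ⁿ` vanishing on the standard basis is zero. -/
theorem ContinuousLinearMap.eq_zero_of_single {F : Type*} [NormedAddCommGroup F] [NormedSpace 𝕜 F]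
    {A : (Fin n → 𝕜) →L[𝕜] F} (h : ∀ i, A (Pi.single i 1) = 0) : A = 0 := by
  ext v
  rw [pi_eq_sum_univ' v]
  simp [map_sum, h]

end PartialDerivatives

/-! ### Jets of solutions and the general solution. -/

section GeneralSolutions

variable {𝕜 : Type*} [RCLike 𝕜] {n m p : ℕ} {I : JetIndex n m p}

theorem JetIndex.mdeg_le_order (I : JetIndex n m p) (q : Fin p) : mdeg (I.β q) ≤ I.order :=
  Finset.le_sup (f := fun q => mdeg (I.β q)) (Finset.mem_univ q)

theorem JetIndex.β_ne_zero (I : JetIndex n m p) (q : Fin p) : I.β q ≠ 0 := by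
  intro h
  have := I.one_le q
  simp [h, mdeg] at this

/-- The coordinates on the skeleton of the jet of `s` at `x`. -/
noncomputable def JetIndex.jetAt (I : JetIndex n m p) (s : (Fin n → 𝕜) → Fin m → 𝕜)
    (x : Fin n → 𝕜) : JetSpace 𝕜 n m p :=
  (x, s x, I.derivs s x)

theorem JetIndex.jetAt_congr (I : JetIndex n m p) {s s' : (Fin n → 𝕜) → Fin m → 𝕜}
    {x : Fin n → 𝕜} (h : s =ᶠ[𝓝 x] s') : I.jetAt s x = I.jetAt s' x := by
  have h1 : ∀ q, mpd (I.β q) (fun x' => s x' (I.j q)) x = mpd (I.β q) (fun x' => s' x' (I.j q)) x :=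
    fun q => (mpd_congr (I.β q) (h.mono fun y hy => congrFun hy (I.j q))).self_of_nhds
  simp only [jetAt, h.self_of_nhds, Prod.mk.injEq, true_and]
  exact funext h1

theorem JetIndex.jetAt_analyticAt_param {C : Type*} [NormedAddCommGroup C] [NormedSpace 𝕜 C]
    (I : JetIndex n m p) {Q : (Fin n → 𝕜) → C → Fin m → 𝕜} {w : (Fin n → 𝕜) × C}
    (hQ : AnalyticAt 𝕜 (fun w : (Fin n → 𝕜) × C => Q w.1 w.2) w) :
    AnalyticAt 𝕜 (fun w : (Fin n → 𝕜) × C => I.jetAt (fun x => Q x w.2) w.1) w := by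
  refine analyticAt_fst.prod (hQ.prod (analyticAt_pi_iff.2 fun q => ?_))
  exact mpd_analyticAt_param (H := fun c x => Q x c (I.j q)) (I.β q)
    (analyticAt_pi_iff.1 hQ (I.j q))

theorem JetIndex.jetAt_analyticAt (I : JetIndex n m p) {s : (Fin n → 𝕜) → Fin m → 𝕜}
    {x : Fin n → 𝕜} (hs : AnalyticAt 𝕜 s x) : AnalyticAt 𝕜 (I.jetAt s) x := by
  refine analyticAt_id.prod (hs.prod (analyticAt_pi_iff.2 fun q => ?_))
  exact mpd_analyticAt (I.β q) (analyticAt_pi_iff.1 hs (I.j q))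

/-- The jet of the solution `P(·, c)` at `x`, as a function of `(x, c)`. -/
noncomputable def DefMap.jetMap (P : DefMap 𝕜 n m p) (I : JetIndex n m p)
    (w : (Fin n → 𝕜) × ((Fin p → 𝕜) × (Fin m → 𝕜))) : JetSpace 𝕜 n m p :=
  I.jetAt (fun x => P x w.2) w.1

theorem DefMap.Analytic.jetMap {P : DefMap 𝕜 n m p} (hP : P.Analytic) (I : JetIndex n m p) :
    AnalyticAt 𝕜 (P.jetMap I) 0 :=
  I.jetAt_analyticAt_param (Q := P) hP

theorem DefMap.Analytic.eventually_analyticAt {P : DefMap 𝕜 n m p} (hP : P.Analytic) :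
    ∀ᶠ w in 𝓝 (0 : (Fin n → 𝕜) × ((Fin p → 𝕜) × (Fin m → 𝕜))),
      AnalyticAt 𝕜 (fun x => P x w.2) w.1 := by
  have h : AnalyticAt 𝕜 (fun w : (Fin n → 𝕜) × ((Fin p → 𝕜) × (Fin m → 𝕜)) => P w.1 w.2) 0 := hP
  filter_upwards [h.eventually_analyticAt] with w hw
  exact AnalyticAt.comp₂' (f := fun w : (Fin n → 𝕜) × ((Fin p → 𝕜) × (Fin m → 𝕜)) => P w.1 w.2)
    hw analyticAt_id analyticAt_const rfl

/-- The jet map preserves the x-coordinate, so its derivative at 0 is block triangular and is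
invertible as soon as its restriction to x = 0 is; that is exactly the rank hypothesis. -/
theorem DefMap.HasMaximalRank.exists_inverse {P : DefMap 𝕜 n m p} (hr : P.HasMaximalRank I)
    (hP : P.Analytic) (h0 : P.jetMap I 0 = 0) :
    ∃ Φ : JetSpace 𝕜 n m p → (Fin n → 𝕜) × ((Fin p → 𝕜) × (Fin m → 𝕜)), AnalyticAt 𝕜 Φ 0 ∧
      Φ 0 = 0 ∧ (∀ᶠ w in 𝓝 0, Φ (P.jetMap I w) = w) ∧ ∀ᶠ v in 𝓝 0, P.jetMap I (Φ v) = v := by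
  have hf : AnalyticAt 𝕜 (fun w => (P.jetMap I w).2) 0 :=
    analyticAt_snd.comp_of_eq (hP.jetMap I) rfl
  have hb := bijective_fderiv_graph (u₀ := (0 : Fin n → 𝕜))
    (x₀ := (0 : (Fin p → 𝕜) × (Fin m → 𝕜))) hf.differentiableAt hr
  have h := (hP.jetMap I).exists_local_inverse hb
  rwa [h0] at h

namespace PDESystem

variable (E : PDESystem 𝕜 I)

theorem jet_zero (j : Fin m) (w : JetSpace 𝕜 n m p) : E.jet j 0 w = w.2.1 j := by
  simp [jet]

theorem jet_β (q : Fin p) (w : JetSpace 𝕜 n m p) : E.jet (I.j q) (I.β q) w = w.2.2 q := by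
  have h : ∃ q', I.j q' = I.j q ∧ I.β q' = I.β q := ⟨q, rfl, rfl⟩
  -- The pairs are distinct, so the index selected by choice in `jet` can only be q.
  have h2 : h.choose = q := I.inj (Prod.ext h.choose_spec.1 h.choose_spec.2)
  rw [jet, if_neg (I.β_ne_zero q), dif_pos h, h2]

theorem jet_of_isPrincipal {j : Fin m} {α : Fin n → ℕ} (h : I.IsPrincipal j α)
    (w : JetSpace 𝕜 n m p) : E.jet j α w = E.F j α w := by
  have h2 : ¬ ∃ q, I.j q = j ∧ I.β q = α := by
    rintro ⟨q, rfl, rfl⟩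
    exact h.2.1 q rfl
  rw [jet, if_neg h.1, dif_neg h2]

/-- A jet variable is `y^j`, one of the coordinates `y^{j(q)}_{β(q)}`, or principal. -/
theorem jet_cases {motive : Fin m → (Fin n → ℕ) → Prop} (j : Fin m) (α : Fin n → ℕ)
    (hα : mdeg α ≤ I.order + 1) (h0 : ∀ j, motive j 0) (h1 : ∀ q, motive (I.j q) (I.β q))
    (h2 : ∀ j α, I.IsPrincipal j α → motive j α) : motive j α := by
  by_cases h : α = 0
  · subst h; exact h0 j
  · by_cases h' : ∃ q, (j, α) = (I.j q, I.β q)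
    · obtain ⟨q, hq⟩ := h'
      obtain ⟨rfl, rfl⟩ := Prod.mk.inj hq
      exact h1 q
    · exact h2 j α ⟨h, fun q hq => h' ⟨q, hq⟩, hα⟩

theorem jet_analyticAt (j : Fin m) (α : Fin n → ℕ) (hα : mdeg α ≤ I.order + 1) :
    AnalyticAt 𝕜 (E.jet j α) 0 := by
  refine jet_cases (motive := fun j α => AnalyticAt 𝕜 (E.jet j α) 0) j α hα ?_ ?_ ?_
  · intro j
    have h : E.jet j 0 = fun w => w.2.1 j := funext fun w => E.jet_zero j w
    rw [h]
    exact analyticAt_pi_iff.1 (analyticAt_fst.comp_of_eq analyticAt_snd rfl) j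
  · intro q
    have h : E.jet (I.j q) (I.β q) = fun w => w.2.2 q := funext fun w => E.jet_β q w
    rw [h]
    exact analyticAt_pi_iff.1 (analyticAt_snd.comp_of_eq analyticAt_snd rfl) q
  · intro j α h
    have h' : E.jet j α = E.F j α := funext fun w => E.jet_of_isPrincipal h w
    rw [h']
    exact E.analytic j α h

theorem mdeg_single_le : ∀ i : Fin n, mdeg (Pi.single i 1 : Fin n → ℕ) ≤ I.order + 1 := by
  intro i; rw [mdeg_single]; omega

theorem mdeg_β_add_single_le (q : Fin p) (i : Fin n) :
    mdeg (I.β q + Pi.single i 1) ≤ I.order + 1 := by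
  rw [mdeg_add_single]; have := I.mdeg_le_order q; omega

theorem totalD_analyticAt (i : Fin n) : AnalyticAt 𝕜 (E.totalD i) 0 :=
  analyticAt_const.prod ((analyticAt_pi_iff.2 fun j =>
    E.jet_analyticAt j _ (mdeg_single_le (I := I) i)).prod
      (analyticAt_pi_iff.2 fun q => E.jet_analyticAt _ _ (mdeg_β_add_single_le q i)))

variable {E}

/-- This lets one treat the three kinds of jet variables uniformly: at a point where the equations
hold, each of them of order up to κ + 1 is an actual derivative of s. -/
theorem HoldsAt.jet_eq {s : (Fin n → 𝕜) → Fin m → 𝕜} {x : Fin n → 𝕜} (h : E.HoldsAt s x)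
    (j : Fin m) (α : Fin n → ℕ) (hα : mdeg α ≤ I.order + 1) :
    E.jet j α (I.jetAt s x) = mpd α (fun x' => s x' j) x := by
  refine jet_cases (motive := fun j α => E.jet j α (I.jetAt s x) = mpd α (fun x' => s x' j) x)
    j α hα ?_ ?_ ?_
  · intro j
    rw [jet_zero, mpd_zero]; rfl
  · intro q
    rw [jet_β]; rfl
  · intro j α hp
    rw [E.jet_of_isPrincipal hp, h j α hp]; rfl

/-- Along a solution, the total differentiation operators are the partial derivatives. -/
theorem HoldsAt.fderiv_jetAt {s : (Fin n → 𝕜) → Fin m → 𝕜} {x : Fin n → 𝕜} (h : E.HoldsAt s x)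
    (hs : AnalyticAt 𝕜 s x) (i : Fin n) :
    fderiv 𝕜 (I.jetAt s) x (Pi.single i 1) = E.totalD i (I.jetAt s x) := by
  have hsj := fun j => analyticAt_pi_iff.1 hs j
  have h1 : HasFDerivAt s (ContinuousLinearMap.pi fun j => fderiv 𝕜 (fun x' => s x' j) x) x :=
    hasFDerivAt_pi.2 fun j => (hsj j).differentiableAt.hasFDerivAt
  have h2 : HasFDerivAt (I.derivs s) (ContinuousLinearMap.pi fun q =>
      fderiv 𝕜 (mpd (I.β q) fun x' => s x' (I.j q)) x) x :=
    hasFDerivAt_pi.2 fun q =>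
      (mpd_analyticAt (I.β q) (hsj (I.j q))).differentiableAt.hasFDerivAt
  have h3 : HasFDerivAt (I.jetAt s) _ x := (hasFDerivAt_id x).prodMk (h1.prodMk h2)
  rw [h3.fderiv]
  refine Prod.ext rfl (Prod.ext (funext fun j => ?_) (funext fun q => ?_))
  · change pd i (fun x' => s x' j) x = E.jet j (Pi.single i 1) (I.jetAt s x)
    rw [h.jet_eq j _ (mdeg_single_le (I := I) i), (mpd_single i (hsj j)).self_of_nhds]
  · change pd i (mpd (I.β q) fun x' => s x' (I.j q)) x = E.jet (I.j q) (I.β q + Pi.single i 1) _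
    rw [h.jet_eq _ _ (mdeg_β_add_single_le q i),
      (mpd_add_single (I.β q) i (hsj (I.j q))).self_of_nhds]

theorem SolvedBy.fderiv_jetMap {P : DefMap 𝕜 n m p} (h : E.SolvedBy P) (i : Fin n) :
    ∀ᶠ w in 𝓝 0, fderiv 𝕜 (P.jetMap I) w (Pi.single i 1, 0) = E.totalD i (P.jetMap I w) := by
  filter_upwards [h.2, h.1.eventually_analyticAt, (h.1.jetMap I).eventually_analyticAt]
    with w h1 h2 h3
  rw [DefMap.jetMap, ← h1.fderiv_jetAt h2 i]
  have h4 : HasFDerivAt (I.jetAt fun x => P x w.2)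
      ((fderiv 𝕜 (P.jetMap I) w).comp (ContinuousLinearMap.inl 𝕜 _ _)) w.1 :=
    HasFDerivAt.comp (f := fun x => (x, w.2)) (g := P.jetMap I) w.1
      h3.differentiableAt.hasFDerivAt (hasFDerivAt_prodMk_left w.1 w.2)
  rw [h4.fderiv]; simp

/-- The local inverse of the jet map straightens the total differentiation operators. -/
theorem SolvedBy.fderiv_inverse {P : DefMap 𝕜 n m p} (h : E.SolvedBy P)
    {Φ : JetSpace 𝕜 n m p → (Fin n → 𝕜) × ((Fin p → 𝕜) × (Fin m → 𝕜))}
    (hΦ : AnalyticAt 𝕜 Φ 0) (h0 : Φ 0 = 0) (hP0 : P.jetMap I 0 = 0)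
    (hl : ∀ᶠ w in 𝓝 0, Φ (P.jetMap I w) = w) (hr : ∀ᶠ v in 𝓝 0, P.jetMap I (Φ v) = v)
    (i : Fin n) :
    ∀ᶠ v in 𝓝 0, fderiv 𝕜 Φ v (E.totalD i v) = (Pi.single i 1, 0) := by
  have hct : Tendsto Φ (𝓝 0) (𝓝 0) := by
    have := hΦ.continuousAt.tendsto; rwa [h0] at this
  have hct' : Tendsto (P.jetMap I) (𝓝 0) (𝓝 0) := by
    have := (h.1.jetMap I).continuousAt.tendsto; rwa [hP0] at this
  filter_upwards [hr, hct.eventually (h.fderiv_jetMap i), hct.eventually hl.eventually_nhds,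
    hct.eventually (h.1.jetMap I).eventually_analyticAt,
    hΦ.eventually_analyticAt] with v h1 h2 h3 h4 h5
  rw [h1] at h2
  rw [← h2]
  -- The total derivative D_i is the image of (e_i, 0) under the jet map, and Φ inverts that map.
  have h6 : HasFDerivAt (fun w => Φ (P.jetMap I w))
      ((fderiv 𝕜 Φ v).comp (fderiv 𝕜 (P.jetMap I) (Φ v))) (Φ v) := by
    refine HasFDerivAt.comp (Φ v) ?_ h4.differentiableAt.hasFDerivAt
    rw [h1]; exact h5.differentiableAt.hasFDerivAt
  have h7 := h6.unique ((hasFDerivAt_id (Φ v)).congr_of_eventuallyEq h3)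
  exact DFunLike.congr_fun h7 _

/-- Every local solution whose jet is close to the origin is one of the solutions `P(·, c)`. -/
theorem SolvedBy.exists_eq_of_isSolutionAt {P : DefMap 𝕜 n m p} (h : E.SolvedBy P)
    {Φ : JetSpace 𝕜 n m p → (Fin n → 𝕜) × ((Fin p → 𝕜) × (Fin m → 𝕜))}
    (hΦ : AnalyticAt 𝕜 Φ 0) (h0 : Φ 0 = 0) (hP0 : P.jetMap I 0 = 0)
    (hl : ∀ᶠ w in 𝓝 0, Φ (P.jetMap I w) = w) (hr : ∀ᶠ v in 𝓝 0, P.jetMap I (Φ v) = v) :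
    ∃ N ∈ 𝓝 (0 : JetSpace 𝕜 n m p), ∀ (x₀ : Fin n → 𝕜) (s : (Fin n → 𝕜) → Fin m → 𝕜),
      E.IsSolutionAt s x₀ → I.jetAt s x₀ ∈ N →
        s =ᶠ[𝓝 x₀] fun x => P x (Φ (I.jetAt s x₀)).2 := by
  have hall : ∀ᶠ v in 𝓝 (0 : JetSpace 𝕜 n m p), (∀ i, fderiv 𝕜 Φ v (E.totalD i v) =
      (Pi.single i 1, 0)) ∧ P.jetMap I (Φ v) = v ∧ AnalyticAt 𝕜 Φ v :=
    (eventually_all.2 fun i => h.fderiv_inverse hΦ h0 hP0 hl hr i).and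
      (hr.and hΦ.eventually_analyticAt)
  refine ⟨_, hall.eventually_nhds, fun x₀ s hs hN => ?_⟩
  have hc : ContinuousAt (I.jetAt s) x₀ := (I.jetAt_analyticAt hs.1).continuousAt
  -- The parameter part of Φ along the jet of s has zero derivative: the jet moves in the directions
  -- D_i, which Φ sends to (e_i, 0).
  have hev : ∀ᶠ x in 𝓝 x₀, fderiv 𝕜 (fun x => (Φ (I.jetAt s x)).2) x = 0 ∧
      P.jetMap I (Φ (I.jetAt s x)) = I.jetAt s x ∧
      DifferentiableAt 𝕜 (fun x => (Φ (I.jetAt s x)).2) x := by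
    filter_upwards [hc.eventually hN, hs.2, hs.1.eventually_analyticAt] with x h1 h2 h3
    have h4 : HasFDerivAt (fun x => Φ (I.jetAt s x))
        ((fderiv 𝕜 Φ (I.jetAt s x)).comp (fderiv 𝕜 (I.jetAt s) x)) x :=
      HasFDerivAt.comp x h1.2.2.differentiableAt.hasFDerivAt
        (I.jetAt_analyticAt h3).differentiableAt.hasFDerivAt
    refine ⟨ContinuousLinearMap.eq_zero_of_single fun i => ?_, h1.2.1, h4.snd.differentiableAt⟩
    rw [h4.snd.fderiv]
    simp only [ContinuousLinearMap.comp_apply]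
    rw [h2.fderiv_jetAt h3, h1.1 i]; rfl
  obtain ⟨r, hr, hrW⟩ := Metric.eventually_nhds_iff_ball.1 hev
  filter_upwards [Metric.ball_mem_nhds _ hr] with x hx
  have hcst : (Φ (I.jetAt s x)).2 = (Φ (I.jetAt s x₀)).2 :=
    Metric.isOpen_ball.is_const_of_fderiv_eq_zero (𝕜 := 𝕜) (f := fun x => (Φ (I.jetAt s x)).2)
      (convex_ball x₀ r).isPreconnected
      (fun y hy => (hrW y hy).2.2.differentiableWithinAt) (fun y hy => (hrW y hy).1) hx
      (Metric.mem_ball_self hr)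
  have h1 := (hrW x hx).2.1
  have h2 : (Φ (I.jetAt s x)).1 = x := congrArg Prod.fst h1
  have h3 : P (Φ (I.jetAt s x)).1 (Φ (I.jetAt s x)).2 = s x := congrArg (fun v => v.2.1) h1
  rw [h2, hcst] at h3
  exact h3.symm

end PDESystem

end GeneralSolutions

/-! ### Successive flows of commuting fields. -/

section Frobenius

variable {𝕜 : Type*} [RCLike 𝕜] {n : ℕ}

/-- A map obtained by flowing successively along commuting vector fields `D₀, …, Dₙ₋₁` is an
integral map of all of them. -/
theorem fderiv_eq_of_successive_flows {C Z : Type*} [NormedAddCommGroup C] [NormedSpace 𝕜 C]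
    [NormedAddCommGroup Z] [NormedSpace 𝕜 Z] [CompleteSpace Z]
    {U : (Fin n → 𝕜) × C → Z} {D : Fin n → Z → Z} (hU : AnalyticAt 𝕜 U 0) (hU0 : U 0 = 0)
    (hD : ∀ i, AnalyticAt 𝕜 (D i) 0)
    (hbr : ∀ i k, ∀ᶠ v in 𝓝 0, fderiv 𝕜 (D k) v (D i v) = fderiv 𝕜 (D i) v (D k v))
    (hflow : ∀ i : Fin n, ∀ᶠ w in 𝓝 0, (∀ k, i < k → w.1 k = 0) →
      fderiv 𝕜 U w (Pi.single i 1, 0) = D i (U w)) (i : Fin n) :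
    ∀ᶠ w in 𝓝 0, fderiv 𝕜 U w (Pi.single i 1, 0) = D i (U w) := by
  have hUt : Tendsto U (𝓝 0) (𝓝 0) := by
    have := hU.continuousAt.tendsto; rwa [hU0] at this
  -- The defect of the k-th integrality equation. The goal is that it vanishes; the flow hypothesis
  -- gives this only where all later coordinates are zero.
  let δ : Fin n → (Fin n → 𝕜) × C → Z := fun k w =>
    fderiv 𝕜 U w (Pi.single k 1, 0) - D k (U w)
  have hδ : ∀ k, AnalyticAt 𝕜 (δ k) 0 := fun k =>
    (hU.fderiv.clm_apply_vec analyticAt_const).sub ((hD k).comp_of_eq hU hU0)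
  have hδd : ∀ k (v : (Fin n → 𝕜) × C), ∀ᶠ w in 𝓝 0, fderiv 𝕜 (δ k) w v =
      fderiv 𝕜 (fun z => fderiv 𝕜 U z (Pi.single k 1, 0)) w v -
        fderiv 𝕜 (D k) (U w) (fderiv 𝕜 U w v) := by
    intro k v
    filter_upwards [hU.eventually_analyticAt, hUt.eventually (hD k).eventually_analyticAt]
      with w h1 h2
    have h3 : HasFDerivAt (fun z => D k (U z)) ((fderiv 𝕜 (D k) (U w)).comp (fderiv 𝕜 U w)) w :=
      HasFDerivAt.comp w h2.differentiableAt.hasFDerivAt h1.differentiableAt.hasFDerivAt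
    have h4 : AnalyticAt 𝕜 (fun z => fderiv 𝕜 U z ((Pi.single k 1 : Fin n → 𝕜), (0 : C))) w :=
      h1.fderiv.clm_apply_vec analyticAt_const
    exact DFunLike.congr_fun (h4.differentiableAt.hasFDerivAt.sub h3).fderiv v
  -- Commutation of the fields and of the partial derivatives turns ∂δ_k/∂xⁱ into a linear
  -- expression in δ_k itself, so vanishing propagates in the direction xⁱ.
  have hlin : ∀ i k : Fin n, k < i → ∀ᶠ w in 𝓝 (0 : (Fin n → 𝕜) × C),
      (∀ l, i < l → w.1 l = 0) →
        fderiv 𝕜 (δ k) w (Pi.single i 1, 0) = fderiv 𝕜 (D i) (U w) (δ k w) := by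
    intro i k hki
    filter_upwards [hδd k (Pi.single i 1, 0), hδd i (Pi.single k 1, 0),
      hU.eventually_fderiv_fderiv_comm (Pi.single k 1, 0) (Pi.single i 1, 0),
      hUt.eventually (hbr i k), (hflow i).eventually_nhds, (hδ i).eventually_analyticAt]
      with w h1 h2 h3 h4 h5 h6 hw
    -- Moving in the direction e_k with k < i stays in the slice where the coordinates after i
    -- vanish, and δ_i is identically zero there.
    have h7 : fderiv 𝕜 (δ i) w (Pi.single k 1, 0) = 0 := by
      let γ : 𝕜 → (Fin n → 𝕜) × C := fun t => w + t • ((Pi.single k 1 : Fin n → 𝕜), (0 : C))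
      have hγ : HasDerivAt γ ((Pi.single k 1 : Fin n → 𝕜), (0 : C)) 0 := by
        have h := ((hasDerivAt_id (0 : 𝕜)).smul_const
          ((Pi.single k 1 : Fin n → 𝕜), (0 : C))).const_add w
        rwa [one_smul] at h
      have hγ0 : γ 0 = w := by simp [γ]
      have h8 : HasDerivAt (fun t => δ i (γ t)) (fderiv 𝕜 (δ i) w (Pi.single k 1, 0)) 0 := by
        refine HasFDerivAt.comp_hasDerivAt (f := γ) (l := δ i) 0 ?_ hγ
        rw [hγ0]; exact h6.differentiableAt.hasFDerivAt
      have h9 : ∀ᶠ t in 𝓝 (0 : 𝕜), δ i (γ t) = 0 := by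
        have := hγ.continuousAt.tendsto
        rw [hγ0] at this
        filter_upwards [this.eventually h5] with t ht
        refine sub_eq_zero.2 (ht fun l hl => ?_)
        have : l ≠ k := (hki.trans hl).ne'
        simp [γ, hw l hl, this]
      exact h8.unique ((hasDerivAt_const (0 : 𝕜) (0 : Z)).congr_of_eventuallyEq h9)
    have h10 := h5.self_of_nhds hw
    rw [h2, sub_eq_zero] at h7
    rw [h1, h3, h7, h10, h4, ← map_sub]
  -- Induction on the number N of free coordinates: when all the others are zero, the first N
  -- equations hold. Freeing xⁱ with i = N, the equations k < i extend from xⁱ = 0 by Grönwall, and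
  -- the equation k = i is the flow hypothesis.
  have hmain : ∀ N : ℕ, N ≤ n → ∀ᶠ w in 𝓝 (0 : (Fin n → 𝕜) × C),
      (∀ l : Fin n, N ≤ l → w.1 l = 0) → ∀ k : Fin n, (k : ℕ) < N → δ k w = 0 := by
    intro N
    induction N with
    | zero => exact fun _ => Eventually.of_forall fun w _ k hk => absurd hk (Nat.not_lt_zero _)
    | succ N ih =>
      intro hN
      have ih' := ih (by omega)
      let i : Fin n := ⟨N, hN⟩
      -- Isolates the new coordinate as a time variable: it keeps the earlier coordinates, inserts t
      -- as xⁱ and kills the later ones, which holds the curve inside the slice.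
      let σ : 𝕜 × ((Fin n → 𝕜) × C) → (Fin n → 𝕜) × C := fun u =>
        (fun l => if l < i then u.2.1 l else if l = i then u.1 else 0, u.2.2)
      have hσc : Continuous σ := by
        refine Continuous.prodMk (continuous_pi fun l => ?_) (by fun_prop)
        by_cases h1 : l < i
        · simp only [h1, if_true]; fun_prop
        · by_cases h2 : l = i
          · subst h2; simp only [lt_irrefl, if_false, if_true]; fun_prop
          · simp only [h1, h2, if_false]; fun_prop
      have hσ0 : σ 0 = 0 := by
        refine Prod.ext (funext fun l => ?_) rfl
        simp [σ]
      have hσt : Tendsto σ (𝓝 (0, 0)) (𝓝 0) := by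
        have := hσc.tendsto 0; rwa [hσ0] at this
      have hσd : ∀ u : 𝕜 × ((Fin n → 𝕜) × C), HasDerivAt (fun t => σ (t, u.2))
          ((Pi.single i 1 : Fin n → 𝕜), (0 : C)) u.1 := by
        intro u
        refine HasDerivAt.prodMk (hasDerivAt_pi.2 fun l => ?_) (hasDerivAt_const u.1 u.2.2)
        by_cases h2 : l = i
        · subst h2
          simp only [lt_irrefl, if_false, if_true, Pi.single_eq_same]
          exact hasDerivAt_id _
        · by_cases h1 : l < i <;>
          · simp only [h1, h2, if_false, if_true, Pi.single_eq_of_ne h2]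
            exact hasDerivAt_const _ _
      have hσs : ∀ u, ∀ l, i < l → (σ u).1 l = 0 := by
        intro u l hl
        simp [σ, hl.not_gt, hl.ne']
      have hk : ∀ k : Fin n, k < i → ∀ᶠ w in 𝓝 (0 : (Fin n → 𝕜) × C),
          (∀ l, i < l → w.1 l = 0) → δ k w = 0 := by
        intro k hki
        have hz := eventually_eq_zero_of_norm_deriv_le (u₀ := (0 : (Fin n → 𝕜) × C))
          (H := fun u => δ k (σ u)) (H' := fun u => fderiv 𝕜 (δ k) (σ u) (Pi.single i 1, 0))
          (K := ‖fderiv 𝕜 (D i) 0‖ + 1) ?_ ?_ ?_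
        · have hc : Tendsto (fun w : (Fin n → 𝕜) × C => (w.1 i, w)) (𝓝 0) (𝓝 (0, 0)) := by
            have : Continuous (fun w : (Fin n → 𝕜) × C => (w.1 i, w)) := by fun_prop
            exact this.tendsto 0
          filter_upwards [hc.eventually hz] with w hw hs
          have : σ (w.1 i, w) = w := by
            refine Prod.ext (funext fun l => ?_) rfl
            rcases lt_trichotomy l i with h | h | h
            · simp [σ, h]
            · subst h; simp [σ]
            · rw [hσs _ l h, hs l h]
          rwa [this] at hw
        · filter_upwards [hσt.eventually (hδ k).eventually_analyticAt] with u hu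
          exact HasFDerivAt.comp_hasDerivAt u.1 hu.differentiableAt.hasFDerivAt (hσd u)
        · have hcn : ∀ᶠ w in 𝓝 (0 : (Fin n → 𝕜) × C),
              ‖fderiv 𝕜 (D i) (U w)‖ < ‖fderiv 𝕜 (D i) 0‖ + 1 :=
            hUt.eventually ((hD i).fderiv.continuousAt.norm.eventually_lt continuousAt_const
              (lt_add_one _))
          filter_upwards [hσt.eventually (hlin i k hki), hσt.eventually hcn] with u h1 h2
          rw [h1 (hσs u)]
          exact (ContinuousLinearMap.le_opNorm _ _).trans
            (mul_le_mul_of_nonneg_right h2.le (norm_nonneg _))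
        · have hc : Tendsto (fun w : (Fin n → 𝕜) × C => σ (0, w)) (𝓝 0) (𝓝 0) := by
            have : Continuous (fun w : (Fin n → 𝕜) × C => σ (0, w)) :=
              hσc.comp (by fun_prop)
            have := this.tendsto 0
            rwa [show σ (0, 0) = 0 from hσ0] at this
          filter_upwards [hc.eventually ih'] with w hw
          refine hw (fun l hl => ?_) k hki
          have h1 : ¬ l < i := not_lt.2 hl
          simp [σ, h1]
      have hk' : ∀ᶠ w in 𝓝 (0 : (Fin n → 𝕜) × C), ∀ k : Fin n, k < i →
          (∀ l, i < l → w.1 l = 0) → δ k w = 0 := by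
        refine eventually_all.2 fun k => ?_
        by_cases h : k < i
        · exact (hk k h).mono fun w hw _ => hw
        · exact Eventually.of_forall fun w h' => absurd h' h
      filter_upwards [hk', hflow i] with w h1 h2 hs k hkN
      have hs' : ∀ l, i < l → w.1 l = 0 := fun l hl => hs l (Nat.succ_le_of_lt hl)
      rcases Nat.lt_succ_iff_lt_or_eq.1 hkN with h | h
      · exact h1 k h hs'
      · have : k = i := Fin.ext h
        rw [this]
        exact sub_eq_zero.2 (h2 hs')
  filter_upwards [hmain n le_rfl] with w hw
  exact sub_eq_zero.1 (hw (fun l hl => absurd l.2 (not_lt.2 hl)) i i.2)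

end Frobenius

/-! ### From integrable systems to solution manifolds and back. -/

section AssociatedSystems

variable {𝕜 : Type*} [RCLike 𝕜] {n m p : ℕ} {I : JetIndex n m p}

namespace PDESystem

variable {E : PDESystem 𝕜 I}

/-- The total differentiation operators of a completely integrable system commute. -/
theorem CompletelyIntegrable.fderiv_totalD_comm (hE : E.CompletelyIntegrable) (i k : Fin n) :
    ∀ᶠ v in 𝓝 0, fderiv 𝕜 (E.totalD k) v (E.totalD i v) =
      fderiv 𝕜 (E.totalD i) v (E.totalD k v) := by
  filter_upwards [hE.2 i k, (E.totalD_analyticAt k).eventually_analyticAt,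
    (E.totalD_analyticAt i).eventually_analyticAt] with v h1 h2 h3
  -- The x-component of every D_k is constant, so the bracket has none. As the x-component of D_l is
  -- e_l, all coefficients of the bracket vanish.
  have hfst : ∀ k, AnalyticAt 𝕜 (E.totalD k) v → ∀ u, (fderiv 𝕜 (E.totalD k) v u).1 = 0 := by
    intro k hk u
    have h4 : HasFDerivAt (fun w => (E.totalD k w).1) _ v :=
      hk.differentiableAt.hasFDerivAt.fst
    have h5 := h4.unique (hasFDerivAt_const (Pi.single k 1 : Fin n → 𝕜) v)
    exact DFunLike.congr_fun h5 u
  obtain ⟨c, hc⟩ := (Submodule.mem_span_range_iff_exists_fun 𝕜).1 h1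
  rw [VectorField.lieBracket] at hc
  have hc1 := congrArg Prod.fst hc
  rw [Prod.fst_sub, hfst k h2, hfst i h3, sub_zero, Prod.fst_sum] at hc1
  have hc2 : ∀ l, c l = 0 := by
    intro l
    have := congrFun hc1 l
    simpa [totalD, Finset.sum_apply, Pi.single_apply] using this
  simp only [hc2, zero_smul, Finset.sum_const_zero] at hc
  exact sub_eq_zero.1 hc.symm

/-- The multiple flow U is integral for all the D_i, and the contact condition D_i y^j_α = y^j_{α +
e_i} then identifies the jet variables along U with the derivatives of P, by induction on the order.
In particular Ω is the vector of the distinguished derivatives. -/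
theorem IsSubmanifoldOfSolutions.solvedBy {P : DefMap 𝕜 n m p} (hE : E.CompletelyIntegrable)
    (hP : E.IsSubmanifoldOfSolutions P) : E.SolvedBy P ∧ P.jetMap I 0 = 0 := by
  obtain ⟨Ω, hPa, hΩ, hinit, hflow⟩ := hP
  have hPa' : AnalyticAt 𝕜 (fun w : (Fin n → 𝕜) × ((Fin p → 𝕜) × (Fin m → 𝕜)) => P w.1 w.2) 0 := hPa
  let U : (Fin n → 𝕜) × ((Fin p → 𝕜) × (Fin m → 𝕜)) → JetSpace 𝕜 n m p :=
    fun w => (w.1, P w.1 w.2, Ω w.1 w.2)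
  have hU : AnalyticAt 𝕜 U 0 := analyticAt_fst.prod (hPa'.prod hΩ)
  have hU0 : U 0 = 0 := Prod.ext rfl (Prod.ext hinit.self_of_nhds.1 hinit.self_of_nhds.2)
  have hUt : Tendsto U (𝓝 0) (𝓝 0) := by
    have := hU.continuousAt.tendsto; rwa [hU0] at this
  have hUd : ∀ i, ∀ᶠ w in 𝓝 0, fderiv 𝕜 U w (Pi.single i 1, 0) = E.totalD i (U w) := by
    refine fderiv_eq_of_successive_flows hU hU0 E.totalD_analyticAt hE.fderiv_totalD_comm
      fun i => ?_
    filter_upwards [hflow i, hU.eventually_analyticAt] with w h1 h2 hw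
    have h3 : HasDerivAt (fun t => (Function.update w.1 i t, w.2))
        ((Pi.single i 1 : Fin n → 𝕜), (0 : (Fin p → 𝕜) × (Fin m → 𝕜))) (w.1 i) :=
      (hasDerivAt_update w.1 i (w.1 i)).prodMk (hasDerivAt_const _ _)
    have h4 : HasDerivAt (fun t => U (Function.update w.1 i t, w.2))
        (fderiv 𝕜 U w (Pi.single i 1, 0)) (w.1 i) := by
      refine HasFDerivAt.comp_hasDerivAt (l := U) (w.1 i) ?_ h3
      rw [Function.update_eq_self]
      exact h2.differentiableAt.hasFDerivAt
    exact h4.unique (h1 hw)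
  have hPj : ∀ j, AnalyticAt 𝕜
      (fun w : (Fin n → 𝕜) × ((Fin p → 𝕜) × (Fin m → 𝕜)) => P w.1 w.2 j) 0 :=
    fun j => analyticAt_pi_iff.1 hPa' j
  have hjet : ∀ N : ℕ, N ≤ I.order + 1 → ∀ (j : Fin m) (α : Fin n → ℕ), mdeg α = N →
      ∀ᶠ w in 𝓝 0, mpd α (fun x => P x w.2 j) w.1 = E.jet j α (U w) := by
    intro N
    induction N with
    | zero =>
      intro _ j α hα
      have : α = 0 := by
        funext i
        exact Finset.sum_eq_zero_iff.1 hα i (Finset.mem_univ i)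
      subst this
      exact Eventually.of_forall fun w => by rw [mpd_zero, jet_zero]
    | succ N ih =>
      intro hN j α hα
      have hα0 : α ≠ 0 := by rintro rfl; simp [mdeg] at hα
      obtain ⟨α', i, rfl⟩ := exists_add_single hα0
      rw [mdeg_add_single] at hα
      have hα' : mdeg α' = N := by omega
      filter_upwards [(ih (by omega) j α' hα').eventually_nhds,
        mpd_add_single_param (H := fun c x => P x c j) α' i (hPj j), hUd i,
        hUt.eventually (hE.1 j α' i (by omega)), hU.eventually_analyticAt,
        hUt.eventually (E.jet_analyticAt j α' (by omega)).eventually_analyticAt]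
        with w h1 h2 h3 h4 h5 h6
      rw [h2, ← h4, ← h3]
      have h7 : HasFDerivAt (fun w => E.jet j α' (U w))
          ((fderiv 𝕜 (E.jet j α') (U w)).comp (fderiv 𝕜 U w)) w :=
        HasFDerivAt.comp w h6.differentiableAt.hasFDerivAt h5.differentiableAt.hasFDerivAt
      rw [(h7.congr_of_eventuallyEq h1).fderiv]
      rfl
  have hUP : ∀ᶠ w in 𝓝 0, U w = P.jetMap I w := by
    have := eventually_all.2 fun q : Fin p =>
      hjet _ ((I.mdeg_le_order q).trans (Nat.le_succ _)) (I.j q) (I.β q) rfl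
    filter_upwards [this] with w hw
    refine Prod.ext rfl (Prod.ext rfl (funext fun q => ?_))
    have h := hw q
    rw [jet_β] at h
    exact h.symm
  refine ⟨⟨hPa, ?_⟩, hUP.self_of_nhds.symm.trans hU0⟩
  have hfin : ∀ᶠ w in 𝓝 0, ∀ (j : Fin m) (α : {α : Fin n → ℕ // mdeg α ≤ I.order + 1}),
      mpd α.1 (fun x => P x w.2 j) w.1 = E.jet j α.1 (U w) := by
    -- Only finitely many multiindices occur, so one neighborhood serves all equations.
    have hf : Finite {α : Fin n → ℕ // mdeg α ≤ I.order + 1} := by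
      refine Set.Finite.subset (Set.finite_Iic (fun _ : Fin n => I.order + 1)) ?_
      intro α hα i
      exact (Finset.single_le_sum (f := α) (fun _ _ => Nat.zero_le _) (Finset.mem_univ i)).trans hα
    exact eventually_all.2 fun j => eventually_all.2 fun α => hjet _ α.2 j α.1 rfl
  filter_upwards [hfin, hUP] with w h1 h2 j α hp
  have h3 := h1 j ⟨α, hp.2.2⟩
  rw [E.jet_of_isPrincipal hp, h2] at h3
  exact h3

end PDESystem

theorem mpd_zero_fun (α : Fin n → ℕ) : mpd α (fun _ => (0 : 𝕜)) = fun _ => 0 := by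
  have h : ∀ (i : Fin n) (k : ℕ), (pd i)^[k] (fun _ => (0 : 𝕜)) = fun _ => 0 := by
    intro i k
    induction k with
    | zero => rfl
    | succ k ih =>
      rw [Function.iterate_succ_apply', ih]
      funext x; simp [pd]
  unfold mpd
  induction List.finRange n with
  | nil => rfl
  | cons i l ih => rw [List.foldr_cons, ih, h]

theorem DefMap.jetMap_eq_of_eventually_eq_zero {P : DefMap 𝕜 n m p}
    (h0 : ∀ᶠ x in 𝓝 0, P x 0 = 0) (I : JetIndex n m p) :
    ∀ᶠ x in 𝓝 0, P.jetMap I (x, 0) = (x, 0, 0) := by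
  filter_upwards [h0.eventually_nhds] with x hx
  rw [DefMap.jetMap, I.jetAt_congr (s' := fun _ => 0) hx]
  refine Prod.ext rfl (Prod.ext rfl (funext fun q => ?_))
  exact congrFun (mpd_zero_fun (I.β q)) x

/-- A system associated with a submanifold is completely integrable. -/
theorem PDESystem.IsAssociatedWith.completelyIntegrable {E : PDESystem 𝕜 I} {P : DefMap 𝕜 n m p}
    (h : E.IsAssociatedWith P) (h0 : P.jetMap I 0 = 0) : E.CompletelyIntegrable := by
  obtain ⟨Φ, hΦ, hΦ0, hl, hr⟩ := h.1.exists_inverse h.2.1 h0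
  have hΨ := h.2.1.jetMap I
  have hΦt : Tendsto Φ (𝓝 0) (𝓝 0) := by
    have := hΦ.continuousAt.tendsto; rwa [hΦ0] at this
  have hΨt : Tendsto (P.jetMap I) (𝓝 0) (𝓝 0) := by
    have := hΨ.continuousAt.tendsto; rwa [h0] at this
  -- The jet map is locally onto, so an identity on the skeleton need only be checked on jets of the
  -- solutions P(·, c).
  have htr : ∀ q : JetSpace 𝕜 n m p → Prop, (∀ᶠ w in 𝓝 0, q (P.jetMap I w)) → ∀ᶠ v in 𝓝 0, q v := by
    intro q hq
    filter_upwards [hΦt.eventually hq, hr] with v h1 h2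
    rwa [h2] at h1
  constructor
  · intro j α i hα
    refine htr _ ?_
    have hPj := analyticAt_pi_iff.1 h.2.1 j
    filter_upwards [h.2.fderiv_jetMap i, h.2.2.eventually_nhds, hΨ.eventually_analyticAt,
      hΨt.eventually (E.jet_analyticAt j α (by omega)).eventually_analyticAt,
      mpd_add_single_param (H := fun c x => P x c j) α i hPj] with w h1 h2 h3 h4 h5
    have h6 : HasFDerivAt (fun w => E.jet j α (P.jetMap I w))
        ((fderiv 𝕜 (E.jet j α) (P.jetMap I w)).comp (fderiv 𝕜 (P.jetMap I) w)) w :=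
      HasFDerivAt.comp w h4.differentiableAt.hasFDerivAt h3.differentiableAt.hasFDerivAt
    have h7 : (fun w => mpd α (fun x => P x w.2 j) w.1) =ᶠ[𝓝 w]
        fun w => E.jet j α (P.jetMap I w) :=
      h2.mono fun w' hw' => (hw'.jet_eq j α (by omega)).symm
    have h8 := h2.self_of_nhds.jet_eq j (α + Pi.single i 1) (by rw [mdeg_add_single]; omega)
    rw [← h1, ← ContinuousLinearMap.comp_apply, ← (h6.congr_of_eventuallyEq h7).fderiv, ← h5]
    exact h8.symm
  · intro i k
    refine htr _ ?_
    -- Pulled back by the jet map, the D_i become coordinate derivatives, and the bracket becomes a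
    -- difference of mixed second derivatives.
    have hder : ∀ i k, ∀ᶠ w in 𝓝 0, fderiv 𝕜 (E.totalD k) (P.jetMap I w) (E.totalD i (P.jetMap I w))
        = fderiv 𝕜 (fun z => fderiv 𝕜 (P.jetMap I) z (Pi.single k 1, 0)) w (Pi.single i 1, 0) := by
      intro i k
      filter_upwards [h.2.fderiv_jetMap i, (h.2.fderiv_jetMap k).eventually_nhds,
        hΨ.eventually_analyticAt, hΨt.eventually (E.totalD_analyticAt k).eventually_analyticAt]
        with w h1 h2 h3 h4
      have h6 : HasFDerivAt (fun w => E.totalD k (P.jetMap I w))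
          ((fderiv 𝕜 (E.totalD k) (P.jetMap I w)).comp (fderiv 𝕜 (P.jetMap I) w)) w :=
        HasFDerivAt.comp w h4.differentiableAt.hasFDerivAt h3.differentiableAt.hasFDerivAt
      rw [← h1, (h6.congr_of_eventuallyEq h2).fderiv]
      rfl
    filter_upwards [hder i k, hder k i,
      hΨ.eventually_fderiv_fderiv_comm (Pi.single k 1, 0) (Pi.single i 1, 0)] with w h1 h2 h3
    rw [VectorField.lieBracket, h1, h2, h3, sub_self]
    exact Submodule.zero_mem _

/-- Elimination of the parameters. -/
theorem DefMap.HasMaximalRank.exists_isAssociatedWith {P : DefMap 𝕜 n m p}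
    (hr : P.HasMaximalRank I) (hP : P.Analytic) (h0 : ∀ᶠ x in 𝓝 0, P x 0 = 0) :
    ∃ E : PDESystem 𝕜 I, E.IsAssociatedWith P := by
  have hj := DefMap.jetMap_eq_of_eventually_eq_zero h0 I
  obtain ⟨Φ, hΦ, hΦ0, hl, -⟩ := hr.exists_inverse hP hj.self_of_nhds
  -- The right-hand sides are the derivatives of P evaluated at the (x, c) that Φ recovers from the
  -- jet coordinates.
  refine ⟨⟨fun j α v => mpd α (fun x => P x (Φ v).2 j) (Φ v).1, ?_, ?_⟩, hr, hP, ?_⟩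
  · intro j α _
    have h1 := mpd_analyticAt_param (H := fun c x => P x c j)
      (w := (0 : (Fin n → 𝕜) × ((Fin p → 𝕜) × (Fin m → 𝕜)))) α (analyticAt_pi_iff.1 hP j)
    exact AnalyticAt.comp_of_eq h1 hΦ hΦ0
  · intro j α _
    have hc : Tendsto (fun x : Fin n → 𝕜 => (x, (0 : (Fin p → 𝕜) × (Fin m → 𝕜)))) (𝓝 0) (𝓝 0) := by
      have : Continuous fun x : Fin n → 𝕜 => (x, (0 : (Fin p → 𝕜) × (Fin m → 𝕜))) := by fun_prop
      exact this.tendsto 0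
    filter_upwards [hj, hc.eventually hl, h0.eventually_nhds] with x h1 h2 h3
    rw [h1] at h2
    simp only [h2]
    have h4 : (fun x => P x 0 j) =ᶠ[𝓝 x] fun _ => 0 := h3.mono fun y hy => congrFun hy j
    rw [(mpd_congr α h4).self_of_nhds, mpd_zero_fun]
  · filter_upwards [hl] with w hw j α _
    change _ = mpd α (fun x => P x (Φ (P.jetMap I w)).2 j) (Φ (P.jetMap I w)).1
    rw [hw]

end AssociatedSystems

/-! ### Tangent fields give symmetries. -/

section Symmetries

variable {𝕜 : Type*} [RCLike 𝕜] {n m p : ℕ} {I : JetIndex n m p}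

theorem IsLocalFlow.apply_zero {V : Type*} [NormedAddCommGroup V] [NormedSpace 𝕜 V] {L : V → V}
    {φ : 𝕜 × V → V} (h : IsLocalFlow L φ) : φ 0 = 0 :=
  h.2.1.self_of_nhds

theorem AnalyticAt.tendsto_zero {E F : Type*} [NormedAddCommGroup E] [NormedSpace 𝕜 E]
    [NormedAddCommGroup F] [NormedSpace 𝕜 F] {f : E → F} (hf : AnalyticAt 𝕜 f 0) (h0 : f 0 = 0) :
    Tendsto f (𝓝 0) (𝓝 0) := by
  have := hf.continuousAt.tendsto
  rwa [h0] at this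

theorem Continuous.tendsto_zero {E F : Type*} [TopologicalSpace E] [Zero E]
    [TopologicalSpace F] [Zero F] {f : E → F} (hf : Continuous f) (h0 : f 0 = 0) :
    Tendsto f (𝓝 0) (𝓝 0) := by
  have := hf.tendsto 0
  rwa [h0] at this

namespace DefMap

/-- The defining function of the submanifold `y = P(x, a, b)`. -/
def rho (P : DefMap 𝕜 n m p) : Ambient 𝕜 n m p → Fin m → 𝕜 := fun w => -w.1.2 + P w.1.1 w.2

/-- The vector field `L + L'` is tangent to `y = P(x, a, b)`. -/
def IsTangent (P : DefMap 𝕜 n m p)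
    (L : (Fin n → 𝕜) × (Fin m → 𝕜) → (Fin n → 𝕜) × (Fin m → 𝕜))
    (L' : (Fin p → 𝕜) × (Fin m → 𝕜) → (Fin p → 𝕜) × (Fin m → 𝕜)) : Prop :=
  ∀ᶠ w in 𝓝 (0 : Ambient 𝕜 n m p), P.rho w = 0 → fderiv 𝕜 P.rho w (L w.1, L' w.2) = 0

variable {P : DefMap 𝕜 n m p}

theorem Analytic.rho (hP : P.Analytic) : AnalyticAt 𝕜 P.rho 0 :=
  (analyticAt_snd.comp_of_eq analyticAt_fst rfl).neg.add
    (AnalyticAt.comp₂' (x := (0 : Ambient 𝕜 n m p)) (g := fun w => w.1.1) (h := fun w => w.2)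
      (f := fun w : (Fin n → 𝕜) × ((Fin p → 𝕜) × (Fin m → 𝕜)) => P w.1 w.2) hP
      (analyticAt_fst.comp_of_eq analyticAt_fst rfl) analyticAt_snd rfl)

theorem rho_graph (x : Fin n → 𝕜) (c : (Fin p → 𝕜) × (Fin m → 𝕜)) :
    P.rho ((x, P x c), c) = 0 := by
  simp [rho]

/-- Composing the defining map with analytic maps sending the base point to `0` is analytic. -/
theorem Analytic.comp_apply {X : Type*} [NormedAddCommGroup X] [NormedSpace 𝕜 X]
    (hP : P.Analytic) {f : X → Fin n → 𝕜} {g : X → (Fin p → 𝕜) × (Fin m → 𝕜)}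
    {x : X} (hf : AnalyticAt 𝕜 f x) (hg : AnalyticAt 𝕜 g x) (hf0 : f x = 0) (hg0 : g x = 0) :
    AnalyticAt 𝕜 (fun x => P (f x) (g x)) x :=
  AnalyticAt.comp₂' (f := fun w : (Fin n → 𝕜) × ((Fin p → 𝕜) × (Fin m → 𝕜)) => P w.1 w.2) hP
    hf hg (Prod.ext hf0 hg0)

/-- The flow of a tangent vector field `L + L'` preserves the submanifold. -/
theorem IsTangent.flow_invariant {L : (Fin n → 𝕜) × (Fin m → 𝕜) → (Fin n → 𝕜) × (Fin m → 𝕜)}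
    {L' : (Fin p → 𝕜) × (Fin m → 𝕜) → (Fin p → 𝕜) × (Fin m → 𝕜)} (h : P.IsTangent L L')
    (hP : P.Analytic) (hP0 : P 0 0 = 0) (hL : AnalyticAt 𝕜 L 0) (hL' : AnalyticAt 𝕜 L' 0)
    {φ : 𝕜 × ((Fin n → 𝕜) × (Fin m → 𝕜)) → (Fin n → 𝕜) × (Fin m → 𝕜)}
    {φ' : 𝕜 × ((Fin p → 𝕜) × (Fin m → 𝕜)) → (Fin p → 𝕜) × (Fin m → 𝕜)}
    (hφ : IsLocalFlow L φ) (hφ' : IsLocalFlow L' φ') :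
    ∀ᶠ u in 𝓝 (0 : (𝕜 × ((Fin p → 𝕜) × (Fin m → 𝕜))) × (Fin n → 𝕜)),
      (φ (u.1.1, (u.2, P u.2 u.1.2))).2 =
        P (φ (u.1.1, (u.2, P u.2 u.1.2))).1 (φ' u.1) := by
  let C := (Fin p → 𝕜) × (Fin m → 𝕜)
  let X := Fin n → 𝕜
  have h1 : AnalyticAt 𝕜 (fun u : 𝕜 × (C × X) => (u.1, (u.2.2, P u.2.2 u.2.1))) 0 :=
    analyticAt_fst.prod ((analyticAt_snd.comp_of_eq analyticAt_snd rfl).prod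
      (hP.comp_apply (analyticAt_snd.comp_of_eq analyticAt_snd rfl)
        (analyticAt_fst.comp_of_eq analyticAt_snd rfl) rfl rfl))
  have h1t := h1.tendsto_zero (Prod.ext rfl (Prod.ext rfl hP0))
  have h2 : AnalyticAt 𝕜 (fun u : 𝕜 × (C × X) => (u.1, u.2.1)) 0 :=
    analyticAt_fst.prod (analyticAt_fst.comp_of_eq analyticAt_snd rfl)
  have h2t := h2.tendsto_zero rfl
  let A : 𝕜 × (C × X) → Ambient 𝕜 n m p :=
    fun u => (φ (u.1, (u.2.2, P u.2.2 u.2.1)), φ' (u.1, u.2.1))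
  have hA : AnalyticAt 𝕜 A 0 :=
    (AnalyticAt.comp_of_eq hφ.1 h1 (Prod.ext rfl (Prod.ext rfl hP0))).prod
      (AnalyticAt.comp_of_eq hφ'.1 h2 rfl)
  have hA0 : A 0 = 0 := by
    refine Prod.ext ?_ hφ'.apply_zero
    change φ (0, (0, P 0 0)) = 0
    rw [hP0]; exact hφ.apply_zero
  have hAt := hA.tendsto_zero hA0
  let g : Ambient 𝕜 n m p → Fin m → 𝕜 := fun w => fderiv 𝕜 P.rho w (L w.1, L' w.2)
  have hg : AnalyticAt 𝕜 g 0 := hP.rho.fderiv.clm_apply_vec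
    ((AnalyticAt.comp_of_eq hL analyticAt_fst rfl).prod
      (AnalyticAt.comp_of_eq hL' analyticAt_snd rfl))
  -- The function dρ(L + L*) vanishes on {ρ = 0}, and the vertical distance to that graph is ‖ρ‖. A
  -- Lipschitz bound therefore controls it by K‖ρ‖, the input Grönwall needs along the flow.
  obtain ⟨K, s, hs, hK⟩ := (hg.contDiffAt (n := 1)).exists_lipschitzOnWith
  have hbound : ∀ᶠ w in 𝓝 (0 : Ambient 𝕜 n m p), ‖g w‖ ≤ K * ‖P.rho w‖ := by
    have h3 : AnalyticAt 𝕜 (fun w : Ambient 𝕜 n m p =>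
        (((w.1.1, P w.1.1 w.2), w.2) : Ambient 𝕜 n m p)) 0 :=
      ((analyticAt_fst.comp_of_eq analyticAt_fst rfl).prod
        (hP.comp_apply (analyticAt_fst.comp_of_eq analyticAt_fst rfl) analyticAt_snd
          rfl rfl)).prod analyticAt_snd
    have h3t := h3.tendsto_zero (Prod.ext (Prod.ext rfl hP0) rfl)
    filter_upwards [hs, h3t.eventually hs, h3t.eventually h] with w hw1 hw2 hw3
    have h4 := hw3 (rho_graph _ _)
    have h5 := hK.norm_sub_le hw1 hw2
    have h6 : g ((w.1.1, P w.1.1 w.2), w.2) = 0 := h4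
    rw [h6, sub_zero] at h5
    refine h5.trans_eq ?_
    congr 1
    rw [Prod.norm_def, Prod.norm_def]
    simp only [Prod.fst_sub, Prod.snd_sub, sub_self, norm_zero]
    rw [max_eq_right (norm_nonneg _), max_eq_left (norm_nonneg _), ← norm_neg, rho]
    congr 1; abel
  have hz := eventually_eq_zero_of_norm_deriv_le (u₀ := (0 : C × X)) (K := K)
    (H := fun u => P.rho (A u)) (H' := fun u => g (A u)) ?_ ?_ ?_
  · have hc : Tendsto (fun u : (𝕜 × C) × X => (u.1.1, (u.1.2, u.2))) (𝓝 0) (𝓝 0) :=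
      Continuous.tendsto_zero (by fun_prop) rfl
    filter_upwards [hc.eventually hz] with u hu
    exact (neg_add_eq_zero.1 hu)
  · filter_upwards [h1t.eventually hφ.2.2, h2t.eventually hφ'.2.2,
      hAt.eventually hP.rho.eventually_analyticAt] with u hu1 hu2 hu3
    exact HasFDerivAt.comp_hasDerivAt (f := fun t => A (t, u.2)) u.1
      hu3.differentiableAt.hasFDerivAt (hu1.prodMk hu2)
  · exact hAt.eventually hbound
  · have hc1 : AnalyticAt 𝕜 (fun u : C × X => (u.2, P u.2 u.1)) 0 :=
      analyticAt_snd.prod (hP.comp_apply analyticAt_snd analyticAt_fst rfl rfl)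
    have hc2 : Tendsto (fun u : C × X => u.1) (𝓝 0) (𝓝 0) :=
      Continuous.tendsto_zero continuous_fst rfl
    filter_upwards [(hc1.tendsto_zero (Prod.ext rfl hP0)).eventually hφ.2.1,
      hc2.eventually hφ'.2.1] with u hu1 hu2
    simp only [A, hu1, hu2]
    exact rho_graph _ _

/-- The base point of the image of a graph under a flow is a local coordinate on the graph. -/
theorem Analytic.exists_inverse_flow {L : (Fin n → 𝕜) × (Fin m → 𝕜) → (Fin n → 𝕜) × (Fin m → 𝕜)}
    (hP : P.Analytic) (hP0 : P 0 0 = 0)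
    {φ : 𝕜 × ((Fin n → 𝕜) × (Fin m → 𝕜)) → (Fin n → 𝕜) × (Fin m → 𝕜)} (hφ : IsLocalFlow L φ) :
    AnalyticAt 𝕜 (fun u : (𝕜 × ((Fin p → 𝕜) × (Fin m → 𝕜))) × (Fin n → 𝕜) =>
      φ (u.1.1, (u.2, P u.2 u.1.2))) 0 ∧ φ (0, (0, P 0 0)) = 0 ∧
    ∃ h : (𝕜 × ((Fin p → 𝕜) × (Fin m → 𝕜))) × (Fin n → 𝕜) → (Fin n → 𝕜), AnalyticAt 𝕜 h 0 ∧
      h 0 = 0 ∧ (∀ᶠ u : (𝕜 × ((Fin p → 𝕜) × (Fin m → 𝕜))) × (Fin n → 𝕜) in 𝓝 0,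
        h (u.1, (φ (u.1.1, (u.2, P u.2 u.1.2))).1) = u.2) ∧
      ∀ᶠ u in 𝓝 0, (φ (u.1.1, (h u, P (h u) u.1.2))).1 = u.2 := by
  have h0 : φ (0, (0, P 0 0)) = 0 := by rw [hP0]; exact hφ.apply_zero
  have h1 : AnalyticAt 𝕜 (fun u : (𝕜 × ((Fin p → 𝕜) × (Fin m → 𝕜))) × (Fin n → 𝕜) =>
      φ (u.1.1, (u.2, P u.2 u.1.2))) 0 := by
    refine AnalyticAt.comp_of_eq hφ.1 ((analyticAt_fst.comp_of_eq analyticAt_fst rfl).prod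
      (analyticAt_snd.prod (hP.comp_apply analyticAt_snd
        (analyticAt_snd.comp_of_eq analyticAt_fst rfl) rfl rfl))) ?_
    exact Prod.ext rfl (Prod.ext rfl hP0)
  refine ⟨h1, h0, ?_⟩
  have h2 : AnalyticAt 𝕜 (fun u : (𝕜 × ((Fin p → 𝕜) × (Fin m → 𝕜))) × (Fin n → 𝕜) =>
      (φ (u.1.1, (u.2, P u.2 u.1.2))).1) (0, 0) := analyticAt_fst.comp_of_eq h1 rfl
  refine h2.exists_param_inverse (z₀ := 0) (congrArg Prod.fst h0) ?_
  have hc : AnalyticAt 𝕜 (fun x : Fin n → 𝕜 => (x, P x 0)) 0 :=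
    analyticAt_id.prod (hP.comp_apply analyticAt_id analyticAt_const rfl rfl)
  -- At t = 0 the flow is the identity, so the base-point map x ↦ x is trivially invertible, and
  -- remains so with parameters.
  have h3 : (fun x : Fin n → 𝕜 => (φ (0, (x, P x 0))).1) =ᶠ[𝓝 0] id := by
    filter_upwards [(hc.tendsto_zero (Prod.ext rfl hP0)).eventually hφ.2.1] with x hx
    rw [hx]; rfl
  change Function.Bijective (fderiv 𝕜 (fun x : Fin n → 𝕜 => (φ (0, (x, P x 0))).1) 0)
  rw [h3.fderiv_eq, fderiv_id]
  exact Function.bijective_id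

end DefMap

/-- Equality of graph germs is an equality of filters, for which continuity of the base map is not
enough. A continuous local right inverse shows that images of neighborhoods are neighborhoods. -/
theorem map_nhds_eq_of_local_inverse {X Y : Type*} [TopologicalSpace X] [TopologicalSpace Y]
    {f : X → Y} {h : Y → X} {x : X} (hf : ContinuousAt f x) (hh : ContinuousAt h (f x))
    (hx : h (f x) = x) (hr : ∀ᶠ y in 𝓝 (f x), f (h y) = y) : map f (𝓝 x) = 𝓝 (f x) := by
  refine le_antisymm hf ?_
  have h1 : Tendsto h (𝓝 (f x)) (𝓝 x) := by
    have := hh.tendsto; rwa [hx] at this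
  calc 𝓝 (f x) = map (fun y => f (h y)) (𝓝 (f x)) := by
        rw [Filter.map_congr hr]; exact map_id.symm
    _ = map f (map h (𝓝 (f x))) := map_map.symm
    _ ≤ map f (𝓝 x) := map_mono h1

namespace PDESystem

variable {E : PDESystem 𝕜 I} {P : DefMap 𝕜 n m p}

/-- If `L + L'` is tangent to the submanifold of solutions, then `L` is an infinitesimal
symmetry. -/
theorem IsAssociatedWith.isInfinitesimalSymmetry (h : E.IsAssociatedWith P)
    (h0 : P.jetMap I 0 = 0) {L : (Fin n → 𝕜) × (Fin m → 𝕜) → (Fin n → 𝕜) × (Fin m → 𝕜)}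
    {L' : (Fin p → 𝕜) × (Fin m → 𝕜) → (Fin p → 𝕜) × (Fin m → 𝕜)} (ht : P.IsTangent L L')
    (hL : AnalyticAt 𝕜 L 0) (hL' : AnalyticAt 𝕜 L' 0) : E.IsInfinitesimalSymmetry L := by
  obtain ⟨hr, hP, hsol⟩ := h
  have hP0 : P 0 0 = 0 := congrArg (fun v => v.2.1) h0
  obtain ⟨Φ, hΦ, hΦ0, hΦl, hΦr⟩ := hr.exists_inverse hP h0
  obtain ⟨N, hN, hNs⟩ := SolvedBy.exists_eq_of_isSolutionAt ⟨hP, hsol⟩ hΦ hΦ0 h0 hΦl hΦr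
  obtain ⟨φ, hφ⟩ := exists_isLocalFlow hL
  obtain ⟨φ', hφ'⟩ := exists_isLocalFlow hL'
  have hinv := ht.flow_invariant hP hP0 hL hL' hφ hφ'
  obtain ⟨hS, hS0, h, hh, hh0, hhl, hhr⟩ := hP.exists_inverse_flow hP0 hφ
  let S : (𝕜 × ((Fin p → 𝕜) × (Fin m → 𝕜))) × (Fin n → 𝕜) → (Fin n → 𝕜) × (Fin m → 𝕜) :=
    fun u => φ (u.1.1, (u.2, P u.2 u.1.2))
  have hS' : AnalyticAt 𝕜 S 0 := hS
  have h1 : AnalyticAt 𝕜 (fun u : (𝕜 × ((Fin p → 𝕜) × (Fin m → 𝕜))) × (Fin n → 𝕜) =>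
      (u.1, (S u).1)) 0 := analyticAt_fst.prod (analyticAt_fst.comp_of_eq hS rfl)
  have h1t := h1.tendsto_zero (Prod.ext rfl (congrArg Prod.fst hS0))
  have h2 : AnalyticAt 𝕜 (fun u : (𝕜 × ((Fin p → 𝕜) × (Fin m → 𝕜))) × (Fin n → 𝕜) =>
      ((S u).1, φ' u.1)) 0 := (analyticAt_fst.comp_of_eq hS rfl).prod
        (AnalyticAt.comp_of_eq hφ'.1 analyticAt_fst rfl)
  have h2t := h2.tendsto_zero
    (Prod.ext (show (S 0).1 = 0 from congrArg Prod.fst hS0) hφ'.apply_zero)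
  -- For (t, c, x) near 0: the image of the graph lies in the graph of P(·, φ'(t, c)), the base map
  -- is locally onto, and that function is a solution near the image point.
  have hgood : ∀ᶠ u in 𝓝 (0 : (𝕜 × ((Fin p → 𝕜) × (Fin m → 𝕜))) × (Fin n → 𝕜)),
      (∀ᶠ x in 𝓝 u.2, (S (u.1, x)).2 = P (S (u.1, x)).1 (φ' u.1)) ∧
      map (fun x => (S (u.1, x)).1) (𝓝 u.2) = 𝓝 (S u).1 ∧
      E.IsSolutionAt (fun x => P x (φ' u.1)) (S u).1 := by
    filter_upwards [hinv.eventually_nhds, hS'.eventually_analyticAt, hhl,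
      h1t.eventually hhr.eventually_nhds, h1t.eventually hh.eventually_analyticAt,
      h2t.eventually hsol.eventually_nhds, h2t.eventually hP.eventually_analyticAt]
      with u hu1 hu2 hu3 hu4 hu5 hu6 hu7
    have hcx : ∀ x, ContinuousAt (fun x : Fin n → 𝕜 => (u.1, x)) x := fun x => by fun_prop
    refine ⟨(hcx u.2).eventually hu1, ?_, hu7, ?_⟩
    · refine map_nhds_eq_of_local_inverse (f := fun x => (S (u.1, x)).1)
        (h := fun z => h (u.1, z)) ?_ ?_ hu3 ((hcx _).eventually hu4)
      · exact (ContinuousAt.comp (f := fun x => (u.1, x)) hu2.continuousAt (hcx u.2)).fst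
      · exact ContinuousAt.comp (f := fun x => (u.1, x)) hu5.continuousAt (hcx _)
    · have : ContinuousAt (fun x : Fin n → 𝕜 => (x, φ' u.1)) (S u).1 := by fun_prop
      exact this.eventually hu6
  have hc : AnalyticAt 𝕜 (fun r : 𝕜 × JetSpace 𝕜 n m p => ((r.1, (Φ r.2).2), r.2.1)) 0 :=
    (analyticAt_fst.prod (analyticAt_snd.comp_of_eq
      (AnalyticAt.comp_of_eq hΦ analyticAt_snd rfl) rfl)).prod
      (analyticAt_fst.comp_of_eq analyticAt_snd rfl)
  have hct := hc.tendsto_zero (Prod.ext (Prod.ext rfl (show (Φ 0).2 = 0 from congrArg Prod.snd hΦ0)) rfl)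
  -- A product neighborhood separates small times from jets, so the domain of validity does not
  -- depend on t.
  obtain ⟨T, hT, M, hM, hTM⟩ := mem_nhds_prod_iff.1 (hct.eventually hgood)
  refine ⟨φ, hφ, N ∩ M, inter_mem hN hM, ?_⟩
  filter_upwards [hT] with t ht x₀ s hs hsN
  have hs1 := hNs x₀ s hs hsN.1
  have hg : _ ∧ _ ∧ _ := hTM (Set.mk_mem_prod ht hsN.2)
  set c := (Φ (I.jetAt s x₀)).2 with hcdef
  obtain ⟨hg1, hg2, hg3⟩ := hg
  change ∀ᶠ x in 𝓝 x₀, (S ((t, c), x)).2 = P (S ((t, c), x)).1 (φ' (t, c)) at hg1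
  change map (fun x => (S ((t, c), x)).1) (𝓝 x₀) = 𝓝 (S ((t, c), x₀)).1 at hg2
  change E.IsSolutionAt (fun x => P x (φ' (t, c))) (S ((t, c), x₀)).1 at hg3
  have hx0 : φ (t, (x₀, s x₀)) = S ((t, c), x₀) := by
    rw [hs1.self_of_nhds]
  refine ⟨fun x => P x (φ' (t, c)), show E.IsSolutionAt _ (φ (t, (x₀, s x₀))).1 by
    rw [hx0]; exact hg3, ?_⟩
  change _ = map _ (𝓝 (φ (t, (x₀, s x₀))).1)
  rw [hx0, ← hg2, map_map, map_map]
  refine Filter.map_congr ?_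
  filter_upwards [hs1, hg1] with x hx1 hx2
  simp only [Function.comp_apply]
  rw [← hx2, hx1]

end PDESystem

end Symmetries

/-! ### Symmetries give tangent fields, uniquely. -/

section Symmetries

variable {𝕜 : Type*} [RCLike 𝕜] {n m p : ℕ} {I : JetIndex n m p}

namespace PDESystem

variable {E : PDESystem 𝕜 I} {P : DefMap 𝕜 n m p}

/-- The flow of an infinitesimal symmetry permutes the solutions `P(·, c)`, which induces a local
transformation `κ(t, ·)` of the parameters. -/
theorem IsAssociatedWith.exists_parameter_flow (h : E.IsAssociatedWith P)
    (h0 : P.jetMap I 0 = 0) {L : (Fin n → 𝕜) × (Fin m → 𝕜) → (Fin n → 𝕜) × (Fin m → 𝕜)}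
    {φ : 𝕜 × ((Fin n → 𝕜) × (Fin m → 𝕜)) → (Fin n → 𝕜) × (Fin m → 𝕜)} (hφ : IsLocalFlow L φ)
    {N : Set (JetSpace 𝕜 n m p)} (hN : N ∈ 𝓝 0)
    (hsym : ∀ᶠ t in 𝓝 (0 : 𝕜), E.IsLieSymmetryOn N fun z => φ (t, z)) :
    ∃ κ : 𝕜 × ((Fin p → 𝕜) × (Fin m → 𝕜)) → (Fin p → 𝕜) × (Fin m → 𝕜), AnalyticAt 𝕜 κ 0 ∧
      (∀ᶠ c in 𝓝 0, κ (0, c) = c) ∧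
      ∀ᶠ u in 𝓝 (0 : (𝕜 × ((Fin p → 𝕜) × (Fin m → 𝕜))) × (Fin n → 𝕜)),
        P.rho (φ (u.1.1, (u.2, P u.2 u.1.2)), κ u.1) = 0 := by
  obtain ⟨hr, hP, hsol⟩ := h
  have hP0 : P 0 0 = 0 := congrArg (fun v => v.2.1) h0
  obtain ⟨Φ, hΦ, hΦ0, hΦl, hΦr⟩ := hr.exists_inverse hP h0
  obtain ⟨N', hN', hNs⟩ := SolvedBy.exists_eq_of_isSolutionAt ⟨hP, hsol⟩ hΦ hΦ0 h0 hΦl hΦr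
  obtain ⟨hS, hS0, h, hh, hh0, hhl, hhr⟩ := hP.exists_inverse_flow hP0 hφ
  let C := (Fin p → 𝕜) × (Fin m → 𝕜)
  let X := Fin n → 𝕜
  let S : (𝕜 × C) × X → X × (Fin m → 𝕜) := fun u => φ (u.1.1, (u.2, P u.2 u.1.2))
  have hSa : AnalyticAt 𝕜 S 0 := hS
  have hS0' : S 0 = 0 := hS0
  -- the transformed solutions
  let Q : X → 𝕜 × C → Fin m → 𝕜 := fun x τ => (S (τ, h (τ, x))).2
  have hht : AnalyticAt 𝕜 (fun w : X × (𝕜 × C) => h (w.2, w.1)) 0 :=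
    AnalyticAt.comp_of_eq hh (analyticAt_snd.prod analyticAt_fst) rfl
  have hQ : AnalyticAt 𝕜 (fun w : X × (𝕜 × C) => Q w.1 w.2) 0 :=
    analyticAt_snd.comp_of_eq (AnalyticAt.comp_of_eq (g := S)
      (f := fun w : X × (𝕜 × C) => (w.2, h (w.2, w.1))) hSa (analyticAt_snd.prod hht)
      (Prod.ext rfl hh0)) rfl
  let JQ : X × (𝕜 × C) → JetSpace 𝕜 n m p := fun w => I.jetAt (fun x => Q x w.2) w.1
  have hJQ : AnalyticAt 𝕜 JQ 0 := I.jetAt_analyticAt_param hQ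
  have hQP : ∀ᶠ w in 𝓝 (0 : X × C), Q w.1 (0, w.2) = P w.1 w.2 := by
    have h1 : AnalyticAt 𝕜 (fun w : X × C => h (((0 : 𝕜), w.2), w.1)) 0 :=
      AnalyticAt.comp_of_eq hh ((analyticAt_const.prod analyticAt_snd).prod analyticAt_fst) rfl
    have h2 : AnalyticAt 𝕜 (fun w : X × C => (h (((0 : 𝕜), w.2), w.1),
        P (h (((0 : 𝕜), w.2), w.1)) w.2)) 0 :=
      h1.prod (hP.comp_apply h1 analyticAt_snd hh0 rfl)
    have h2t := h2.tendsto_zero (Prod.ext hh0 (show P (h 0) 0 = 0 by rw [hh0, hP0]))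
    have h3t : Tendsto (fun w : X × C => (((0 : 𝕜), w.2), w.1)) (𝓝 0) (𝓝 0) :=
      Continuous.tendsto_zero (by fun_prop) rfl
    filter_upwards [h2t.eventually hφ.2.1, h3t.eventually hhr] with w hw1 hw2
    simp only [hw1] at hw2
    change (φ (0, (h ((0, w.2), w.1), P (h ((0, w.2), w.1)) w.2))).2 = P w.1 w.2
    rw [hw1, hw2]
  have hJQ0 : ∀ᶠ c in 𝓝 (0 : C), JQ (0, (0, c)) = P.jetMap I (0, c) := by
    have hc : Tendsto (fun c : C => ((0 : X), c)) (𝓝 0) (𝓝 0) :=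
      Continuous.tendsto_zero (by fun_prop) rfl
    filter_upwards [hc.eventually hQP.eventually_nhds] with c hcQ
    refine I.jetAt_congr ?_
    have hcx : ContinuousAt (fun x : X => (x, c)) 0 := by fun_prop
    exact hcx.eventually hcQ
  have hJQ00 : JQ 0 = 0 := hJQ0.self_of_nhds.trans h0
  have hS1 : AnalyticAt 𝕜 (fun τ : 𝕜 × C => ((S (τ, 0)).1, τ)) 0 :=
    (analyticAt_fst.comp_of_eq (AnalyticAt.comp_of_eq hSa
      (analyticAt_id.prod analyticAt_const) rfl) rfl).prod analyticAt_id
  have hS10 : ((S (0, 0)).1, (0 : 𝕜 × C)) = 0 := Prod.ext (show (S 0).1 = 0 from congrArg Prod.fst hS0') rfl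
  -- The new parameter is read off by Φ from the jet of the transformed solution at the image of the
  -- point over x = 0. This formula makes sense and is analytic before it is known that the
  -- transformed graph is a solution.
  let κ : 𝕜 × C → C := fun τ => (Φ (JQ ((S (τ, 0)).1, τ))).2
  have hJS : AnalyticAt 𝕜 (fun τ : 𝕜 × C => JQ ((S (τ, 0)).1, τ)) 0 :=
    AnalyticAt.comp_of_eq hJQ hS1 hS10
  have hJS0 : JQ ((S (0, 0)).1, 0) = 0 := by rw [hS10]; exact hJQ00
  have hκ : AnalyticAt 𝕜 κ 0 :=
    analyticAt_snd.comp_of_eq (AnalyticAt.comp_of_eq hΦ hJS hJS0) rfl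
  have hκ1 : ∀ᶠ c in 𝓝 (0 : C), κ (0, c) = c := by
    have h1 : AnalyticAt 𝕜 (fun c : C => ((0 : X), P 0 c)) 0 :=
      analyticAt_const.prod (hP.comp_apply analyticAt_const analyticAt_id rfl rfl)
    have h2t : Tendsto (fun c : C => ((0 : X), c)) (𝓝 0) (𝓝 0) :=
      Continuous.tendsto_zero (by fun_prop) rfl
    filter_upwards [hJQ0, (h1.tendsto_zero (Prod.ext rfl hP0)).eventually hφ.2.1,
      h2t.eventually hΦl] with c hc1 hc2 hc3
    have hc4 : (S ((0, c), 0)).1 = 0 := by simp only [S, hc2]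
    simp only [κ, hc4, hc1, hc3]
  have hκ0 : κ 0 = 0 := hκ1.self_of_nhds
  refine ⟨κ, hκ, hκ1, ?_⟩
  have hA : AnalyticAt 𝕜 (fun u : (𝕜 × C) × X => ((S u, κ u.1) : Ambient 𝕜 n m p)) 0 :=
    hSa.prod (AnalyticAt.comp_of_eq (g := κ) (f := fun u : (𝕜 × C) × X => u.1) hκ
      analyticAt_fst rfl)
  -- The symmetry hypothesis gives the identity only on a germ in x depending on (t, c); the
  -- identity theorem makes it uniform.
  refine AnalyticAt.eventually_eq_zero_of_forall_eventually
    (H := fun u : (𝕜 × C) × X => P.rho (S u, κ u.1))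
    (AnalyticAt.comp_of_eq hP.rho hA (Prod.ext hS0' hκ0)) ?_
  have ht1 : Tendsto (fun τ : 𝕜 × C => τ.1) (𝓝 0) (𝓝 0) :=
    Continuous.tendsto_zero continuous_fst rfl
  have ht2 : Tendsto (fun τ : 𝕜 × C => ((0 : X), τ.2)) (𝓝 0) (𝓝 0) :=
    Continuous.tendsto_zero (by fun_prop) rfl
  have ht3 : Tendsto (fun τ : 𝕜 × C => (τ, (0 : X))) (𝓝 0) (𝓝 0) :=
    Continuous.tendsto_zero (by fun_prop) rfl
  have ht4 : Tendsto (fun τ : 𝕜 × C => (τ, (S (τ, 0)).1)) (𝓝 0) (𝓝 0) := by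
    have := hS1.tendsto_zero hS10
    exact (Continuous.tendsto_zero continuous_swap rfl).comp this
  filter_upwards [ht1.eventually hsym, ht2.eventually ((hP.jetMap I).tendsto_zero h0 hN),
    ht2.eventually hsol.eventually_nhds, ht2.eventually hP.eventually_analyticAt,
    ht3.eventually hhl, ht3.eventually hSa.eventually_analyticAt,
    ht4.eventually hhr.eventually_nhds, ht4.eventually hh.eventually_analyticAt,
    hJS.tendsto_zero hJS0 hN'] with τ h1 h2 h3 h4 h5 h6 h7 h8 h9
  obtain ⟨t, c⟩ := τ
  have hcx : ∀ x : X, ContinuousAt (fun x : X => (((t, c) : 𝕜 × C), x)) x := fun x => by fun_prop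
  have hSc : ContinuousAt (fun x : X => (S ((t, c), x)).1) 0 :=
    (ContinuousAt.comp (f := fun x : X => (((t, c) : 𝕜 × C), x)) h6.continuousAt (hcx 0)).fst
  have hsolc : E.IsSolutionAt (fun x => P x c) 0 := by
    refine ⟨h4, ?_⟩
    have : ContinuousAt (fun x : X => (x, c)) 0 := by fun_prop
    exact this.eventually h3
  obtain ⟨s', hs', hmap⟩ := h1 0 (fun x => P x c) hsolc h2
  change E.IsSolutionAt s' (S ((t, c), 0)).1 at hs'
  -- The set where s' agrees with the second coordinate belongs to the filter of the graph of s',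
  -- hence to that of the transformed graph.
  have step1 : ∀ᶠ x in 𝓝 (0 : X), s' (S ((t, c), x)).1 = (S ((t, c), x)).2 := by
    have hmem : {z : X × (Fin m → 𝕜) | s' z.1 = z.2} ∈
        map (fun x => (x, s' x)) (𝓝 ((fun z => φ (t, z)) ((0 : X), P 0 c)).1) :=
      Filter.mem_map.2 (Filter.univ_mem' fun x => rfl)
    rw [← hmap, map_map] at hmem
    exact hmem
  have step2 : s' =ᶠ[𝓝 (S ((t, c), 0)).1] fun x => Q x (t, c) := by
    have hhc : Tendsto (fun x : X => h ((t, c), x)) (𝓝 (S ((t, c), 0)).1) (𝓝 0) := by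
      have h10 : ContinuousAt (fun x : X => h ((t, c), x)) (S ((t, c), 0)).1 :=
        ContinuousAt.comp (f := fun x : X => (((t, c) : 𝕜 × C), x)) h8.continuousAt (hcx _)
      have h11 := h10.tendsto
      rwa [show h ((t, c), (S ((t, c), 0)).1) = 0 from h5] at h11
    filter_upwards [hhc.eventually step1, (hcx _).eventually h7] with x hx1 hx2
    have hx2' : (S ((t, c), h ((t, c), x))).1 = x := hx2
    rw [hx2'] at hx1
    exact hx1
  have step3 : s' =ᶠ[𝓝 (S ((t, c), 0)).1] fun x => P x (κ (t, c)) := by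
    have hj : I.jetAt s' (S ((t, c), 0)).1 = JQ ((S ((t, c), 0)).1, (t, c)) :=
      I.jetAt_congr step2
    have := hNs _ s' hs' (by rw [hj]; exact h9)
    rwa [hj] at this
  filter_upwards [step1, hSc.eventually step3] with x hx1 hx2
  refine neg_add_eq_zero.2 ?_
  rw [← hx1, hx2]

/-- L' is the velocity ∂κ/∂t at t = 0 of the induced parameter transformations; tangency is the
derivative at t = 0 of ρ(φ_t, κ_t) = 0. -/
theorem IsAssociatedWith.exists_isTangent (h : E.IsAssociatedWith P)
    (h0 : P.jetMap I 0 = 0) {L : (Fin n → 𝕜) × (Fin m → 𝕜) → (Fin n → 𝕜) × (Fin m → 𝕜)}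
    (hs : E.IsInfinitesimalSymmetry L) :
    ∃ L' : (Fin p → 𝕜) × (Fin m → 𝕜) → (Fin p → 𝕜) × (Fin m → 𝕜), AnalyticAt 𝕜 L' 0 ∧
      P.IsTangent L L' := by
  obtain ⟨φ, hφ, N, hN, hsym⟩ := hs
  obtain ⟨κ, hκ, hκ1, hκP⟩ := h.exists_parameter_flow h0 hφ hN hsym
  have hP := h.2.1
  have hP0 : P 0 0 = 0 := congrArg (fun v => v.2.1) h0
  refine ⟨fun c => fderiv 𝕜 κ (0, c) (1, 0), ?_, ?_⟩
  · have h1 : AnalyticAt 𝕜 (fun c : (Fin p → 𝕜) × (Fin m → 𝕜) => fderiv 𝕜 κ (0, c)) 0 :=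
      AnalyticAt.comp_of_eq hκ.fderiv (analyticAt_const.prod analyticAt_id) rfl
    exact h1.clm_apply_vec (analyticAt_const (v := ((1 : 𝕜), (0 : (Fin p → 𝕜) × (Fin m → 𝕜)))))
  · have ht1 : Tendsto (fun w : Ambient 𝕜 n m p => (((0 : 𝕜), w.2), w.1.1)) (𝓝 0) (𝓝 0) :=
      Continuous.tendsto_zero (by fun_prop) rfl
    have ht2 : Tendsto (fun w : Ambient 𝕜 n m p => w.2) (𝓝 0) (𝓝 0) :=
      Continuous.tendsto_zero (by fun_prop) rfl
    have ht3 : Tendsto (fun w : Ambient 𝕜 n m p => ((0 : 𝕜), w.2)) (𝓝 0) (𝓝 0) :=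
      Continuous.tendsto_zero (by fun_prop) rfl
    have ht4 : Tendsto (fun w : Ambient 𝕜 n m p => w.1) (𝓝 0) (𝓝 0) :=
      Continuous.tendsto_zero (by fun_prop) rfl
    have ht5 : Tendsto (fun w : Ambient 𝕜 n m p => ((0 : 𝕜), w.1)) (𝓝 0) (𝓝 0) :=
      Continuous.tendsto_zero (by fun_prop) rfl
    filter_upwards [ht1.eventually hκP.eventually_nhds, ht2.eventually hκ1,
      ht3.eventually hκ.eventually_analyticAt, ht4.eventually hφ.2.1, ht5.eventually hφ.2.2,
      hP.rho.eventually_analyticAt] with w h1 h2 h3 h4 h5 h6 hw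
    obtain ⟨⟨x, y⟩, c⟩ := w
    have hy : y = P x c := neg_add_eq_zero.1 hw
    subst hy
    have hd1 : HasDerivAt (fun t : 𝕜 => κ (t, c)) (fderiv 𝕜 κ (0, c) (1, 0)) 0 :=
      HasFDerivAt.comp_hasDerivAt (f := fun t : 𝕜 => (t, c)) (0 : 𝕜)
        h3.differentiableAt.hasFDerivAt ((hasDerivAt_id (0 : 𝕜)).prodMk (hasDerivAt_const _ c))
    have hd2 : HasDerivAt (fun t : 𝕜 => ((φ (t, (x, P x c)), κ (t, c)) : Ambient 𝕜 n m p))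
        (L (x, P x c), fderiv 𝕜 κ (0, c) (1, 0)) 0 := by
      refine HasDerivAt.prodMk ?_ hd1
      have := h5
      simp only [h4] at this
      exact this
    have hd3 : HasDerivAt (fun t : 𝕜 => P.rho (φ (t, (x, P x c)), κ (t, c)))
        (fderiv 𝕜 P.rho ((x, P x c), c) (L (x, P x c), fderiv 𝕜 κ (0, c) (1, 0))) 0 := by
      refine HasFDerivAt.comp_hasDerivAt
        (l := P.rho) (f := fun t : 𝕜 => ((φ (t, (x, P x c)), κ (t, c)) : Ambient 𝕜 n m p)) (0 : 𝕜) ?_ hd2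
      rw [show φ (0, (x, P x c)) = (x, P x c) from h4, show κ (0, c) = c from h2]
      exact h6.differentiableAt.hasFDerivAt
    have hct : ContinuousAt (fun t : 𝕜 => ((t, c), x)) 0 := by fun_prop
    exact hd3.unique ((hasDerivAt_const (0 : 𝕜) (0 : Fin m → 𝕜)).congr_of_eventuallyEq
      (hct.eventually h1))

/-- The parameter part of a tangent vector field `L + L'` is determined by `L`. -/
theorem IsAssociatedWith.eq_zero_of_isTangent_zero (h : E.IsAssociatedWith P)
    (h0 : P.jetMap I 0 = 0) {L' : (Fin p → 𝕜) × (Fin m → 𝕜) → (Fin p → 𝕜) × (Fin m → 𝕜)}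
    (hL' : AnalyticAt 𝕜 L' 0) (ht : P.IsTangent (fun _ => 0) L') : L' =ᶠ[𝓝 0] 0 := by
  obtain ⟨hr, hP, -⟩ := h
  have hP0 : P 0 0 = 0 := congrArg (fun v => v.2.1) h0
  obtain ⟨Φ, hΦ, hΦ0, hΦl, -⟩ := hr.exists_inverse hP h0
  obtain ⟨φ', hφ'⟩ := exists_isLocalFlow hL'
  -- The zero field has the identity as flow, so flow invariance reduces to P(x, c) = P(x, φ'(t,
  -- c)).
  have hφ : IsLocalFlow (𝕜 := 𝕜) (fun _ : (Fin n → 𝕜) × (Fin m → 𝕜) => 0) (fun w => w.2) :=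
    ⟨analyticAt_snd, Eventually.of_forall fun _ => rfl,
      Eventually.of_forall fun w => hasDerivAt_const w.1 w.2⟩
  have hinv := ht.flow_invariant hP hP0 analyticAt_const hL' hφ hφ'
  let C := (Fin p → 𝕜) × (Fin m → 𝕜)
  have hc1 : Tendsto (fun τ : 𝕜 × C => (τ, (0 : Fin n → 𝕜))) (𝓝 0) (𝓝 0) :=
    Continuous.tendsto_zero (by fun_prop) rfl
  have hc2 : Tendsto (fun τ : 𝕜 × C => ((0 : Fin n → 𝕜), τ.2)) (𝓝 0) (𝓝 0) :=
    Continuous.tendsto_zero (by fun_prop) rfl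
  have hc3 : Tendsto (fun τ : 𝕜 × C => ((0 : Fin n → 𝕜), φ' τ)) (𝓝 0) (𝓝 0) :=
    (analyticAt_const.prod hφ'.1).tendsto_zero (Prod.ext rfl hφ'.apply_zero)
  -- The two parameters define the same germ of solution at x = 0, hence the same jet, and Φ forces
  -- them to be equal.
  have hstat : ∀ᶠ τ in 𝓝 (0 : 𝕜 × C), φ' τ = τ.2 := by
    filter_upwards [hc1.eventually hinv.eventually_nhds, hc2.eventually hΦl, hc3.eventually hΦl]
      with τ h1 h2 h3
    have hcx : ContinuousAt (fun x : Fin n → 𝕜 => (τ, x)) 0 := by fun_prop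
    have h4 : P.jetMap I (0, τ.2) = P.jetMap I (0, φ' τ) := I.jetAt_congr (hcx.eventually h1)
    have h5 : Φ (P.jetMap I (0, τ.2)) = (0, τ.2) := h2
    have h6 : Φ (P.jetMap I (0, φ' τ)) = (0, φ' τ) := h3
    rw [h4, h6] at h5
    exact congrArg Prod.snd h5
  have hc4 : Tendsto (fun c : C => ((0 : 𝕜), c)) (𝓝 0) (𝓝 0) :=
    Continuous.tendsto_zero (by fun_prop) rfl
  filter_upwards [hφ'.2.1, hc4.eventually hφ'.2.2, hc4.eventually hstat.eventually_nhds]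
    with c h1 h2 h3
  have h4 : HasDerivAt (fun t => φ' (t, c)) (L' (φ' (0, c))) 0 := h2
  rw [h1] at h4
  have hct : ContinuousAt (fun t : 𝕜 => (t, c)) 0 := by fun_prop
  exact h4.unique ((hasDerivAt_const (0 : 𝕜) c).congr_of_eventuallyEq (hct.eventually h3))

end PDESystem

end Symmetries

/-! ### Lie algebras of tangent fields and their projections. -/

section LieAlgebras

namespace VFGerm

variable {𝕜 V V' : Type*} [RCLike 𝕜] [NormedAddCommGroup V] [NormedSpace 𝕜 V]
  [NormedAddCommGroup V'] [NormedSpace 𝕜 V']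

theorem ext_rep {g h : VFGerm 𝕜 V} (H : g.rep =ᶠ[𝓝 0] h.rep) : g = h := by
  rw [← mk_rep g, ← mk_rep h]
  exact mk_eq_mk.2 H

theorem rep_eq_of_eq_mk {g : VFGerm 𝕜 V} {L : V → V} {hL : AnalyticAt 𝕜 L 0} (h : g = mk L hL) :
    g.rep =ᶠ[𝓝 0] L := by
  subst h; exact rep_mk hL

theorem rep_add (g h : VFGerm 𝕜 V) : (g + h).rep =ᶠ[𝓝 0] fun v => g.rep v + h.rep v :=
  rep_eq_of_eq_mk (hL := g.rep_analytic.add h.rep_analytic) (by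
    conv_lhs => rw [← mk_rep g, ← mk_rep h]
    rfl)

theorem rep_smul (c : 𝕜) (g : VFGerm 𝕜 V) : (c • g).rep =ᶠ[𝓝 0] fun v => c • g.rep v :=
  rep_eq_of_eq_mk (hL := g.rep_analytic.const_smul) (by
    conv_lhs => rw [← mk_rep g]
    rfl)

theorem rep_zero : (0 : VFGerm 𝕜 V).rep =ᶠ[𝓝 0] fun _ => 0 :=
  rep_eq_of_eq_mk (hL := analyticAt_const) rfl

theorem rep_lie [CompleteSpace V] (g h : VFGerm 𝕜 V) :
    (⁅g, h⁆).rep =ᶠ[𝓝 0] VectorField.lieBracket 𝕜 g.rep h.rep :=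
  rep_eq_of_eq_mk (hL := analyticAt_lieBracket g.rep_analytic h.rep_analytic) rfl

theorem rep_directSum (g : VFGerm 𝕜 V) (g' : VFGerm 𝕜 V') :
    (g.directSum g').rep =ᶠ[𝓝 0] fun w => (g.rep w.1, g'.rep w.2) :=
  rep_mk _

theorem directSum_eq_of_rep {g : VFGerm 𝕜 V} {g' : VFGerm 𝕜 V'} {W : VFGerm 𝕜 (V × V')}
    {L : V → V} {L' : V' → V'} (hL : g.rep =ᶠ[𝓝 0] L) (hL' : g'.rep =ᶠ[𝓝 0] L')
    (hW : W.rep =ᶠ[𝓝 0] fun w => (L w.1, L' w.2)) : W = g.directSum g' := by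
  refine ext_rep ((hW.trans ?_).trans (rep_directSum g g').symm)
  filter_upwards [(continuous_fst.tendsto (0 : V × V')).eventually hL,
    (continuous_snd.tendsto (0 : V × V')).eventually hL'] with w h1 h2
  rw [← h1, ← h2]

theorem directSum_add (g h : VFGerm 𝕜 V) (g' h' : VFGerm 𝕜 V') :
    g.directSum g' + h.directSum h' = (g + h).directSum (g' + h') := by
  refine directSum_eq_of_rep (rep_add g h) (rep_add g' h') ((rep_add _ _).trans ?_)
  filter_upwards [rep_directSum g g', rep_directSum h h'] with w h1 h2
  rw [h1, h2]; rfl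

theorem directSum_smul (c : 𝕜) (g : VFGerm 𝕜 V) (g' : VFGerm 𝕜 V') :
    c • g.directSum g' = (c • g).directSum (c • g') := by
  refine directSum_eq_of_rep (rep_smul c g) (rep_smul c g') ((rep_smul _ _).trans ?_)
  filter_upwards [rep_directSum g g'] with w h1
  rw [h1]; rfl

theorem directSum_zero : (0 : VFGerm 𝕜 (V × V')) = directSum 0 0 :=
  directSum_eq_of_rep rep_zero rep_zero (rep_zero.trans (Eventually.of_forall fun _ => rfl))

theorem directSum_lie [CompleteSpace V] [CompleteSpace V'] (g h : VFGerm 𝕜 V)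
    (g' h' : VFGerm 𝕜 V') : ⁅g.directSum g', h.directSum h'⁆ = ⁅g, h⁆.directSum ⁅g', h'⁆ := by
  refine directSum_eq_of_rep (rep_lie g h) (rep_lie g' h') ((rep_lie _ _).trans ?_)
  refine ((rep_directSum g g').lieBracket_vectorField (rep_directSum h h')).trans ?_
  have hd : ∀ (g : VFGerm 𝕜 V) (g' : VFGerm 𝕜 V'), ∀ᶠ w in 𝓝 (0 : V × V'), ∀ v,
      fderiv 𝕜 (fun w : V × V' => (g.rep w.1, g'.rep w.2)) w v =
        (fderiv 𝕜 g.rep w.1 v.1, fderiv 𝕜 g'.rep w.2 v.2) := by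
    intro g g'
    filter_upwards [(continuous_fst.tendsto (0 : V × V')).eventually
        g.rep_analytic.eventually_analyticAt,
      (continuous_snd.tendsto (0 : V × V')).eventually g'.rep_analytic.eventually_analyticAt]
      with w h1 h2 v
    have h3 : HasFDerivAt (fun w : V × V' => (g.rep w.1, g'.rep w.2)) _ w :=
      (HasFDerivAt.comp w h1.differentiableAt.hasFDerivAt hasFDerivAt_fst).prodMk
        (HasFDerivAt.comp w h2.differentiableAt.hasFDerivAt hasFDerivAt_snd)
    rw [h3.fderiv]; rfl
  filter_upwards [hd g g', hd h h'] with w h1 h2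
  simp only [VectorField.lieBracket, h1, h2]
  rfl

theorem analyticAt_fst_rep (W : VFGerm 𝕜 (V × V')) :
    AnalyticAt 𝕜 (fun v => (W.rep (v, 0)).1) 0 :=
  analyticAt_fst.comp_of_eq
    (W.rep_analytic.comp_of_eq (analyticAt_id.prod analyticAt_const) rfl) rfl

theorem analyticAt_snd_rep (W : VFGerm 𝕜 (V × V')) :
    AnalyticAt 𝕜 (fun v => (W.rep (0, v)).2) 0 :=
  analyticAt_snd.comp_of_eq
    (W.rep_analytic.comp_of_eq (analyticAt_const.prod analyticAt_id) rfl) rfl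

/-- The component in the first space of the restriction of a vector field to it. -/
noncomputable def fstPart (𝕜 V V' : Type*) [RCLike 𝕜] [NormedAddCommGroup V] [NormedSpace 𝕜 V]
    [NormedAddCommGroup V'] [NormedSpace 𝕜 V'] : VFGerm 𝕜 (V × V') →ₗ[𝕜] VFGerm 𝕜 V where
  toFun W := mk (fun v => (W.rep (v, 0)).1) W.analyticAt_fst_rep
  map_add' W W' := by
    rw [add_mk]
    refine mk_eq_mk.2 ?_
    have hc : Tendsto (fun v : V => (v, (0 : V'))) (𝓝 0) (𝓝 0) :=
      Continuous.tendsto_zero (by fun_prop) rfl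
    filter_upwards [hc.eventually (rep_add W W')] with v hv
    rw [hv]; rfl
  map_smul' c W := by
    rw [RingHom.id_apply, smul_mk]
    refine mk_eq_mk.2 ?_
    have hc : Tendsto (fun v : V => (v, (0 : V'))) (𝓝 0) (𝓝 0) :=
      Continuous.tendsto_zero (by fun_prop) rfl
    filter_upwards [hc.eventually (rep_smul c W)] with v hv
    rw [hv]; rfl

theorem fstPart_directSum (g : VFGerm 𝕜 V) (g' : VFGerm 𝕜 V') :
    fstPart 𝕜 V V' (g.directSum g') = g := by
  refine ext_rep ((rep_eq_of_eq_mk (hL := analyticAt_fst_rep _) rfl).trans ?_)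
  have hc : Tendsto (fun v : V => (v, (0 : V'))) (𝓝 0) (𝓝 0) :=
    Continuous.tendsto_zero (by fun_prop) rfl
  filter_upwards [hc.eventually (rep_directSum g g')] with v hv
  rw [hv]

/-- The component in the second space of the restriction of a vector field to it. -/
noncomputable def sndPart (𝕜 V V' : Type*) [RCLike 𝕜] [NormedAddCommGroup V] [NormedSpace 𝕜 V]
    [NormedAddCommGroup V'] [NormedSpace 𝕜 V'] : VFGerm 𝕜 (V × V') →ₗ[𝕜] VFGerm 𝕜 V' where
  toFun W := mk (fun v => (W.rep (0, v)).2) W.analyticAt_snd_rep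
  map_add' W W' := by
    rw [add_mk]
    refine mk_eq_mk.2 ?_
    have hc : Tendsto (fun v : V' => ((0 : V), v)) (𝓝 0) (𝓝 0) :=
      Continuous.tendsto_zero (by fun_prop) rfl
    filter_upwards [hc.eventually (rep_add W W')] with v hv
    rw [hv]; rfl
  map_smul' c W := by
    rw [RingHom.id_apply, smul_mk]
    refine mk_eq_mk.2 ?_
    have hc : Tendsto (fun v : V' => ((0 : V), v)) (𝓝 0) (𝓝 0) :=
      Continuous.tendsto_zero (by fun_prop) rfl
    filter_upwards [hc.eventually (rep_smul c W)] with v hv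
    rw [hv]; rfl

theorem sndPart_directSum (g : VFGerm 𝕜 V) (g' : VFGerm 𝕜 V') :
    sndPart 𝕜 V V' (g.directSum g') = g' := by
  refine ext_rep ((rep_eq_of_eq_mk (hL := analyticAt_snd_rep _) rfl).trans ?_)
  have hc : Tendsto (fun v : V' => ((0 : V), v)) (𝓝 0) (𝓝 0) :=
    Continuous.tendsto_zero (by fun_prop) rfl
  filter_upwards [hc.eventually (rep_directSum g g')] with v hv
  rw [hv]

end VFGerm

/-- A linear map that is injective and multiplicative on a Lie subalgebra is an isomorphism of the
subalgebra onto its image. -/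
theorem LieSubalgebra.exists_equiv_image {R A B : Type*} [CommRing R] [LieRing A] [LieAlgebra R A]
    [LieRing B] [LieAlgebra R B] (S : LieSubalgebra R A) (f : A →ₗ[R] B)
    (hf : ∀ x ∈ S, ∀ y ∈ S, f ⁅x, y⁆ = ⁅f x, f y⁆) (hinj : ∀ x ∈ S, f x = 0 → x = 0) :
    ∃ T : LieSubalgebra R B, (T : Set B) = f '' S ∧
      ∃ e : S ≃ₗ⁅R⁆ T, ∀ x : S, (e x : B) = f x := by
  let φ : S →ₗ⁅R⁆ B :=
    { (f.comp S.toSubmodule.subtype) with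
      map_lie' := fun {x y} => hf x x.2 y y.2 }
  have hφ : Function.Injective φ := by
    rw [injective_iff_map_eq_zero]
    intro x hx
    exact Subtype.ext (hinj x x.2 hx)
  refine ⟨φ.range, ?_, LieEquiv.ofInjective φ hφ, fun x => rfl⟩
  ext b
  constructor
  · rintro ⟨x, rfl⟩
    exact ⟨x, x.2, rfl⟩
  · rintro ⟨x, hx, rfl⟩
    exact ⟨⟨x, hx⟩, rfl⟩

/-- If the image of the local projection `a ↦ a + ι (ρ a)` lies in `{ρ = 0}`, a function vanishing
on `{ρ = 0}` has vanishing derivative along `ker dρ`. -/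
theorem eventually_fderiv_eq_zero_of_zero_set {𝕜 V F G : Type*} [RCLike 𝕜] [NormedAddCommGroup V]
    [NormedSpace 𝕜 V] [NormedAddCommGroup F] [NormedSpace 𝕜 F] [CompleteSpace F]
    [NormedAddCommGroup G] [NormedSpace 𝕜 G] [CompleteSpace G] {ρ : V → F} {g : V → G} {ι : F →L[𝕜] V}
    (hρ : AnalyticAt 𝕜 ρ 0) (hι : ∀ a, ρ (a + ι (ρ a)) = 0) (hg : AnalyticAt 𝕜 g 0)
    (h : ∀ᶠ a in 𝓝 0, ρ a = 0 → g a = 0) :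
    ∀ᶠ a in 𝓝 0, ρ a = 0 → ∀ v, fderiv 𝕜 ρ a v = 0 → fderiv 𝕜 g a v = 0 := by
  filter_upwards [h.eventually_nhds, hρ.eventually_analyticAt, hg.eventually_analyticAt]
    with a h1 h2 h3 ha v hv
  -- The derivative of this map is the identity on ker dρ, so differentiating g composed with it,
  -- which is zero, gives dg = 0 on that kernel.
  have hπ : HasFDerivAt (fun b => b + ι (ρ b))
      (ContinuousLinearMap.id 𝕜 V + ι.comp (fderiv 𝕜 ρ a)) a :=
    (hasFDerivAt_id a).add (ι.hasFDerivAt.comp a h2.differentiableAt.hasFDerivAt)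
  have ha' : a + ι (ρ a) = a := by rw [ha, map_zero, add_zero]
  have h4 : HasFDerivAt (fun b => g (b + ι (ρ b)))
      ((fderiv 𝕜 g a).comp (ContinuousLinearMap.id 𝕜 V + ι.comp (fderiv 𝕜 ρ a))) a := by
    refine HasFDerivAt.comp a ?_ hπ
    rw [ha']; exact h3.differentiableAt.hasFDerivAt
  have h5 : ∀ᶠ b in 𝓝 a, g (b + ι (ρ b)) = 0 := by
    have hc : Tendsto (fun b => b + ι (ρ b)) (𝓝 a) (𝓝 a) := by
      have := hπ.continuousAt.tendsto; rwa [ha'] at this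
    filter_upwards [hc.eventually h1] with b hb using hb (hι b)
  have h6 := h4.unique ((hasFDerivAt_const (0 : G) a).congr_of_eventuallyEq h5)
  have h7 := DFunLike.congr_fun h6 v
  simpa [hv] using h7

variable {𝕜 : Type*} [RCLike 𝕜] {n m p : ℕ} {I : JetIndex n m p}

theorem directSum_mem_twinSymSet_iff {ρ : Ambient 𝕜 n m p → Fin m → 𝕜}
    {g : VFGerm 𝕜 ((Fin n → 𝕜) × (Fin m → 𝕜))} {g' : VFGerm 𝕜 ((Fin p → 𝕜) × (Fin m → 𝕜))} :
    g.directSum g' ∈ twinSymSet ρ ↔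
      ∀ᶠ w in 𝓝 (0 : Ambient 𝕜 n m p), ρ w = 0 → fderiv 𝕜 ρ w (g.rep w.1, g'.rep w.2) = 0 := by
  constructor
  · rintro ⟨-, h⟩
    filter_upwards [h, VFGerm.rep_directSum g g'] with w h1 h2
    rwa [h2] at h1
  · intro h
    refine ⟨⟨g, g', rfl⟩, ?_⟩
    filter_upwards [h, VFGerm.rep_directSum g g'] with w h1 h2
    rwa [h2]

/-- For the bracket: dρ(W₁) vanishes on {ρ = 0} and W₂ is tangent there, so its derivative along W₂
vanishes, and likewise with the roles exchanged. Subtracting, the Hessian terms of ρ cancel by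
symmetry and leave dρ([W₁, W₂]) = 0. -/
theorem exists_lieSubalgebra_twinSymSet {ρ : Ambient 𝕜 n m p → Fin m → 𝕜}
    {ι : (Fin m → 𝕜) →L[𝕜] Ambient 𝕜 n m p} (hρ : AnalyticAt 𝕜 ρ 0)
    (hι : ∀ a, ρ (a + ι (ρ a)) = 0) :
    ∃ S : LieSubalgebra 𝕜 (VFGerm 𝕜 (Ambient 𝕜 n m p)),
      (S : Set (VFGerm 𝕜 (Ambient 𝕜 n m p))) = twinSymSet ρ := by
  refine ⟨{ carrier := twinSymSet ρ, add_mem' := ?_, zero_mem' := ?_, smul_mem' := ?_,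
            lie_mem' := ?_ }, rfl⟩
  · rintro W₁ W₂ ⟨⟨g, g', rfl⟩, h1⟩ ⟨⟨h, h', rfl⟩, h2⟩
    refine ⟨⟨_, _, VFGerm.directSum_add _ _ _ _⟩, ?_⟩
    filter_upwards [h1, h2, VFGerm.rep_add (g.directSum g') (h.directSum h')] with w h3 h4 h5 hw
    rw [h5, map_add, h3 hw, h4 hw, add_zero]
  · refine ⟨⟨_, _, VFGerm.directSum_zero⟩, ?_⟩
    filter_upwards [VFGerm.rep_zero (𝕜 := 𝕜) (V := Ambient 𝕜 n m p)] with w h1 _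
    rw [h1, map_zero]
  · rintro c W ⟨⟨g, g', rfl⟩, h1⟩
    refine ⟨⟨_, _, VFGerm.directSum_smul _ _ _⟩, ?_⟩
    filter_upwards [h1, VFGerm.rep_smul c (g.directSum g')] with w h3 h5 hw
    rw [h5, map_smul, h3 hw, smul_zero]
  · rintro W₁ W₂ ⟨⟨g, g', hg⟩, h1⟩ ⟨⟨h, h', hh⟩, h2⟩
    refine ⟨⟨_, _, by rw [hg, hh]; exact VFGerm.directSum_lie _ _ _ _⟩, ?_⟩
    have ha : ∀ W : VFGerm 𝕜 (Ambient 𝕜 n m p),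
        AnalyticAt 𝕜 (fun w => fderiv 𝕜 ρ w (W.rep w)) 0 :=
      fun W => hρ.fderiv.clm_apply_vec W.rep_analytic
    have hd : ∀ W : VFGerm 𝕜 (Ambient 𝕜 n m p), ∀ᶠ w in 𝓝 0, ∀ v,
        fderiv 𝕜 (fun w => fderiv 𝕜 ρ w (W.rep w)) w v =
          fderiv 𝕜 ρ w (fderiv 𝕜 W.rep w v) + fderiv 𝕜 (fderiv 𝕜 ρ) w v (W.rep w) := by
      intro W
      filter_upwards [hρ.eventually_analyticAt, W.rep_analytic.eventually_analyticAt]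
        with w h3 h4 v
      rw [fderiv_clm_apply h3.fderiv.differentiableAt h4.differentiableAt]
      rfl
    filter_upwards [h1, h2, VFGerm.rep_lie W₁ W₂, hd W₁, hd W₂, hρ.eventually_analyticAt,
      eventually_fderiv_eq_zero_of_zero_set hρ hι (ha W₁) h1,
      eventually_fderiv_eq_zero_of_zero_set hρ hι (ha W₂) h2] with w e1 e2 e3 e4 e5 e6 e7 e8 hw
    have e9 := e7 hw _ (e2 hw)
    have e10 := e8 hw _ (e1 hw)
    rw [e4] at e9
    rw [e5] at e10
    have e11 : fderiv 𝕜 (fderiv 𝕜 ρ) w (W₁.rep w) (W₂.rep w) =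
        fderiv 𝕜 (fderiv 𝕜 ρ) w (W₂.rep w) (W₁.rep w) :=
      (e6.contDiffAt (n := ⊤)).isSymmSndFDerivAt (by simp) _ _
    rw [e3, VectorField.lieBracket, map_sub, sub_eq_zero]
    rw [e11] at e10
    exact add_right_cancel (e10.trans e9.symm)

/-- Tangency is independent of the defining function: ρ' vanishes where ρ does, so dρ' vanishes on
ker dρ along the common zero set. -/
theorem twinSymSet_subset {ρ ρ' : Ambient 𝕜 n m p → Fin m → 𝕜}
    {ι : (Fin m → 𝕜) →L[𝕜] Ambient 𝕜 n m p} (hρ : AnalyticAt 𝕜 ρ 0)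
    (hι : ∀ a, ρ (a + ι (ρ a)) = 0) (hρ' : AnalyticAt 𝕜 ρ' 0)
    (h : ∀ᶠ a in 𝓝 0, ρ a = 0 → ρ' a = 0) (h' : ∀ᶠ a in 𝓝 0, ρ' a = 0 → ρ a = 0) :
    twinSymSet ρ ⊆ twinSymSet ρ' := by
  rintro W ⟨hW, ht⟩
  refine ⟨hW, ?_⟩
  filter_upwards [ht, h', eventually_fderiv_eq_zero_of_zero_set hρ hι hρ' h] with a h1 h2 h3 ha
  exact h3 (h2 ha) _ (h1 (h2 ha))

theorem directSum_mem_symSubmanifold_iff {P : DefMap 𝕜 n m p}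
    {g : VFGerm 𝕜 ((Fin n → 𝕜) × (Fin m → 𝕜))} {g' : VFGerm 𝕜 ((Fin p → 𝕜) × (Fin m → 𝕜))} :
    g.directSum g' ∈ symSubmanifold P ↔ P.IsTangent g.rep g'.rep :=
  directSum_mem_twinSymSet_iff

/-- Swapping the two factors of the ambient space turns dual tangency into the tangency condition
for Π*, so results proved for P can be reused. -/
theorem directSum_mem_symDualSubmanifold_iff {Ps : DefMap 𝕜 p m n}
    {g : VFGerm 𝕜 ((Fin n → 𝕜) × (Fin m → 𝕜))} {g' : VFGerm 𝕜 ((Fin p → 𝕜) × (Fin m → 𝕜))} :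
    g.directSum g' ∈ symDualSubmanifold Ps ↔ Ps.IsTangent g'.rep g.rep := by
  let σ : Ambient 𝕜 n m p ≃L[𝕜] Ambient 𝕜 p m n := ContinuousLinearEquiv.prodComm 𝕜 _ _
  have hσ : ∀ w v, fderiv 𝕜 (fun w => Ps.rho (σ w)) w v = fderiv 𝕜 Ps.rho (σ w) (σ v) := by
    intro w v
    have h := σ.comp_right_fderiv (f := Ps.rho) (x := w)
    exact DFunLike.congr_fun h v
  refine directSum_mem_twinSymSet_iff.trans ?_
  change (∀ᶠ w in 𝓝 (0 : Ambient 𝕜 n m p), Ps.rho (σ w) = 0 →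
    fderiv 𝕜 (fun w => Ps.rho (σ w)) w (g.rep w.1, g'.rep w.2) = 0) ↔ _
  simp only [hσ]
  constructor
  · intro h
    have hc : Tendsto (fun w : Ambient 𝕜 p m n => σ.symm w) (𝓝 0) (𝓝 0) :=
      Continuous.tendsto_zero σ.symm.continuous (map_zero _)
    filter_upwards [hc.eventually h] with w hw
    exact hw
  · intro h
    have hc : Tendsto (fun w : Ambient 𝕜 n m p => σ w) (𝓝 0) (𝓝 0) :=
      Continuous.tendsto_zero σ.continuous (map_zero _)
    filter_upwards [hc.eventually h] with w hw
    exact hw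

theorem DefMap.IsTangent.congr {P : DefMap 𝕜 n m p}
    {L M : (Fin n → 𝕜) × (Fin m → 𝕜) → (Fin n → 𝕜) × (Fin m → 𝕜)}
    {L' M' : (Fin p → 𝕜) × (Fin m → 𝕜) → (Fin p → 𝕜) × (Fin m → 𝕜)} (h : P.IsTangent L L')
    (hL : L =ᶠ[𝓝 0] M) (hL' : L' =ᶠ[𝓝 0] M') : P.IsTangent M M' := by
  filter_upwards [h, (continuous_fst.tendsto (0 : Ambient 𝕜 n m p)).eventually hL,
    (continuous_snd.tendsto (0 : Ambient 𝕜 n m p)).eventually hL'] with w h1 h2 h3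
  rwa [← h2, ← h3]

namespace PDESystem

variable {E : PDESystem 𝕜 I} {P : DefMap 𝕜 n m p}

theorem IsAssociatedWith.mem_symSet_iff (h : E.IsAssociatedWith P) (h0 : P.jetMap I 0 = 0)
    {g : VFGerm 𝕜 ((Fin n → 𝕜) × (Fin m → 𝕜))} :
    g ∈ E.symSet ↔ ∃ g' : VFGerm 𝕜 ((Fin p → 𝕜) × (Fin m → 𝕜)), P.IsTangent g.rep g'.rep := by
  constructor
  · rintro ⟨L, hL, rfl, hs⟩
    obtain ⟨L', hL', ht⟩ := h.exists_isTangent h0 hs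
    exact ⟨VFGerm.mk L' hL', ht.congr (VFGerm.rep_mk hL).symm (VFGerm.rep_mk hL').symm⟩
  · rintro ⟨g', ht⟩
    exact ⟨g.rep, g.rep_analytic, (VFGerm.mk_rep g).symm,
      h.isInfinitesimalSymmetry h0 ht g.rep_analytic g'.rep_analytic⟩

theorem IsAssociatedWith.eq_zero_of_isTangent (h : E.IsAssociatedWith P) (h0 : P.jetMap I 0 = 0)
    {g' : VFGerm 𝕜 ((Fin p → 𝕜) × (Fin m → 𝕜))}
    (ht : P.IsTangent (0 : VFGerm 𝕜 ((Fin n → 𝕜) × (Fin m → 𝕜))).rep g'.rep) : g' = 0 :=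
  VFGerm.ext_rep ((h.eq_zero_of_isTangent_zero h0 g'.rep_analytic
    (ht.congr VFGerm.rep_zero EventuallyEq.rfl)).trans VFGerm.rep_zero.symm)

end PDESystem

end LieAlgebras

/-! ### Assembly of the duality. -/

theorem theorem9p13 {𝕜 : Type*} [RCLike 𝕜] {n m p : ℕ} (hn : 1 ≤ n) (hm : 1 ≤ m) (hp : 1 ≤ p)
    (I : JetIndex n m p) (E : PDESystem 𝕜 I) (hE : E.CompletelyIntegrable)
    (P : DefMap 𝕜 n m p) (hP : E.IsSubmanifoldOfSolutions P)
    (Ps : DefMap 𝕜 p m n) (hPs : IsDualMap P Ps)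
    (hpar : P.SolvableWrtParameters I)
    (J : JetIndex p m n) (hvar : Ps.SolvableWrtVariables J) :
    (∃ Es : PDESystem 𝕜 J, Es.CompletelyIntegrable ∧ Es.IsAssociatedWith Ps) ∧
    ∀ Es : PDESystem 𝕜 J, Es.IsAssociatedWith Ps →
      ∃ (symE : LieSubalgebra 𝕜 (VFGerm 𝕜 ((Fin n → 𝕜) × (Fin m → 𝕜))))
        (symM symMs : LieSubalgebra 𝕜 (VFGerm 𝕜 (Ambient 𝕜 n m p)))
        (symEs : LieSubalgebra 𝕜 (VFGerm 𝕜 ((Fin p → 𝕜) × (Fin m → 𝕜)))),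
        (symE : Set (VFGerm 𝕜 ((Fin n → 𝕜) × (Fin m → 𝕜)))) = E.symSet ∧
        (symM : Set (VFGerm 𝕜 (Ambient 𝕜 n m p))) = symSubmanifold P ∧
        (symMs : Set (VFGerm 𝕜 (Ambient 𝕜 n m p))) = symDualSubmanifold Ps ∧
        (symEs : Set (VFGerm 𝕜 ((Fin p → 𝕜) × (Fin m → 𝕜)))) = Es.symSet ∧
        symM = symMs ∧
        ∃ (e : symE ≃ₗ⁅𝕜⁆ symM) (es : symMs ≃ₗ⁅𝕜⁆ symEs),
          ∀ (W : VFGerm 𝕜 (Ambient 𝕜 n m p)) (hW : W ∈ symM) (hWs : W ∈ symMs),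
            W = VFGerm.directSum (e.symm ⟨W, hW⟩).1 (es ⟨W, hWs⟩).1 := by
  obtain ⟨hsolved, hj0⟩ := hP.solvedBy hE
  have hassoc : E.IsAssociatedWith P := ⟨hpar.2, hsolved⟩
  obtain ⟨hPa, hPsa, -, -, hd1, hd2⟩ := hPs
  -- The multiple flow starts at y = b when x = 0, so P(0, a, 0) = 0; inverting gives Π*(a, 0, 0) =
  -- 0, the zero solution of the dual system.
  have hPs0 : ∀ᶠ a in 𝓝 0, Ps a 0 = 0 := by
    obtain ⟨Ω, -, -, hinit, -⟩ := hP
    have hc1 : Tendsto (fun a : Fin p → 𝕜 => (a, (0 : Fin m → 𝕜))) (𝓝 0) (𝓝 0) :=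
      Continuous.tendsto_zero (by fun_prop) rfl
    have hc2 : Tendsto (fun a : Fin p → 𝕜 => ((0 : Fin n → 𝕜), a, (0 : Fin m → 𝕜))) (𝓝 0) (𝓝 0) :=
      Continuous.tendsto_zero (by fun_prop) rfl
    filter_upwards [hc1.eventually hinit, hc2.eventually hd1] with a h1 h2
    rw [h1.1] at h2
    exact h2
  have hjs0 : Ps.jetMap J 0 = 0 :=
    (DefMap.jetMap_eq_of_eventually_eq_zero hPs0 J).self_of_nhds
  constructor
  · obtain ⟨Es, hEs⟩ := hvar.exists_isAssociatedWith hPsa hPs0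
    exact ⟨Es, hEs.completelyIntegrable hjs0, hEs⟩
  intro Es hEs
  let ρs : Ambient 𝕜 n m p → Fin m → 𝕜 := fun w => -w.2.2 + Ps w.2.1 w.1
  have hρs : AnalyticAt 𝕜 ρs 0 :=
    AnalyticAt.comp_of_eq (g := Ps.rho) (f := fun w : Ambient 𝕜 n m p => (w.2, w.1)) hPsa.rho
      (analyticAt_snd.prod analyticAt_fst) rfl
  -- Adding ρ in the y-slot (in the b-slot for the dual function) projects the ambient space onto
  -- the graph, since ρ is -y + P.
  let ι : (Fin m → 𝕜) →L[𝕜] Ambient 𝕜 n m p :=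
    (ContinuousLinearMap.inl 𝕜 _ _).comp (ContinuousLinearMap.inr 𝕜 _ _)
  let ιs : (Fin m → 𝕜) →L[𝕜] Ambient 𝕜 n m p :=
    (ContinuousLinearMap.inr 𝕜 _ _).comp (ContinuousLinearMap.inr 𝕜 _ _)
  have hι : ∀ a, P.rho (a + ι (P.rho a)) = 0 := by
    intro a
    simp [ι, DefMap.rho]
  have hιs : ∀ a, ρs (a + ιs (ρs a)) = 0 := by
    intro a
    simp [ιs, ρs]
  have hz1 : ∀ᶠ a in 𝓝 0, P.rho a = 0 → ρs a = 0 := by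
    have hc : Tendsto (fun w : Ambient 𝕜 n m p => (w.1.1, w.2)) (𝓝 0) (𝓝 0) :=
      Continuous.tendsto_zero (by fun_prop) rfl
    filter_upwards [hc.eventually hd1] with w h1 h2
    have h3 : w.1.2 = P w.1.1 w.2 := neg_add_eq_zero.1 h2
    rw [← h3] at h1
    exact neg_add_eq_zero.2 h1.symm
  have hz2 : ∀ᶠ a in 𝓝 0, ρs a = 0 → P.rho a = 0 := by
    have hc : Tendsto (fun w : Ambient 𝕜 n m p => (w.2.1, w.1)) (𝓝 0) (𝓝 0) :=
      Continuous.tendsto_zero (by fun_prop) rfl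
    filter_upwards [hc.eventually hd2] with w h1 h2
    have h3 : w.2.2 = Ps w.2.1 w.1 := neg_add_eq_zero.1 h2
    rw [← h3] at h1
    exact neg_add_eq_zero.2 h1.symm
  have hsets : symSubmanifold P = symDualSubmanifold Ps :=
    Set.Subset.antisymm (twinSymSet_subset hPa.rho hι hρs hz1 hz2)
      (twinSymSet_subset hρs hιs hPa.rho hz2 hz1)
  obtain ⟨S, hS⟩ := exists_lieSubalgebra_twinSymSet hPa.rho hι
  have hSM : (S : Set (VFGerm 𝕜 (Ambient 𝕜 n m p))) = symSubmanifold P := hS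
  have hSt : ∀ g g', VFGerm.directSum g g' ∈ S ↔ P.IsTangent g.rep g'.rep := fun g g' => by
    rw [← SetLike.mem_coe, hSM, directSum_mem_symSubmanifold_iff]
  have hSts : ∀ g g', VFGerm.directSum g g' ∈ S ↔ Ps.IsTangent g'.rep g.rep := fun g g' => by
    rw [← SetLike.mem_coe, hSM, hsets, directSum_mem_symDualSubmanifold_iff]
  have hSd : ∀ W ∈ S, ∃ g g', W = VFGerm.directSum g g' := by
    intro W hW
    rw [← SetLike.mem_coe, hSM] at hW
    exact hW.1
  -- The kernel of the projection to L is trivial by uniqueness of L*; the other projection is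
  -- treated with the dual system.
  obtain ⟨T, hT, f, hf⟩ := S.exists_equiv_image (VFGerm.fstPart 𝕜 _ _) (by
      intro x hx y hy
      obtain ⟨g, g', rfl⟩ := hSd x hx
      obtain ⟨h, h', rfl⟩ := hSd y hy
      rw [VFGerm.directSum_lie, VFGerm.fstPart_directSum, VFGerm.fstPart_directSum,
        VFGerm.fstPart_directSum]) (by
      intro x hx hx0
      obtain ⟨g, g', rfl⟩ := hSd x hx
      rw [VFGerm.fstPart_directSum] at hx0
      subst hx0
      rw [hassoc.eq_zero_of_isTangent hj0 ((hSt _ _).1 hx)]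
      exact VFGerm.directSum_zero.symm)
  obtain ⟨Ts, hTs, fs, hfs⟩ := S.exists_equiv_image (VFGerm.sndPart 𝕜 _ _) (by
      intro x hx y hy
      obtain ⟨g, g', rfl⟩ := hSd x hx
      obtain ⟨h, h', rfl⟩ := hSd y hy
      rw [VFGerm.directSum_lie, VFGerm.sndPart_directSum, VFGerm.sndPart_directSum,
        VFGerm.sndPart_directSum]) (by
      intro x hx hx0
      obtain ⟨g, g', rfl⟩ := hSd x hx
      rw [VFGerm.sndPart_directSum] at hx0
      subst hx0
      rw [hEs.eq_zero_of_isTangent hjs0 ((hSts _ _).1 hx)]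
      exact VFGerm.directSum_zero.symm)
  refine ⟨T, S, S, Ts, ?_, hSM, hSM.trans hsets, ?_, rfl, f.symm, fs, ?_⟩
  · rw [hT]
    ext g
    rw [hassoc.mem_symSet_iff hj0]
    constructor
    · rintro ⟨W, hW, rfl⟩
      obtain ⟨g, g', rfl⟩ := hSd W hW
      rw [VFGerm.fstPart_directSum]
      exact ⟨g', (hSt _ _).1 hW⟩
    · rintro ⟨g', hg'⟩
      exact ⟨g.directSum g', (hSt _ _).2 hg', VFGerm.fstPart_directSum g g'⟩
  · rw [hTs]
    ext g'
    rw [hEs.mem_symSet_iff hjs0]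
    constructor
    · rintro ⟨W, hW, rfl⟩
      obtain ⟨g, g', rfl⟩ := hSd W hW
      rw [VFGerm.sndPart_directSum]
      exact ⟨g, (hSts _ _).1 hW⟩
    · rintro ⟨g, hg⟩
      exact ⟨g.directSum g', (hSts _ _).2 hg, VFGerm.sndPart_directSum g g'⟩
  · intro W hW hWs
    obtain ⟨g, g', rfl⟩ := hSd W hW
    have h1 : (f.symm.symm ⟨_, hW⟩ : VFGerm 𝕜 ((Fin n → 𝕜) × (Fin m → 𝕜))) = g :=
      (hf _).trans (VFGerm.fstPart_directSum g g')
    have h2 : (fs ⟨_, hWs⟩ : VFGerm 𝕜 ((Fin p → 𝕜) × (Fin m → 𝕜))) = g' :=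
      (hfs _).trans (VFGerm.sndPart_directSum g g')
    rw [h1, h2]
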